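/- Let $\Omega\subseteq\mathbb{C}$ be a domain (a non-empty connected open set) of infinite connectivity, that is, the complement of $\Omega$ in the Riemann sphere $\hat{\mathbb{C}}=\mathbb{C}\cup\{\infty\}$ has infinitely many connected components. Let $\mathcal{H}_{l.u.}(\Omega)$ denote the set of all locally univalent holomorphic functions on $\Omega$, i.e. of all holomorphic $f:\Omega\to\mathbb{C}$ with $f'(z)\neq 0$ for all $z\in\Omega$, equipped with the topology of locally uniform convergence. A compact set $K\subseteq\Omega$ is called $\mathcal{O}$-convex if no connected component of $\Omega\setminus K$ is relatively compact in $\Omega$. Let $\Phi$ be a family of locally univalent self-maps of $\Omega$ (holomorphic maps $\phi:\Omega\to\Omega$ with nowhere vanishing derivative). A function $G\in\mathcal{H}_{l.u.}(\Omega)$ is called $\Phi$-universal in $\mathcal{H}_{l.u.}(\Omega)$ if $\{G\circ\phi : \phi\in\Phi\}$ is a dense subset of $\mathcal{H}_{l.u.}(\Omega)$. Suppose that there exists a sequence $(\phi_n)$ in $\Phi$ such that (i) $(\phi_n)$ is eventually injective: for every compact set $K\subseteq\Omega$ there exists $N\in\mathbb{N}$ such that $\phi_n|_K$ is injective for all $n\ge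 N$; and (ii) for every $\mathcal{O}$-convex compact set $K\subseteq\Omega$ and every $N\in\mathbb{N}$ there exists $n\ge N$ such that $\phi_n(K)\cap K=\emptyset$ and $\phi_n(K)\cup K$ is $\mathcal{O}$-convex. Then there is a $\Phi$-universal function in $\mathcal{H}_{l.u.}(\Omega)$, and the set of all such functions is a dense $G_\delta$-subset of $\mathcal{H}_{l.u.}(\Omega)$. -/

import Mathlib

/-- A domain in the complex plane: a non-empty connected open set. -/
def IsPlaneDomain (Ω : Set ℂ) : Prop := IsOpen Ω ∧ IsConnected Ω

/-- `Ω` has infinite connectivity: its complement in the Riemann sphere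
`ℂ ∪ {∞}` has infinitely many connected components. -/
def HasInfiniteConnectivity (Ω : Set ℂ) : Prop :=
  Infinite (ConnectedComponents
    ↥(((fun z : ℂ => (z : OnePoint ℂ)) '' Ω)ᶜ : Set (OnePoint ℂ)))

/-- A function `f : Ω → ℂ` on an open set `Ω` is holomorphic and locally univalent:
it is holomorphic with nowhere vanishing derivative. The function `F` extends `f` to all
of `ℂ` by arbitrary values; only its restriction to the open set `Ω` matters. -/
def IsLocallyUnivalent (Ω : Set ℂ) (f : Ω → ℂ) : Prop :=
  ∃ F : ℂ → ℂ, DifferentiableOn ℂ F Ω ∧ (∀ z ∈ Ω, deriv F z ≠ 0) ∧ ∀ z : Ω, F z = f z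

/-- The set of all locally univalent holomorphic functions on `Ω`, as a subset of the
space `C(Ω, ℂ)`, whose compact-open topology is that of locally uniform convergence. -/
def locallyUnivalentFunctions (Ω : Set ℂ) : Set C(Ω, ℂ) :=
  {f | IsLocallyUnivalent Ω f}

/-- The set of all locally univalent (holomorphic) self-maps of `Ω`. -/
def locallyUnivalentSelfMaps (Ω : Set ℂ) : Set C(Ω, Ω) :=
  {φ | IsLocallyUnivalent Ω (fun z => (φ z : ℂ))}

/-- `G` is `Φ`-universal in `𝒢`: it belongs to `𝒢`, and `{G ∘ φ | φ ∈ Φ}` is a dense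
subset of `𝒢` (for the topology of locally uniform convergence). -/
def IsUniversalIn {Ω : Set ℂ} (Φ : Set C(Ω, Ω)) (𝒢 : Set C(Ω, ℂ)) (G : C(Ω, ℂ)) : Prop :=
  G ∈ 𝒢 ∧ {f | ∃ φ ∈ Φ, G.comp φ = f} ⊆ 𝒢 ∧ 𝒢 ⊆ closure {f | ∃ φ ∈ Φ, G.comp φ = f}

/-- For every compact `K ⊆ Ω`, all but finitely many `φ n` are injective on `K`. -/
def EventuallyInjective {Ω : Set ℂ} (φ : ℕ → C(Ω, Ω)) : Prop :=
  ∀ K : Set Ω, IsCompact K → ∃ N : ℕ, ∀ n ≥ N, Set.InjOn (φ n) K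

/-- `K ⊆ Ω` is an `𝒪`-convex compact set: it is compact and no connected component of
`Ω \ K` is relatively compact in `Ω`. Here the space `Ω` carries its subspace topology, so
complement and closure are taken in `Ω`. -/
def IsOConvexCompact {Ω : Set ℂ} (K : Set Ω) : Prop :=
  IsCompact K ∧ ∀ z ∈ Kᶜ, ¬ IsCompact (closure (connectedComponentIn Kᶜ z))

/-!
By Hurwitz' theorem the locally univalent functions form an open subset of their closure, hence a
Baire space, and the universal functions are a countable intersection of open subsets of it. By
Baire's theorem it remains to find a locally univalent `h` close to `f` on a given compact set `K`
and such that `h ∘ φ n` is close to `g` there. Enlarging `K`, one may assume that it is connected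
and `𝒪`-convex; then `h` has to be close to `f` on `K` and to `g ∘ (φ n)⁻¹` on `φ n '' K`.

Runge's theorem for nowhere vanishing functions approximates the prescribed derivative by a nowhere
vanishing holomorphic function on `Ω`. Multiplying it by the exponential of a combination of
finitely many holomorphic functions, with coefficients from the implicit function theorem and
Liouville's theorem, annihilates its periods and nearly gives its primitive the prescribed increment
between the two disjoint continua.
-/

open MeasureTheory Complex Set Topology Filter Metric
open scoped ContDiff

section Dbar

/-- The Wirtinger derivative `∂χ/∂z̄`. -/
noncomputable def dbar (χ : ℂ → ℂ) (z : ℂ) : ℂ := (fderiv ℝ χ z 1 + I * fderiv ℝ χ z I) / 2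

theorem continuous_dbar {χ : ℂ → ℂ} (hχ : ContDiff ℝ 1 χ) : Continuous (dbar χ) := by
  have := hχ.continuous_fderiv (by simp)
  unfold dbar
  fun_prop

theorem tsupport_dbar_subset (χ : ℂ → ℂ) : tsupport (dbar χ) ⊆ tsupport (fderiv ℝ χ) :=
  tsupport_comp_subset (g := fun T : ℂ →L[ℝ] ℂ => (T 1 + I * T I) / 2) (by simp) _

theorem hasCompactSupport_dbar {χ : ℂ → ℂ} (hc : HasCompactSupport χ) :
    HasCompactSupport (dbar χ) :=
  (hc.fderiv ℝ).mono' ((subset_tsupport _).trans (tsupport_dbar_subset χ))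

theorem tsupport_fderiv_apply_subset_tsupport_fderiv (χ : ℂ → ℂ) (v : ℂ) :
    tsupport (fderiv ℝ χ · v) ⊆ tsupport (fderiv ℝ χ) :=
  tsupport_comp_subset (g := fun T : ℂ →L[ℝ] ℂ => T v) (by simp) _

theorem notMem_tsupport_fderiv_of_eventually_eq_const {χ : ℂ → ℂ} {z c : ℂ}
    (h : ∀ᶠ w in 𝓝 z, χ w = c) : z ∉ tsupport (fderiv ℝ χ) := by
  rw [notMem_tsupport_iff_eventuallyEq]
  filter_upwards [h.eventually_nhds] with w (hw : χ =ᶠ[𝓝 w] fun _ => c)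
  simp [hw.fderiv_eq]

theorem integrable_smul_of_tsupport_subset {E : Type*} [NormedAddCommGroup E] [NormedSpace ℂ E]
    {a : ℂ → ℂ} {F : ℂ → E} {U : Set ℂ} (hU : IsOpen U) (ha : Continuous a)
    (hc : HasCompactSupport a) (hs : tsupport a ⊆ U) (hF : ContinuousOn F U) :
    Integrable fun z => a z • F z :=
  ((ha.continuousOn.smul hF).continuous_of_tsupport_subset hU
    ((tsupport_smul_subset_left a F).trans hs)).integrable_of_hasCompactSupport hc.smul_right

theorem integral_fderiv_mul_eq_neg_deriv {h χ : ℂ → ℂ} {U : Set ℂ} (hU : IsOpen U)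
    (hh : DifferentiableOn ℂ h U) (hχ : ContDiff ℝ 1 χ) (hc : HasCompactSupport χ)
    (hs : tsupport χ ⊆ U) (v : ℂ) :
    ∫ z, fderiv ℝ χ z v * h z = -(v * ∫ z, χ z * deriv h z) := by
  have hd : ∀ z ∈ tsupport χ, DifferentiableAt ℂ h z := fun z hz =>
    hh.differentiableAt (hU.mem_nhds (hs hz))
  have : Continuous (fderiv ℝ χ) := hχ.continuous_fderiv (by simp)
  have hfderiv : ∀ z, χ z * fderiv ℝ h z v = v * (χ z * deriv h z) := fun z => by
    by_cases hz : z ∈ tsupport χ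
    · rw [(hd z hz).fderiv_restrictScalars ℝ]
      simp only [ContinuousLinearMap.coe_restrictScalars', fderiv_eq_smul_deriv, smul_eq_mul]
      ring
    · simp [image_eq_zero_of_notMem_tsupport hz]
  have hint : Integrable fun z => χ z * deriv h z :=
    integrable_smul_of_tsupport_subset hU hχ.continuous hc hs (hh.deriv hU).continuousOn
  have hparts := integral_mul_fderiv_eq_neg_fderiv_mul_of_integrable (𝕜 := ℂ) (μ := volume)
    (f := χ) (g := h) (v := v) ?_ ?_ ?_ (fun z _ => hχ.differentiable (by simp) z)
    fun z hz => (hd z hz).restrictScalars ℝ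
  · simp_rw [hfderiv, integral_const_mul] at hparts
    rw [hparts, neg_neg]
  · exact integrable_smul_of_tsupport_subset hU (by fun_prop) (hc.fderiv_apply ℝ v)
      ((tsupport_fderiv_apply_subset ℝ v).trans hs) hh.continuousOn
  · simpa only [hfderiv] using hint.const_mul v
  · exact integrable_smul_of_tsupport_subset hU hχ.continuous hc hs hh.continuousOn

theorem integral_dbar_mul_eq_zero {h χ : ℂ → ℂ} {U : Set ℂ} (hU : IsOpen U)
    (hh : DifferentiableOn ℂ h U) (hχ : ContDiff ℝ 1 χ) (hc : HasCompactSupport χ)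
    (hs : tsupport χ ⊆ U) : ∫ z, dbar χ z * h z = 0 := by
  have : Continuous (fderiv ℝ χ) := hχ.continuous_fderiv (by simp)
  have hint : ∀ v, Integrable fun z => fderiv ℝ χ z v * h z := fun v =>
    integrable_smul_of_tsupport_subset hU (by fun_prop) (hc.fderiv_apply ℝ v)
      ((tsupport_fderiv_apply_subset ℝ v).trans hs) hh.continuousOn
  have hsplit : ∀ z, dbar χ z * h z =
      2⁻¹ * (fderiv ℝ χ z 1 * h z) + I / 2 * (fderiv ℝ χ z I * h z) := fun z => by
    unfold dbar; ring
  simp_rw [hsplit]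
  rw [integral_add ((hint 1).const_mul _) ((hint I).const_mul _), integral_const_mul,
    integral_const_mul, integral_fderiv_mul_eq_neg_deriv hU hh hχ hc hs,
    integral_fderiv_mul_eq_neg_deriv hU hh hχ hc hs]
  linear_combination -(∫ z, χ z * deriv h z) / 2 * I_mul_I

theorem integral_dbar_mul_deriv_eq_zero {r χ : ℂ → ℂ} {U : Set ℂ} (hU : IsOpen U)
    (hr : DifferentiableOn ℂ r U) (hχ : ContDiff ℝ 2 χ) (hc : HasCompactSupport χ)
    (hs : tsupport (fderiv ℝ χ) ⊆ U) : ∫ z, dbar χ z * deriv r z = 0 := by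
  have hχ' : ContDiff ℝ 1 (fderiv ℝ χ) := hχ.fderiv_right (by norm_num)
  have hsmooth : ∀ v, ContDiff ℝ 1 (fderiv ℝ χ · v) := fun v => hχ'.clm_apply contDiff_const
  have hsupp : ∀ v, tsupport (fderiv ℝ χ · v) ⊆ U := fun v =>
    (tsupport_fderiv_apply_subset_tsupport_fderiv χ v).trans hs
  have hparts : ∀ u v, ∫ z, fderiv ℝ (fderiv ℝ χ) z u v * r z =
      -(u * ∫ z, fderiv ℝ χ z v * deriv r z) := fun u v => by
    rw [← integral_fderiv_mul_eq_neg_deriv hU hr (hsmooth v) (hc.fderiv_apply ℝ v) (hsupp v)]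
    congr! 3 with z
    rw [fderiv_clm_apply (hχ'.differentiable (by simp) z) (by fun_prop)]
    simp
  have hsymm : ∀ z, fderiv ℝ (fderiv ℝ χ) z I 1 = fderiv ℝ (fderiv ℝ χ) z 1 I := fun z =>
    (hχ.contDiffAt.isSymmSndFDerivAt (by simp)) I 1
  have hint : ∀ v, Integrable fun z => fderiv ℝ χ z v * deriv r z := fun v =>
    integrable_smul_of_tsupport_subset hU (hsmooth v).continuous (hc.fderiv_apply ℝ v) (hsupp v)
      (hr.deriv hU).continuousOn
  have hsplit : ∀ z, dbar χ z * deriv r z =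
      2⁻¹ * (fderiv ℝ χ z 1 * deriv r z) + I / 2 * (fderiv ℝ χ z I * deriv r z) := fun z => by
    unfold dbar; ring
  have hcross := hparts I 1
  simp_rw [hsymm, hparts 1 I] at hcross
  simp_rw [hsplit]
  rw [integral_add ((hint 1).const_mul _) ((hint I).const_mul _), integral_const_mul,
    integral_const_mul]
  linear_combination (-I / 2) * hcross + (∫ z, fderiv ℝ χ z 1 * deriv r z) / 2 * I_sq

/-- The smooth radial cut-off `ρ(|z|²)` with `ρ = 1` on `(-∞, 1]` and `ρ = 0` on `[2, ∞)`, for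
which the integral in Cauchy's formula can be computed explicitly. -/
noncomputable def radialCutoff (z : ℂ) : ℂ := (Real.smoothTransition (2 - ‖z‖ ^ 2) : ℝ)

theorem contDiff_radialCutoff : ContDiff ℝ ∞ radialCutoff :=
  ofRealCLM.contDiff.comp
    (Real.smoothTransition.contDiff.comp (contDiff_const.sub (contDiff_norm_sq ℝ)))

theorem hasCompactSupport_radialCutoff : HasCompactSupport radialCutoff := by
  refine HasCompactSupport.intro (isCompact_closedBall (0 : ℂ) 2) fun z hz => ?_
  rw [mem_closedBall_zero_iff, not_le] at hz
  simp [radialCutoff, Real.smoothTransition.zero_of_nonpos (x := 2 - ‖z‖ ^ 2) (by nlinarith)]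

theorem eventually_radialCutoff_eq_one : ∀ᶠ z in 𝓝 0, radialCutoff z = 1 := by
  filter_upwards [ball_mem_nhds (0 : ℂ) one_pos] with z hz
  rw [mem_ball_zero_iff] at hz
  simp [radialCutoff,
    Real.smoothTransition.one_of_one_le (x := 2 - ‖z‖ ^ 2) (by nlinarith [norm_nonneg z])]

theorem dbar_radialCutoff (z : ℂ) :
    dbar radialCutoff z = -(deriv Real.smoothTransition (2 - ‖z‖ ^ 2) : ℝ) * z := by
  have hρ : HasDerivAt Real.smoothTransition _ (2 - ‖z‖ ^ 2) :=
    (Real.smoothTransition.contDiffAt.differentiableAt one_ne_zero).hasDerivAt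
  have hd := ofRealCLM.hasFDerivAt.comp z
    (hρ.comp_hasFDerivAt z ((hasStrictFDerivAt_norm_sq z).hasFDerivAt.const_sub 2))
  have hfderiv : fderiv ℝ radialCutoff z = _ := hd.fderiv
  simp only [dbar, hfderiv]
  apply Complex.ext <;> simp <;> ring

theorem integral_dbar_radialCutoff_div : ∫ z, dbar radialCutoff z / z = -Real.pi := by
  set ρ' := deriv Real.smoothTransition
  have hρ : ∀ t, HasDerivAt Real.smoothTransition (ρ' t) t := fun t =>
    (Real.smoothTransition.contDiffAt.differentiableAt one_ne_zero).hasDerivAt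
  have hquot : ∀ᵐ z : ℂ, dbar radialCutoff z / z = ((-ρ' (2 - ‖z‖ ^ 2) : ℝ) : ℂ) := by
    filter_upwards [Measure.ae_ne volume (0 : ℂ)] with z hz
    rw [dbar_radialCutoff, mul_div_cancel_right₀ _ hz, ofReal_neg]
  have hFTC : ∫ r in Ioi (0 : ℝ), r ^ (2 - 1) • -ρ' (2 - r ^ 2) = -2⁻¹ := by
    have hd : ∀ r : ℝ, HasDerivAt (fun r : ℝ => Real.smoothTransition (2 - r ^ 2) / 2)
        (r ^ (2 - 1) • -ρ' (2 - r ^ 2)) r := fun r => by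
      refine (((hρ _).comp r ((hasDerivAt_pow 2 r).const_sub 2)).div_const 2).congr_deriv ?_
      simp only [Nat.cast_ofNat, Nat.add_one_sub_one, pow_one, smul_eq_mul]
      ring
    have hneg : ∀ r ∈ Ioi (0 : ℝ), r ^ (2 - 1) • -ρ' (2 - r ^ 2) ≤ 0 := fun r hr =>
      smul_nonpos_of_nonneg_of_nonpos (pow_nonneg (le_of_lt hr) _)
        (neg_nonpos.2 Real.smoothTransition.monotone.deriv_nonneg)
    have hlim : Tendsto (fun r : ℝ => Real.smoothTransition (2 - r ^ 2) / 2) atTop (𝓝 0) := by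
      refine tendsto_const_nhds.congr' ?_
      filter_upwards [eventually_gt_atTop 2] with r hr
      rw [Real.smoothTransition.zero_of_nonpos (by nlinarith), zero_div]
    rw [integral_Ioi_of_hasDerivAt_of_nonpos (hd 0).continuousAt.continuousWithinAt
      (fun r _ => hd r) hneg hlim]
    simp [Real.smoothTransition.one_of_one_le]
  rw [integral_congr_ae hquot, integral_complex_ofReal,
    integral_fun_norm_addHaar volume (fun r => -ρ' (2 - r ^ 2)), finrank_real_complex, hFTC,
    measureReal_def, Complex.volume_ball]
  norm_num [mul_left_comm]

theorem dbar_sub {χ ψ : ℂ → ℂ} {z : ℂ} (hχ : DifferentiableAt ℝ χ z)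
    (hψ : DifferentiableAt ℝ ψ z) : dbar (fun w => χ w - ψ w) z = dbar χ z - dbar ψ z := by
  simp only [dbar, fderiv_fun_sub hχ hψ, sub_apply]
  ring

theorem dbar_const_mul (c : ℂ) {χ : ℂ → ℂ} {z : ℂ} (hχ : DifferentiableAt ℝ χ z) :
    dbar (fun w => c * χ w) z = c * dbar χ z := by
  simp only [dbar, fderiv_const_mul hχ, smul_apply, smul_eq_mul]
  ring

theorem dbar_comp_sub_right (χ : ℂ → ℂ) (a z : ℂ) :
    dbar (fun w => χ (w - a)) z = dbar χ (z - a) := by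
  simp only [dbar, fderiv_comp_sub]

theorem notMem_tsupport_dbar_of_eventually_eq_const {χ : ℂ → ℂ} {z c : ℂ}
    (h : ∀ᶠ w in 𝓝 z, χ w = c) : z ∉ tsupport (dbar χ) := fun hz =>
  notMem_tsupport_fderiv_of_eventually_eq_const h (tsupport_dbar_subset _ hz)

theorem differentiableOn_inv_sub (a : ℂ) : DifferentiableOn ℂ (fun z => (z - a)⁻¹) {a}ᶜ :=
  fun _ hz => ((differentiableAt_id.sub_const a).inv (sub_ne_zero.2 hz)).differentiableWithinAt

theorem integrable_dbar_mul_inv_sub {χ : ℂ → ℂ} (hχ : ContDiff ℝ 1 χ) (hc : HasCompactSupport χ)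
    {a c : ℂ} (hχc : ∀ᶠ z in 𝓝 a, χ z = c) : Integrable fun z => dbar χ z * (z - a)⁻¹ :=
  integrable_smul_of_tsupport_subset isOpen_compl_singleton (continuous_dbar hχ)
    (hasCompactSupport_dbar hc)
    (subset_compl_singleton_iff.2 (notMem_tsupport_dbar_of_eventually_eq_const hχc))
    (differentiableOn_inv_sub a).continuousOn

/-- Subtracting `c` times the translated radial cut-off makes `χ` vanish near `a`, where the
integrand is singular; so only the radial cut-off contributes. -/
theorem integral_dbar_mul_inv_sub {χ : ℂ → ℂ} (hχ : ContDiff ℝ 1 χ) (hc : HasCompactSupport χ)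
    {a c : ℂ} (hχc : ∀ᶠ z in 𝓝 a, χ z = c) :
    ∫ z, dbar χ z * (z - a)⁻¹ = -Real.pi * c := by
  set ψ : ℂ → ℂ := fun z => radialCutoff (z - a)
  have hψ : ContDiff ℝ 1 ψ :=
    (contDiff_radialCutoff.of_le (by simp)).comp (contDiff_id.sub contDiff_const)
  have hψc : HasCompactSupport ψ :=
    hasCompactSupport_radialCutoff.comp_homeomorph (Homeomorph.subRight a)
  have hψ1 : ∀ᶠ z in 𝓝 a, ψ z = 1 :=
    (show Tendsto (· - a) (𝓝 a) (𝓝 0) from tendsto_sub_nhds_zero_iff.2 tendsto_id).eventually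
      eventually_radialCutoff_eq_one
  have hcψ : ContDiff ℝ 1 fun z => c * ψ z := contDiff_const.mul hψ
  have hdiff : tsupport (fun w => χ w - c * ψ w) ⊆ {a}ᶜ := fun z hz => by
    rintro rfl
    refine notMem_tsupport_iff_eventuallyEq.2 ?_ hz
    filter_upwards [hχc, hψ1] with w hw hw1
    simp [hw, hw1]
  have hzero := integral_dbar_mul_eq_zero isOpen_compl_singleton (differentiableOn_inv_sub a)
    (hχ.sub hcψ) (hc.sub hψc.mul_left) hdiff
  have hsplit : ∀ z, dbar (fun w => χ w - c * ψ w) z * (z - a)⁻¹ =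
      dbar χ z * (z - a)⁻¹ - c * (dbar ψ z * (z - a)⁻¹) := fun z => by
    rw [dbar_sub (hχ.differentiable one_ne_zero z) (hcψ.differentiable one_ne_zero z),
      dbar_const_mul c (hψ.differentiable one_ne_zero z)]
    ring
  have hradial : ∫ z, dbar ψ z * (z - a)⁻¹ = -Real.pi := by
    have hψdbar : ∀ z, dbar ψ z = dbar radialCutoff (z - a) := dbar_comp_sub_right _ a
    rw [← integral_dbar_radialCutoff_div,
      ← integral_sub_right_eq_self (fun z => dbar radialCutoff z / z) a]
    exact integral_congr_ae (.of_forall fun z => by simp only [hψdbar, div_eq_mul_inv])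
  simp_rw [hsplit] at hzero
  rw [integral_sub (integrable_dbar_mul_inv_sub hχ hc hχc)
    ((integrable_dbar_mul_inv_sub hψ hψc hψ1).const_mul c), integral_const_mul, hradial] at hzero
  linear_combination hzero

/-- Cauchy's integral formula with a cut-off function in place of a contour. -/
theorem integral_dbar_mul_inv_sub_mul {U : Set ℂ} (hU : IsOpen U) {g χ : ℂ → ℂ}
    (hg : DifferentiableOn ℂ g U) (hχ : ContDiff ℝ 1 χ) (hc : HasCompactSupport χ)
    (hs : tsupport χ ⊆ U) {a : ℂ} (ha : a ∈ U) (hχ1 : ∀ᶠ z in 𝓝 a, χ z = 1) :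
    ∫ z, dbar χ z * ((z - a)⁻¹ * g z) = -Real.pi * g a := by
  have hat : a ∉ tsupport (dbar χ) := notMem_tsupport_dbar_of_eventually_eq_const hχ1
  have hsupp : tsupport (dbar χ) ⊆ U \ {a} := fun w hw =>
    ⟨hs (tsupport_fderiv_subset ℝ (tsupport_dbar_subset _ hw)), fun h => hat (h ▸ hw)⟩
  have hint : Integrable fun z => dbar χ z * ((z - a)⁻¹ * g z) :=
    integrable_smul_of_tsupport_subset (hU.sdiff isClosed_singleton) (continuous_dbar hχ)
      (hasCompactSupport_dbar hc) hsupp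
      (((differentiableOn_inv_sub a).continuousOn.mono fun _ hz => hz.2).mul
        (hg.continuousOn.mono sdiff_subset))
  have hzero := integral_dbar_mul_eq_zero hU
    ((differentiableOn_dslope (hU.mem_nhds ha)).2 hg) hχ hc hs
  have hsplit : ∀ z, dbar χ z * dslope g a z =
      dbar χ z * ((z - a)⁻¹ * g z) - g a * (dbar χ z * (z - a)⁻¹) := fun z => by
    by_cases hz : z = a
    · simp [hz, image_eq_zero_of_notMem_tsupport hat]
    · rw [dslope_of_ne _ hz, slope_def_field]
      ring
  simp_rw [hsplit] at hzero
  rw [integral_sub hint ((integrable_dbar_mul_inv_sub hχ hc hχ1).const_mul _),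
    integral_const_mul, integral_dbar_mul_inv_sub hχ hc hχ1] at hzero
  linear_combination hzero

theorem exists_contDiff_eventually_eq_one_eventually_eq_zero {s t : Set ℂ} (hs : IsClosed s)
    (ht : IsClosed t) (hd : Disjoint s t) :
    ∃ χ : ℂ → ℂ, ContDiff ℝ ∞ χ ∧ (∀ᶠ z in 𝓝ˢ s, χ z = 1) ∧ ∀ᶠ z in 𝓝ˢ t, χ z = 0 := by
  obtain ⟨f, hf0, hf1, -⟩ := exists_contMDiffMap_zero_one_nhds_of_isClosed (n := ⊤)
    (modelWithCornersSelf ℝ ℂ) ht hs hd.symm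
  refine ⟨fun z => f z, ofRealCLM.contDiff.comp f.contMDiff.contDiff, ?_, ?_⟩
  · exact hf1.mono fun z hz => by simp [hz]
  · exact hf0.mono fun z hz => by simp [hz]

theorem exists_contDiff_tsupport_subset_eventually_eq_one {K U : Set ℂ} (hK : IsCompact K)
    (hU : IsOpen U) (hKU : K ⊆ U) :
    ∃ χ : ℂ → ℂ, ContDiff ℝ ∞ χ ∧ HasCompactSupport χ ∧ tsupport χ ⊆ U ∧
      ∀ᶠ z in 𝓝ˢ K, χ z = 1 := by
  obtain ⟨W, hWo, hKW, hWU, hWc⟩ := exists_open_between_and_isCompact_closure hK hU hKU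
  obtain ⟨χ, hχ, hχ1, hχ0⟩ := exists_contDiff_eventually_eq_one_eventually_eq_zero hK.isClosed
    hWo.isClosed_compl (disjoint_compl_right_iff_subset.2 hKW)
  have hs : tsupport χ ⊆ closure W := closure_mono fun z hz => by
    by_contra h
    exact hz (hχ0.self_of_nhdsSet z h)
  exact ⟨χ, hχ, hWc.of_isClosed_subset (isClosed_tsupport _) hs, hs.trans hWU, hχ1⟩

end Dbar

section Runge

theorem integral_mem_of_isClosed {Y X : Type*} [MeasurableSpace Y] {μ : Measure Y}
    [NormedAddCommGroup X] [NormedSpace ℂ X] [CompleteSpace X] {S : Submodule ℂ X}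
    (hS : IsClosed (S : Set X)) {F : Y → X} (hF : Integrable F μ) (h : ∀ y, F y ∈ S) :
    ∫ y, F y ∂μ ∈ S := by
  rw [← S.ker_mkQ, LinearMap.mem_ker, ← Submodule.mkQL_apply, ← S.mkQL.integral_comp_comm hF]
  refine integral_eq_zero_of_ae (.of_forall fun y => ?_)
  simpa using h y

/-- The coordinate function `z ↦ z` on `K`, as an element of `C(K, ℂ)`. -/
noncomputable def coordinate (K : Set ℂ) : C(K, ℂ) := (ContinuousMap.id ℂ).restrict K

theorem mem_resolventSet_coordinate {K : Set ℂ} {w : ℂ} :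
    w ∈ resolventSet ℂ (coordinate K) ↔ w ∉ K := by
  have h : w ∈ spectrum ℂ (coordinate K) ↔ w ∈ K := by
    rw [ContinuousMap.spectrum_eq_range]
    simp [coordinate]
  exact not_iff_not.1 (by simpa [spectrum] using h)

theorem units_inv_apply {X : Type*} [TopologicalSpace X] (u : C(X, ℂ)ˣ) (x : X) :
    ((u⁻¹ : C(X, ℂ)ˣ) : C(X, ℂ)) x = ((u : C(X, ℂ)) x)⁻¹ := by
  refine eq_inv_of_mul_eq_one_left ?_
  rw [← ContinuousMap.mul_apply, Units.inv_mul, ContinuousMap.one_apply]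

theorem resolvent_coordinate_apply {K : Set ℂ} {w : ℂ} (hw : w ∉ K) (z : K) :
    resolvent (coordinate K) w z = (w - z)⁻¹ := by
  rw [spectrum.resolvent_eq (mem_resolventSet_coordinate.2 hw), units_inv_apply]
  simp [coordinate]

theorem continuousOn_resolvent_coordinate (K : Set ℂ) [CompactSpace K] :
    ContinuousOn (resolvent (coordinate K)) Kᶜ := fun _ hw =>
  (spectrum.hasDerivAt_resolvent_const_left
    (mem_resolventSet_coordinate.2 hw)).continuousAt.continuousWithinAt

/-- Cauchy's formula exhibits `g` as an integral of resolvents with values in `C(K, ℂ)`. -/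
theorem exists_mem_topologicalClosure_span_resolvent {K U : Set ℂ} [CompactSpace K]
    (hU : IsOpen U) (hKU : K ⊆ U) {g : ℂ → ℂ} (hg : DifferentiableOn ℂ g U) :
    ∃ r ∈ (Submodule.span ℂ (resolvent (coordinate K) '' Kᶜ)).topologicalClosure,
      ∀ z : K, r z = g z := by
  obtain ⟨χ, hχ, hc, hs, hχ1⟩ := exists_contDiff_tsupport_subset_eventually_eq_one
    (isCompact_iff_compactSpace.2 ‹_›) hU hKU
  set S := Submodule.span ℂ (resolvent (coordinate K) '' Kᶜ)
  have hK : IsClosed K := (isCompact_iff_compactSpace.2 ‹_›).isClosed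
  have hdχ : tsupport (dbar χ) ⊆ U \ K := fun w hw =>
    ⟨hs (tsupport_fderiv_subset ℝ (tsupport_dbar_subset _ hw)), fun hwK =>
      notMem_tsupport_dbar_of_eventually_eq_const (hχ1.filter_mono (nhds_le_nhdsSet hwK)) hw⟩
  set F : ℂ → C(K, ℂ) := fun w => dbar χ w • g w • resolvent (coordinate K) w
  have hF : Integrable F := integrable_smul_of_tsupport_subset (hU.sdiff hK)
    (continuous_dbar (hχ.of_le (by simp))) (hasCompactSupport_dbar hc) hdχ
    ((hg.continuousOn.mono sdiff_subset).smul
      ((continuousOn_resolvent_coordinate K).mono fun w hw => hw.2))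
  have hmem : ∀ w, F w ∈ S.topologicalClosure := fun w => by
    by_cases hw : w ∈ K
    · have : dbar χ w = 0 := image_eq_zero_of_notMem_tsupport fun h => (hdχ h).2 hw
      simp [F, this]
    · exact S.le_topologicalClosure
        (S.smul_mem _ (S.smul_mem _ (Submodule.subset_span ⟨w, hw, rfl⟩)))
  have heval : ∀ z : K, (∫ w, F w) z = -Real.pi * g z := fun z => by
    rw [← integral_dbar_mul_inv_sub_mul hU hg (hχ.of_le (by simp)) hc hs (hKU z.2)
      (hχ1.filter_mono (nhds_le_nhdsSet z.2)), ← ContinuousMap.evalCLM_apply ℂ,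
      ← (ContinuousMap.evalCLM ℂ z).integral_comp_comm hF]
    refine integral_congr_ae (.of_forall fun w => ?_)
    by_cases hw : w ∈ K
    · have : dbar χ w = 0 := image_eq_zero_of_notMem_tsupport fun h => (hdχ h).2 hw
      simp [F, this]
    · simp [F, resolvent_coordinate_apply hw, mul_comm (g w)]
  refine ⟨(-Real.pi : ℂ)⁻¹ • ∫ w, F w, Submodule.smul_mem _ _
    (integral_mem_of_isClosed S.isClosed_topologicalClosure hF hmem), fun z => ?_⟩
  rw [ContinuousMap.smul_apply, heval, smul_eq_mul,
    inv_mul_cancel_left₀ (neg_ne_zero.2 (ofReal_ne_zero.2 Real.pi_ne_zero))]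

theorem exists_eval_div_eval_eq_of_mem_span_resolvent {K : Set ℂ} {r : C(K, ℂ)}
    (hr : r ∈ Submodule.span ℂ (resolvent (coordinate K) '' Kᶜ)) :
    ∃ p q : Polynomial ℂ, ∀ z : K, q.eval (z : ℂ) ≠ 0 ∧ r z = p.eval (z : ℂ) / q.eval (z : ℂ) := by
  induction hr using Submodule.span_induction with
  | mem x hx =>
    obtain ⟨w, hw, rfl⟩ := hx
    refine ⟨1, Polynomial.C w - Polynomial.X, fun z => ⟨?_, ?_⟩⟩
    · simpa [sub_eq_zero] using fun h : w = z => hw (h ▸ z.2)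
    · simp [resolvent_coordinate_apply hw]
  | zero => exact ⟨0, 1, by simp⟩
  | add x y _ _ hx hy =>
    obtain ⟨p, q, h⟩ := hx
    obtain ⟨p', q', h'⟩ := hy
    refine ⟨p * q' + q * p', q * q', fun z => ⟨?_, ?_⟩⟩
    · simpa using ⟨(h z).1, (h' z).1⟩
    · simp only [Polynomial.eval_mul, Polynomial.eval_add, ContinuousMap.add_apply, (h z).2,
        (h' z).2, div_add_div _ _ (h z).1 (h' z).1]
  | smul c x _ hx =>
    obtain ⟨p, q, h⟩ := hx
    exact ⟨Polynomial.C c * p, q, fun z => ⟨(h z).1, by simp [(h z).2, mul_div_assoc]⟩⟩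

theorem exists_rational_approx {K U : Set ℂ} (hK : IsCompact K) (hU : IsOpen U) (hKU : K ⊆ U)
    {g : ℂ → ℂ} (hg : DifferentiableOn ℂ g U) {ε : ℝ} (hε : 0 < ε) :
    ∃ p q : Polynomial ℂ, ∀ z ∈ K, q.eval z ≠ 0 ∧ ‖p.eval z / q.eval z - g z‖ < ε := by
  have : CompactSpace K := isCompact_iff_compactSpace.mp hK
  obtain ⟨r, hr, hrg⟩ := exists_mem_topologicalClosure_span_resolvent hU hKU hg
  obtain ⟨s, hs, hrs⟩ := Metric.mem_closure_iff.1 hr ε hε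
  obtain ⟨p, q, hpq⟩ := exists_eval_div_eval_eq_of_mem_span_resolvent hs
  refine ⟨p, q, fun z hz => ⟨(hpq ⟨z, hz⟩).1, ?_⟩⟩
  rw [← (hpq ⟨z, hz⟩).2, ← hrg ⟨z, hz⟩, ← dist_eq_norm, dist_comm]
  exact (ContinuousMap.dist_apply_le_dist _).trans_lt hrs

end Runge

section RungePoles

variable {P L M : Set ℂ}

/-- The restrictions to `L` of the holomorphic functions on the complement of `P`. -/
def holSubalgebra (P L : Set ℂ) : Subalgebra ℂ C(L, ℂ) where
  carrier := {g | ∃ G : ℂ → ℂ, DifferentiableOn ℂ G Pᶜ ∧ ∀ z : L, g z = G z}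
  mul_mem' := by
    rintro a b ⟨A, hA, ha⟩ ⟨B, hB, hb⟩
    exact ⟨A * B, hA.mul hB, fun z => by simp [ha, hb]⟩
  add_mem' := by
    rintro a b ⟨A, hA, ha⟩ ⟨B, hB, hb⟩
    exact ⟨A + B, hA.add hB, fun z => by simp [ha, hb]⟩
  algebraMap_mem' c := ⟨fun _ => c, differentiableOn_const _, fun z => by simp⟩

/-- The restrictions to `L` of the nowhere vanishing holomorphic functions on the complement of
`P`, as a group of units of `C(L, ℂ)`. -/
def holUnits (P L : Set ℂ) : Subgroup C(L, ℂ)ˣ where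
  carrier := {g | ∃ G : ℂ → ℂ, DifferentiableOn ℂ G Pᶜ ∧ (∀ z ∈ Pᶜ, G z ≠ 0) ∧
    ∀ z : L, (g : C(L, ℂ)) z = G z}
  mul_mem' := by
    rintro a b ⟨A, hA, hA0, ha⟩ ⟨B, hB, hB0, hb⟩
    exact ⟨A * B, hA.mul hB, fun z hz => mul_ne_zero (hA0 z hz) (hB0 z hz),
      fun z => by simp [ha, hb]⟩
  one_mem' := ⟨fun _ => 1, differentiableOn_const _, fun _ _ => one_ne_zero, fun _ => by simp⟩
  inv_mem' := by
    rintro a ⟨A, hA, hA0, ha⟩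
    exact ⟨fun z => (A z)⁻¹, hA.inv hA0, fun z hz => inv_ne_zero (hA0 z hz),
      fun z => by rw [units_inv_apply, ha]⟩

variable [CompactSpace L]

/-- On `L`, the function `f` is a uniform limit of holomorphic functions on the complement
of `P`. -/
def IsHolLimit (P L : Set ℂ) [CompactSpace L] (f : ℂ → ℂ) : Prop :=
  ∃ a ∈ (holSubalgebra P L).topologicalClosure, ∀ z : L, a z = f z

/-- On `L`, the function `f` is a zero-free uniform limit of nowhere vanishing holomorphic
functions on the complement of `P`. -/
def IsZeroFreeLimit (P L : Set ℂ) [CompactSpace L] (f : ℂ → ℂ) : Prop :=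
  ∃ u ∈ (holUnits P L).topologicalClosure, ∀ z : L, (u : C(L, ℂ)) z = f z

namespace IsHolLimit

variable {f g : ℂ → ℂ}

theorem of_differentiableOn (hP : P ⊆ Lᶜ) (hf : DifferentiableOn ℂ f Pᶜ) : IsHolLimit P L f :=
  ⟨⟨L.domRestrict f, (hf.continuousOn.mono (subset_compl_comm.1 hP)).domRestrict⟩,
    Subalgebra.le_topologicalClosure _ ⟨f, hf, fun _ => rfl⟩, fun _ => rfl⟩

theorem add (hf : IsHolLimit P L f) (hg : IsHolLimit P L g) :
    IsHolLimit P L fun z => f z + g z := by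
  obtain ⟨a, ha, haf⟩ := hf
  obtain ⟨b, hb, hbg⟩ := hg
  exact ⟨a + b, add_mem ha hb, fun z => by simp [haf, hbg]⟩

theorem mul (hf : IsHolLimit P L f) (hg : IsHolLimit P L g) :
    IsHolLimit P L fun z => f z * g z := by
  obtain ⟨a, ha, haf⟩ := hf
  obtain ⟨b, hb, hbg⟩ := hg
  exact ⟨a * b, mul_mem ha hb, fun z => by simp [haf, hbg]⟩

theorem exists_approx (hf : IsHolLimit P L f) {ε : ℝ} (hε : 0 < ε) :
    ∃ G : ℂ → ℂ, DifferentiableOn ℂ G Pᶜ ∧ ∀ z ∈ L, ‖G z - f z‖ < ε := by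
  obtain ⟨a, ha, haf⟩ := hf
  obtain ⟨b, ⟨G, hG, hbG⟩, hab⟩ := Metric.mem_closure_iff.1 ha ε hε
  refine ⟨G, hG, fun z hz => ?_⟩
  rw [← hbG ⟨z, hz⟩, ← haf ⟨z, hz⟩, ← dist_eq_norm, dist_comm]
  exact (ContinuousMap.dist_apply_le_dist _).trans_lt hab

end IsHolLimit

namespace IsZeroFreeLimit

variable {f g : ℂ → ℂ}

theorem of_differentiableOn (hP : P ⊆ Lᶜ) (hf : DifferentiableOn ℂ f Pᶜ)
    (hf0 : ∀ z ∈ Pᶜ, f z ≠ 0) : IsZeroFreeLimit P L f := by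
  have hLP : L ⊆ Pᶜ := subset_compl_comm.1 hP
  obtain ⟨u, hu⟩ := (ContinuousMap.isUnit_iff_forall_ne_zero
    ⟨L.domRestrict f, (hf.continuousOn.mono hLP).domRestrict⟩).2 fun z => hf0 z (hLP z.2)
  have huf : ∀ z : L, (u : C(L, ℂ)) z = f z := fun z => by rw [hu]; rfl
  exact ⟨u, Subgroup.le_topologicalClosure _ ⟨f, hf, hf0, huf⟩, huf⟩

theorem congr (hf : IsZeroFreeLimit P L f) (h : EqOn f g L) : IsZeroFreeLimit P L g :=
  hf.imp fun _ hu => ⟨hu.1, fun z => (hu.2 z).trans (h z.2)⟩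

theorem isHolLimit (hf : IsZeroFreeLimit P L f) : IsHolLimit P L f := by
  obtain ⟨u, hu, huf⟩ := hf
  exact ⟨u, map_mem_closure Units.continuous_val hu fun v ⟨G, hG, _, hvG⟩ => ⟨G, hG, hvG⟩, huf⟩

theorem ne_zero (hf : IsZeroFreeLimit P L f) {z : ℂ} (hz : z ∈ L) : f z ≠ 0 := by
  obtain ⟨u, -, huf⟩ := hf
  exact huf ⟨z, hz⟩ ▸ (ContinuousMap.isUnit_iff_forall_ne_zero _).1 u.isUnit _

theorem mul (hf : IsZeroFreeLimit P L f) (hg : IsZeroFreeLimit P L g) :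
    IsZeroFreeLimit P L fun z => f z * g z := by
  obtain ⟨a, ha, haf⟩ := hf
  obtain ⟨b, hb, hbg⟩ := hg
  exact ⟨a * b, mul_mem ha hb, fun z => by simp [haf, hbg]⟩

theorem inv (hf : IsZeroFreeLimit P L f) : IsZeroFreeLimit P L fun z => (f z)⁻¹ := by
  obtain ⟨u, hu, huf⟩ := hf
  exact ⟨u⁻¹, inv_mem hu, fun z => by rw [units_inv_apply, huf]⟩

theorem multiset_prod (hP : P ⊆ Lᶜ) {ι : Type*} {F : ι → ℂ → ℂ} (s : Multiset ι)
    (h : ∀ i ∈ s, IsZeroFreeLimit P L (F i)) :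
    IsZeroFreeLimit P L fun z => (s.map fun i => F i z).prod := by
  induction s using Multiset.induction_on with
  | empty => simpa using of_differentiableOn hP (differentiableOn_const 1) fun _ _ => one_ne_zero
  | cons i s ih =>
    simpa using (h i (Multiset.mem_cons_self i s)).mul
      (ih fun j hj => h j (Multiset.mem_cons_of_mem hj))

theorem exists_approx (hf : IsZeroFreeLimit P L f) {ε : ℝ} (hε : 0 < ε) :
    ∃ G : ℂ → ℂ, DifferentiableOn ℂ G Pᶜ ∧ (∀ z ∈ Pᶜ, G z ≠ 0) ∧ ∀ z ∈ L, ‖G z - f z‖ < ε := by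
  obtain ⟨u, hu, huf⟩ := hf
  obtain ⟨v, hv, G, hG, hG0, hvG⟩ := mem_closure_iff_nhds.1 hu _
    (Units.continuous_val.continuousAt.preimage_mem_nhds (Metric.ball_mem_nhds _ hε))
  refine ⟨G, hG, hG0, fun z hz => ?_⟩
  rw [← hvG ⟨z, hz⟩, ← huf ⟨z, hz⟩, ← dist_eq_norm]
  exact (ContinuousMap.dist_apply_le_dist _).trans_lt hv

end IsZeroFreeLimit

theorem exists_pos_forall_exists_exp_eq (X : Type*) [NormedRing X] [NormedAlgebra ℂ X]
    [CompleteSpace X] : ∃ r > 0, ∀ a : X, ‖a - 1‖ < r → ∃ v : X, NormedSpace.exp v = a := by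
  have h := (hasStrictFDerivAt_exp_zero (𝕂 := ℂ) (𝔸 := X)).map_nhds_eq_of_surj
    (LinearMap.range_eq_top.2 fun x => ⟨x, rfl⟩)
  have hrange : range (NormedSpace.exp : X → X) ∈ 𝓝 (1 : X) := by
    rw [← NormedSpace.exp_zero, ← h, ← image_univ]
    exact image_mem_map univ_mem
  obtain ⟨r, hr, hball⟩ := Metric.mem_nhds_iff.1 hrange
  exact ⟨r, hr, fun a ha => hball (mem_ball_iff_norm.2 ha)⟩

theorem continuousMap_exp_apply {X : Type*} [TopologicalSpace X] [CompactSpace X] (v : C(X, ℂ))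
    (x : X) : NormedSpace.exp v x = exp (v x) := by
  have h := NormedSpace.map_exp (ContinuousMap.evalAlgHom ℂ ℂ x) (continuous_eval_const x) v
  rwa [ContinuousMap.evalAlgHom_apply, ContinuousMap.evalAlgHom_apply, ← exp_eq_exp_ℂ] at h

theorem exists_pos_forall_mem_exists_exp_eq {X : Type*} [NormedRing X] [NormedAlgebra ℂ X]
    [CompleteSpace X] {A : Subalgebra ℂ X} (hA : IsClosed (A : Set X)) :
    ∃ r > 0, ∀ a ∈ A, ‖a - 1‖ < r → ∃ v ∈ A, NormedSpace.exp v = a := by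
  have : CompleteSpace A := hA.completeSpace_coe
  obtain ⟨r, hr, hexp⟩ := exists_pos_forall_exists_exp_eq A
  refine ⟨r, hr, fun a ha har => ?_⟩
  obtain ⟨v, hv⟩ := hexp ⟨a, ha⟩ har
  let : NormedAlgebra ℚ A := NormedAlgebra.restrictScalars ℚ ℂ A
  let : Algebra ℚ X := Algebra.compHom X (algebraMap ℚ ℂ)
  have hmap := NormedSpace.map_exp A.val continuous_subtype_val v
  rw [hv] at hmap
  exact ⟨v, v.2, hmap.symm⟩

theorem isZeroFreeLimit_of_exp_eq {f : ℂ → ℂ} {v : C(L, ℂ)}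
    (hv : v ∈ (holSubalgebra P L).topologicalClosure) (hvf : ∀ z : L, exp (v z) = f z) :
    IsZeroFreeLimit P L f := by
  have hunit : ∀ w : C(L, ℂ), IsUnit (NormedSpace.exp w) := fun w => NormedSpace.isUnit_exp w
  have hcont : Continuous fun w : C(L, ℂ) => (hunit w).unit :=
    Units.isOpenEmbedding_val.isEmbedding.continuous_iff.2 NormedSpace.exp_continuous
  refine ⟨(hunit v).unit, map_mem_closure hcont hv ?_, fun z => by
    rw [IsUnit.unit_spec, continuousMap_exp_apply, hvf]⟩
  rintro w ⟨G, hG, hwG⟩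
  exact ⟨fun z => exp (G z), hG.cexp, fun z _ => exp_ne_zero _, fun z => by
    rw [IsUnit.unit_spec, continuousMap_exp_apply, hwG]⟩

/-- Near `1`, every limit of holomorphic functions is the exponential of another one. -/
theorem exists_pos_forall_isZeroFreeLimit (P L : Set ℂ) [CompactSpace L] :
    ∃ r > 0, ∀ f : ℂ → ℂ, IsHolLimit P L f → (∀ z ∈ L, ‖f z - 1‖ < r) →
      IsZeroFreeLimit P L f := by
  obtain ⟨r, hr, hexp⟩ := exists_pos_forall_mem_exists_exp_eq
    (Subalgebra.isClosed_topologicalClosure (holSubalgebra P L))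
  refine ⟨r, hr, fun f ⟨a, ha, haf⟩ hfr => ?_⟩
  obtain ⟨v, hv, rfl⟩ := hexp a ha
    ((ContinuousMap.norm_lt_iff (a - 1) hr).2 fun z => by simpa [haf] using hfr z z.2)
  exact isZeroFreeLimit_of_exp_eq hv fun z => by rw [← haf, continuousMap_exp_apply]

section Poles

variable (hP : P ⊆ Lᶜ)
include hP

theorem isZeroFreeLimit_sub_of_norm_lt {r : ℝ} (hr : ∀ f : ℂ → ℂ, IsHolLimit P L f →
      (∀ z ∈ L, ‖f z - 1‖ < r) → IsZeroFreeLimit P L f) {b c : ℂ}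
    (hb : IsZeroFreeLimit P L (· - b)) (hbc : ∀ z ∈ L, ‖b - c‖ < r * ‖z - b‖) :
    IsZeroFreeLimit P L (· - c) := by
  have hconst (k : ℂ) : IsHolLimit P L fun _ => k :=
    .of_differentiableOn hP (differentiableOn_const k)
  have hquot : IsZeroFreeLimit P L fun z => 1 + (b - c) * (z - b)⁻¹ := by
    refine hr _ ((hconst 1).add ((hconst (b - c)).mul hb.inv.isHolLimit)) fun z hz => ?_
    rw [add_sub_cancel_left, norm_mul, norm_inv, ← div_eq_mul_inv,
      div_lt_iff₀ (norm_pos_iff.2 (hb.ne_zero hz))]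
    exact hbc z hz
  refine (hb.mul hquot).congr fun z hz => ?_
  have := hb.ne_zero hz
  field_simp
  ring

theorem eventually_isZeroFreeLimit_sub_iff {b : ℂ} (hb : b ∉ L) :
    ∀ᶠ c in 𝓝 b, IsZeroFreeLimit P L (· - b) ↔ IsZeroFreeLimit P L (· - c) := by
  obtain ⟨r, hr0, hr⟩ := exists_pos_forall_isZeroFreeLimit P L
  have hnear : ∀ᶠ c in 𝓝 b, ∀ z ∈ L, ‖b - c‖ < r * ‖z - b‖ ∧ ‖c - b‖ < r * ‖z - c‖ := by
    refine (isCompact_iff_compactSpace.2 ‹_›).eventually_forall_of_forall_eventually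
      fun z hz => ?_
    have hzb : 0 < ‖z - b‖ := norm_pos_iff.2 (sub_ne_zero.2 fun h => hb (h ▸ hz))
    have hopen : IsOpen ({q : ℂ × ℂ | ‖b - q.1‖ < r * ‖q.2 - b‖} ∩
        {q : ℂ × ℂ | ‖q.1 - b‖ < r * ‖q.2 - q.1‖}) :=
      (isOpen_lt (by fun_prop) (by fun_prop)).inter (isOpen_lt (by fun_prop) (by fun_prop))
    exact hopen.mem_nhds (by simpa using mul_pos hr0 hzb)
  filter_upwards [hnear] with c hc
  exact ⟨fun h => isZeroFreeLimit_sub_of_norm_lt hP hr h fun z hz => (hc z hz).1,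
    fun h => isZeroFreeLimit_sub_of_norm_lt hP hr h fun z hz => (hc z hz).2⟩

theorem exists_isZeroFreeLimit_sub_of_not_isBounded {C : Set ℂ} (hC : ¬Bornology.IsBounded C) :
    ∃ b ∈ C, IsZeroFreeLimit P L (· - b) := by
  obtain ⟨r, hr0, hr⟩ := exists_pos_forall_isZeroFreeLimit P L
  have hL : IsCompact L := isCompact_iff_compactSpace.2 ‹_›
  obtain ⟨R, hR0, hR⟩ := hL.isBounded.exists_pos_norm_le
  obtain ⟨b, hbC, hb⟩ : ∃ b ∈ C, R / r < ‖b‖ := by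
    by_contra! h
    exact hC (isBounded_iff_forall_norm_le.2 ⟨_, h⟩)
  have hb0 : b ≠ 0 := norm_pos_iff.1 ((div_pos hR0 hr0).trans hb)
  have hone : IsZeroFreeLimit P L fun z => 1 - b⁻¹ * z := by
    refine hr _ (.of_differentiableOn hP (by fun_prop)) fun z hz => ?_
    rw [sub_sub_cancel_left, norm_neg, norm_mul, norm_inv, inv_mul_lt_iff₀ (norm_pos_iff.2 hb0)]
    exact (hR z hz).trans_lt ((div_lt_iff₀ hr0).1 hb)
  have hneg : IsZeroFreeLimit P L fun _ => -b :=
    .of_differentiableOn hP (differentiableOn_const _) fun _ _ => neg_ne_zero.2 hb0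
  refine ⟨b, hbC, (hneg.mul hone).congr fun z _ => ?_⟩
  field_simp
  ring

end Poles

/-- Every point off `M` can be connected in the complement of `L` to a point of `P` or to `∞`. -/
def Separates (P L M : Set ℂ) : Prop :=
  ∀ ζ ∉ M, ∃ C : Set ℂ, IsPreconnected C ∧ C ⊆ Lᶜ ∧ ζ ∈ C ∧
    ((∃ p ∈ P, p ∈ C) ∨ ¬ Bornology.IsBounded C)

namespace Separates

variable (h : Separates P L M) (hP : P ⊆ Lᶜ)
include h hP

/-- Pole pushing along the connected set provided by `Separates`. -/
theorem isZeroFreeLimit_sub {a : ℂ} (ha : a ∉ M) : IsZeroFreeLimit P L (· - a) := by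
  obtain ⟨C, hC, hCL, haC, hstart⟩ := h a ha
  obtain ⟨b, hbC, hb⟩ : ∃ b ∈ C, IsZeroFreeLimit P L (· - b) := by
    rcases hstart with ⟨p, hp, hpC⟩ | hunb
    · exact ⟨p, hpC, .of_differentiableOn hP (by fun_prop) fun z hz =>
        sub_ne_zero.2 fun h => hz (h ▸ hp)⟩
    · exact exists_isZeroFreeLimit_sub_of_not_isBounded hP hunb
  refine (hC.induction₂ (fun x y => IsZeroFreeLimit P L (· - x) ↔ IsZeroFreeLimit P L (· - y))
    (fun x hx => ?_) (fun x y z _ _ _ => Iff.trans) (fun x y _ _ => Iff.symm) hbC haC).1 hb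
  exact (eventually_isZeroFreeLimit_sub_iff hP (hCL hx)).filter_mono nhdsWithin_le_nhds

theorem isZeroFreeLimit_eval {p : Polynomial ℂ} (hp0 : p ≠ 0) (hp : ∀ z ∈ M, p.eval z ≠ 0) :
    IsZeroFreeLimit P L fun z => p.eval z := by
  simp only [(IsAlgClosed.splits p).eval_eq_prod_roots]
  refine .mul (.of_differentiableOn hP (differentiableOn_const _) fun _ _ =>
    Polynomial.leadingCoeff_ne_zero.2 hp0) (.multiset_prod hP _ fun a ha => ?_)
  exact h.isZeroFreeLimit_sub hP fun haM => hp a haM (Polynomial.isRoot_of_mem_roots ha)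

variable {U : Set ℂ} (hM : IsCompact M) (hLM : L ⊆ M) (hU : IsOpen U) (hMU : M ⊆ U)
  {g : ℂ → ℂ} (hg : DifferentiableOn ℂ g U) {ε : ℝ} (hε : 0 < ε)
include hM hLM hU hMU hg hε

theorem exists_holomorphic_approx :
    ∃ G : ℂ → ℂ, DifferentiableOn ℂ G Pᶜ ∧ ∀ z ∈ L, ‖G z - g z‖ < ε := by
  rcases M.eq_empty_or_nonempty with rfl | ⟨z₀, hz₀⟩
  · exact ⟨0, differentiableOn_const _, fun z hz => absurd (hLM hz) (notMem_empty z)⟩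
  obtain ⟨p, q, hpq⟩ := exists_rational_approx hM hU hMU hg (half_pos hε)
  simp only [div_eq_mul_inv] at hpq
  have hq0 : q ≠ 0 := fun hq => (hpq z₀ hz₀).1 (by simp [hq])
  have hquot : IsHolLimit P L fun z => p.eval z * (q.eval z)⁻¹ :=
    .mul (.of_differentiableOn hP p.differentiable.differentiableOn)
      (h.isZeroFreeLimit_eval hP hq0 fun z hz => (hpq z hz).1).inv.isHolLimit
  obtain ⟨G, hG, hGL⟩ := hquot.exists_approx (half_pos hε)
  refine ⟨G, hG, fun z hz => ?_⟩
  rw [← add_halves ε]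
  exact (norm_sub_le_norm_sub_add_norm_sub _ _ _).trans_lt
    (add_lt_add (hGL z hz) (hpq z (hLM hz)).2)

theorem exists_nonvanishing_approx (hg0 : ∀ z ∈ M, g z ≠ 0) :
    ∃ G : ℂ → ℂ, DifferentiableOn ℂ G Pᶜ ∧ (∀ z ∈ Pᶜ, G z ≠ 0) ∧ ∀ z ∈ L, ‖G z - g z‖ < ε := by
  rcases M.eq_empty_or_nonempty with rfl | hMne
  · exact ⟨fun _ => 1, differentiableOn_const _, fun _ _ => one_ne_zero,
      fun z hz => absurd (hLM hz) (notMem_empty z)⟩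
  obtain ⟨z₀, hz₀, hmin⟩ := hM.exists_isMinOn hMne (hg.continuousOn.mono hMU).norm
  obtain ⟨p, q, hpq⟩ := exists_rational_approx hM hU hMU hg
    (lt_min (norm_pos_iff.2 (hg0 z₀ hz₀)) (half_pos hε))
  simp only [div_eq_mul_inv] at hpq
  have hp : ∀ z ∈ M, p.eval z ≠ 0 := fun z hz hpz => by
    have hlt := (hpq z hz).2.trans_le (min_le_left _ _)
    rw [hpz, zero_mul, zero_sub, norm_neg] at hlt
    exact hlt.not_ge (hmin hz)
  have hp0 : p ≠ 0 := fun h => hp z₀ hz₀ (by simp [h])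
  have hq0 : q ≠ 0 := fun h => (hpq z₀ hz₀).1 (by simp [h])
  obtain ⟨G, hG, hG0, hGL⟩ := ((h.isZeroFreeLimit_eval hP hp0 hp).mul
    (h.isZeroFreeLimit_eval hP hq0 fun z hz => (hpq z hz).1).inv).exists_approx (half_pos hε)
  refine ⟨G, hG, hG0, fun z hz => ?_⟩
  rw [← add_halves ε]
  exact (norm_sub_le_norm_sub_add_norm_sub _ _ _).trans_lt
    (add_lt_add (hGL z hz) ((hpq z (hLM hz)).2.trans_le (min_le_right _ _)))

end Separates

end RungePoles

section Primitives

theorem hasDerivAt_of_hasFDerivAt_smul_one {f : ℂ → ℂ} {c z : ℂ}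
    (h : HasFDerivAt f (c • (1 : ℂ →L[ℝ] ℂ)) z) : HasDerivAt f c z :=
  hasDerivAt_iff_hasFDerivAt.2 <| hasFDerivAt_of_restrictScalars ℝ h <| by ext; simp [mul_comm]

/-- The closed `1`-form `f dz - du` extends by zero across `P`, so it is exact. -/
theorem isExactOn_diff_of_eventually_hasDerivAt {f u : ℂ → ℂ} {P s : Set ℂ} (hs : Convex ℝ s)
    (hso : IsOpen s) (hP : IsClosed P) (hf : DifferentiableOn ℂ f (s \ P))
    (hu : ContDiffOn ℝ 2 u (s \ P))
    (hfu : ∀ p ∈ P, ∀ᶠ z in 𝓝 p, z ∉ P → HasDerivAt u (f z) z) :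
    IsExactOn f (s \ P) := by
  classical
  have hsP : IsOpen (s \ P) := hso.sdiff hP
  set η : ℂ → ℂ →L[ℝ] ℂ := P.piecewise 0 fun z => f z • (1 : ℂ →L[ℝ] ℂ) - fderiv ℝ u z with hη
  have hη_of_notMem : ∀ z ∉ P, η z = f z • (1 : ℂ →L[ℝ] ℂ) - fderiv ℝ u z := fun z hz => by
    rw [hη, piecewise_eq_of_notMem _ _ _ hz]
  have hη_near : ∀ p ∈ P, η =ᶠ[𝓝 p] fun _ => 0 := fun p hp => by
    filter_upwards [hfu p hp] with z hz
    by_cases hzP : z ∈ P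
    · simp [hη, hzP]
    · rw [hη_of_notMem z hzP, (hz hzP).complexToReal_fderiv.fderiv, sub_self]
  have hη' : ∀ z ∈ s \ P, HasFDerivAt η ((deriv f z • (1 : ℂ →L[ℝ] ℂ)).smulRight
      (1 : ℂ →L[ℝ] ℂ) - fderiv ℝ (fderiv ℝ u) z) z := fun z hz => by
    have hfz := (hf.hasDerivAt (hsP.mem_nhds hz)).complexToReal_fderiv
    have huz : ContDiffAt ℝ 1 (fderiv ℝ u) z :=
      (hu.contDiffAt (hsP.mem_nhds hz)).fderiv_right (by norm_num)
    refine ((hfz.smul_const _).sub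
      (huz.differentiableAt one_ne_zero).hasFDerivAt).congr_of_eventuallyEq ?_
    filter_upwards [hsP.mem_nhds hz] with w hw using hη_of_notMem w hw.2
  have hηd : DifferentiableOn ℝ η s := fun z hz => by
    by_cases hzP : z ∈ P
    · exact ((hη_near z hzP).differentiableAt_iff.2 (by fun_prop)).differentiableWithinAt
    · exact (hη' z ⟨hz, hzP⟩).differentiableAt.differentiableWithinAt
  obtain ⟨F, hF⟩ := hs.exists_forall_hasFDerivAt_of_fderiv_symmetric hso hηd fun z hz x y => by
    by_cases hzP : z ∈ P
    · simp [(hη_near z hzP).fderiv_eq]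
    · have hsymm : IsSymmSndFDerivAt ℝ u z :=
        (hu.contDiffAt (hsP.mem_nhds ⟨hz, hzP⟩)).isSymmSndFDerivAt (by simp)
      rw [(hη' z ⟨hz, hzP⟩).fderiv]
      simp [hsymm.eq x y, mul_assoc, mul_comm x y]
  refine ⟨F + u, fun z hz => hasDerivAt_of_hasFDerivAt_smul_one ?_⟩
  have huz := (hu.contDiffAt (hsP.mem_nhds hz)).differentiableAt two_ne_zero
  exact ((hF z hz.1).add huz.hasFDerivAt).congr_fderiv (by simp [hη_of_notMem z hz.2])

theorem isExactOn_of_convex {f : ℂ → ℂ} {s : Set ℂ} (hs : Convex ℝ s) (hso : IsOpen s)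
    (hf : DifferentiableOn ℂ f s) : IsExactOn f s := by
  simpa using isExactOn_diff_of_eventually_hasDerivAt (u := 0) hs hso isClosed_empty
    (by simpa using hf) contDiffOn_const (by simp)

theorem contDiffOn_mul_of_tsupport_subset {χ G : ℂ → ℂ} {U P : Set ℂ} {n : ℕ∞} (hU : IsOpen U)
    (hP : IsClosed P) (hχ : ContDiff ℝ n χ) (hs : tsupport χ ⊆ U) (hG : ContDiffOn ℝ n G (U \ P)) :
    ContDiffOn ℝ n (fun z => χ z * G z) Pᶜ := fun z hz => by
  by_cases hzχ : z ∈ tsupport χ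
  · have hGz := hG.contDiffAt ((hU.sdiff hP).mem_nhds ⟨hs hzχ, hz⟩)
    exact (hχ.contDiffAt.mul hGz).contDiffWithinAt
  · refine (contDiffAt_const (c := 0)).congr_of_eventuallyEq ?_ |>.contDiffWithinAt
    filter_upwards [(isClosed_tsupport χ).isOpen_compl.mem_nhds hzχ] with w hw
    rw [image_eq_zero_of_notMem_tsupport hw, zero_mul]

/-- Each local primitive is cut off to `χ p * G p`, and the sum of these is subtracted. -/
theorem isExactOn_compl_of_local {f : ℂ → ℂ} {P : Finset ℂ}
    (hf : DifferentiableOn ℂ f (P : Set ℂ)ᶜ)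
    (hloc : ∀ p ∈ P, ∃ U, IsOpen U ∧ p ∈ U ∧ IsExactOn f (U \ P)) :
    IsExactOn f (P : Set ℂ)ᶜ := by
  have hPc : IsClosed (P : Set ℂ) := P.finite_toSet.isClosed
  choose! U hUo hpU G hG using hloc
  have hdisc : ∀ p : ℂ, IsClosed (P \ {p} : Set ℂ) := fun p => P.finite_toSet.sdiff.isClosed
  choose! χ hχ _ hχU hχ1 using fun p hp =>
    exists_contDiff_tsupport_subset_eventually_eq_one (isCompact_singleton (x := p))
      ((hUo p hp).sdiff (hdisc p)) (by simpa using hpU p hp)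
  have hu : ∀ p ∈ P, ContDiffOn ℝ 2 (fun z => χ p z * G p z) (P : Set ℂ)ᶜ := fun p hp => by
    have hUP : IsOpen (U p \ P) := (hUo p hp).sdiff hPc
    have hGd : DifferentiableOn ℂ (G p) (U p \ P) := fun z hz =>
      (hG p hp z hz).differentiableAt.differentiableWithinAt
    exact contDiffOn_mul_of_tsupport_subset (n := 2) (hUo p hp) hPc
      ((hχ p hp).of_le (by norm_cast)) ((hχU p hp).trans sdiff_subset)
      ((hGd.contDiffOn hUP).restrict_scalars ℝ)
  rw [compl_eq_univ_sdiff]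
  refine isExactOn_diff_of_eventually_hasDerivAt (u := fun z => ∑ p ∈ P, χ p z * G p z)
    convex_univ isOpen_univ hPc (by rwa [← compl_eq_univ_sdiff])
    (by rw [← compl_eq_univ_sdiff]; exact ContDiffOn.sum hu) fun p hp => ?_
  have hone : ∀ᶠ z in 𝓝 p, χ p z = 1 := by simpa using hχ1 p hp
  have hzero : ∀ q ∈ P, q ≠ p → ∀ᶠ z in 𝓝 p, χ q z = 0 := fun q hq hqp => by
    have : p ∉ tsupport (χ q) := fun h => (hχU q hq h).2 ⟨hp, hqp.symm⟩
    filter_upwards [(isClosed_tsupport _).isOpen_compl.mem_nhds this] with z hz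
    exact image_eq_zero_of_notMem_tsupport hz
  have hsum : ∀ᶠ z in 𝓝 p, ∑ q ∈ P, χ q z * G q z = G p z := by
    filter_upwards [hone, (Finset.eventually_all _).2 fun q hq => eventually_imp_distrib_left.2
      (hzero q hq)] with z hz1 hz0
    rw [Finset.sum_eq_single_of_mem p hp fun q hq hqp => by rw [hz0 q hq hqp, zero_mul], hz1,
      one_mul]
  filter_upwards [hsum.eventually_nhds, (hUo p hp).mem_nhds (hpU p hp)] with z hz hzU hzP
  exact (hG p hp z ⟨hzU, hzP⟩).congr_of_eventuallyEq hz

theorem isExactOn_ball_diff_singleton_of_periodic {f E : ℂ → ℂ} {p : ℂ} {r : ℝ}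
    (hE : ∀ w : ℂ, w.re < Real.log r → HasDerivAt E (f (p + exp w) * exp w) w)
    (hper : ∀ w : ℂ, w.re < Real.log r → E (w + 2 * Real.pi * I) = E w) :
    IsExactOn f (ball p r \ {p}) := by
  have hE_int : ∀ (w : ℂ) (n : ℤ), w.re < Real.log r →
      E (w + n * (2 * Real.pi * I)) = E w := fun w n hw => by
    have hp : Function.Periodic (fun n : ℤ => E (w + n * (2 * Real.pi * I))) 1 := fun n => by
      have := hper (w + n * (2 * Real.pi * I)) (by simpa using hw)
      dsimp only
      rw [← this]
      push_cast
      ring_nf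
    simpa using hp.int_mul_eq n
  have hE_exp : ∀ w w' : ℂ, w.re < Real.log r → exp w' = exp w → E w' = E w := fun w w' hw h => by
    obtain ⟨n, rfl⟩ := exp_eq_exp_iff_exists_int.1 h
    exact hE_int w n hw
  refine ⟨fun z => E (log (z - p)), fun z ⟨hzr, hzp⟩ => ?_⟩
  have hz0 : z - p ≠ 0 := sub_ne_zero.2 hzp
  have hlog_re : ∀ w ≠ 0, ‖w‖ < r → (log w).re < Real.log r := fun w hw hwr => by
    rw [log_re]
    exact Real.log_lt_log (norm_pos_iff.2 hw) hwr
  have hlog : HasDerivAt (fun w => log ((w - p) / (z - p)) + log (z - p)) (z - p)⁻¹ z := by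
    have := ((((hasDerivAt_id z).sub_const p).div_const (z - p)).clog
      (by simp [hz0])).add_const (log (z - p))
    simpa [hz0] using this
  have hcomp : HasDerivAt (fun w => E (log ((w - p) / (z - p)) + log (z - p))) (f z) z := by
    have := (hE (log (z - p)) (hlog_re _ hz0 (by simpa [dist_eq] using hzr)))
    refine (HasDerivAt.comp z (by simpa [hz0] using this) hlog).congr_deriv ?_
    rw [exp_log hz0, add_sub_cancel, mul_assoc, mul_inv_cancel₀ hz0, mul_one]
  refine hcomp.congr_of_eventuallyEq ?_
  filter_upwards [(isOpen_ball.sdiff isClosed_singleton).mem_nhds ⟨hzr, hzp⟩] with w ⟨hwr, hwp⟩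
  have hw0 : w - p ≠ 0 := sub_ne_zero.2 hwp
  refine (hE_exp _ _ (hlog_re _ hw0 (by simpa [dist_eq] using hwr)) ?_).symm
  rw [exp_add, exp_log (div_ne_zero hw0 hz0), exp_log hz0, exp_log hw0, div_mul_cancel₀ _ hz0]

/-- On the universal cover `w ↦ p + exp w` of the punctured ball the pulled back form is exact, and
its primitive gains a constant under the deck transformation `w ↦ w + 2πi`. -/
theorem exists_isExactOn_sub_mul_inv {f : ℂ → ℂ} {p : ℂ} {r : ℝ} (hr : 0 < r)
    (hf : DifferentiableOn ℂ f (ball p r \ {p})) :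
    ∃ c, IsExactOn (fun z => f z - c * (z - p)⁻¹) (ball p r \ {p}) := by
  set H : Set ℂ := {w | w.re < Real.log r} with hH
  have hHc : Convex ℝ H := convex_halfSpace_re_lt _
  have hHo : IsOpen H := isOpen_lt continuous_re continuous_const
  have hmaps : MapsTo (fun w => p + exp w) H (ball p r \ {p}) := fun w hw => by
    simpa [dist_eq, norm_exp, exp_ne_zero] using (Real.lt_log_iff_exp_lt hr).1 hw
  obtain ⟨F, hF⟩ := isExactOn_of_convex (f := fun w => f (p + exp w) * exp w) hHc hHo <|
    (hf.comp (by fun_prop) hmaps).mul (by fun_prop)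
  have htrans : ∀ w ∈ H, HasDerivAt (fun w => F (w + 2 * Real.pi * I) - F w) 0 w := fun w hw => by
    have hshift := (hF (w + 2 * Real.pi * I) (by simpa [hH] using hw)).comp_add_const
    exact (hshift.sub (hF w hw)).congr_deriv (by simp [exp_periodic w])
  obtain ⟨b, hb⟩ : ∃ b, ∀ w ∈ H, F (w + 2 * Real.pi * I) - F w = b := by
    exact hHo.exists_is_const_of_deriv_eq_zero hHc.isPreconnected
      (fun w hw => (htrans w hw).differentiableAt.differentiableWithinAt)
      fun w hw => (htrans w hw).deriv
  refine ⟨b / (2 * Real.pi * I), isExactOn_ball_diff_singleton_of_periodic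
    (E := fun w => F w - b / (2 * Real.pi * I) * w) (fun w hw => ?_) fun w hw => ?_⟩
  · refine ((hF w hw).sub ((hasDerivAt_id w).const_mul _)).congr_deriv ?_
    have := exp_ne_zero w
    simp
    field_simp
  · have h := hb w hw
    rw [mul_add, div_mul_cancel₀ _ two_pi_I_ne_zero]
    linear_combination h

theorem exists_isExactOn_sub_sum_mul_inv {f : ℂ → ℂ} {P : Finset ℂ}
    (hf : DifferentiableOn ℂ f (P : Set ℂ)ᶜ) :
    ∃ c : ℂ → ℂ, IsExactOn (fun z => f z - ∑ p ∈ P, c p * (z - p)⁻¹) (P : Set ℂ)ᶜ := by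
  have hdisc : ∀ p : ℂ, ∃ r > 0, ball p r ⊆ (P \ {p} : Set ℂ)ᶜ := fun p =>
    isOpen_iff.1 P.finite_toSet.sdiff.isClosed.isOpen_compl p (by simp)
  choose r hr hrP using hdisc
  have hres : ∀ p, ∃ c, IsExactOn (fun z => f z - c * (z - p)⁻¹) (ball p (r p) \ {p}) :=
    fun p => exists_isExactOn_sub_mul_inv (hr p) <| hf.mono fun z hz hzP => hrP p hz.1 ⟨hzP, hz.2⟩
  choose c hc using hres
  have hinv : ∀ (p : ℂ) (s : Set ℂ), p ∉ s →
      DifferentiableOn ℂ (fun z => c p * (z - p)⁻¹) s := fun p s hps =>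
    ((differentiableOn_inv_sub p).mono (subset_compl_singleton_iff.2 hps)).const_mul _
  refine ⟨c, isExactOn_compl_of_local (hf.sub (.fun_sum fun p hp => hinv p _ (by simpa)))
    fun p hp => ⟨ball p (r p), isOpen_ball, mem_ball_self (hr p), ?_⟩⟩
  obtain ⟨G, hG⟩ := hc p
  obtain ⟨R, hR⟩ := isExactOn_of_convex (convex_ball p (r p)) isOpen_ball
    (DifferentiableOn.fun_sum (u := P.erase p) fun q hq => hinv q _
      fun hqr => hrP p hqr ⟨Finset.mem_of_mem_erase hq, Finset.ne_of_mem_erase hq⟩)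
  refine ⟨fun z => G z - R z, fun z hz => ?_⟩
  have hzp : z ≠ p := fun h => hz.2 (h ▸ hp)
  refine ((hG z ⟨hz.1, hzp⟩).sub (hR z hz.1)).congr_deriv ?_
  simp only [← Finset.add_sum_erase P _ hp, sub_sub]

end Primitives

section Periods

theorem isFiniteMeasure_comap_coe {L : Set ℂ} (hL : IsCompact L) :
    IsFiniteMeasure (Measure.comap ((↑) : L → ℂ) volume) :=
  ⟨by simpa [comap_subtype_coe_apply hL.measurableSet] using hL.measure_lt_top⟩

/-- The functional `g ↦ ∫ y, g y * ψ y ∂μ` on continuous functions. -/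
noncomputable def integralMulCLM {Y : Type*} [TopologicalSpace Y] [CompactSpace Y]
    [MeasurableSpace Y] [BorelSpace Y] (μ : Measure Y) [IsFiniteMeasure μ] (ψ : C(Y, ℂ)) :
    C(Y, ℂ) →L[ℂ] ℂ :=
  L1.integralCLM' ℂ ∘L ContinuousMap.toLp 1 μ ℂ ∘L ContinuousLinearMap.mul ℂ C(Y, ℂ) ψ

theorem integralMulCLM_apply {Y : Type*} [TopologicalSpace Y] [CompactSpace Y]
    [MeasurableSpace Y] [BorelSpace Y] (μ : Measure Y) [IsFiniteMeasure μ] (ψ g : C(Y, ℂ)) :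
    integralMulCLM μ ψ g = ∫ y, ψ y * g y ∂μ := by
  calc L1.integralCLM' ℂ (ContinuousMap.toLp 1 μ ℂ (ψ * g))
      = ∫ y, ContinuousMap.toLp 1 μ ℂ (ψ * g) y ∂μ := by
        rw [← L1.integral_eq', L1.integral_eq_integral]
    _ = ∫ y, ψ y * g y ∂μ := integral_congr_ae (ContinuousMap.coeFn_toLp μ (ψ * g))

theorem exists_clm_eq_integral_dbar_mul {L : Set ℂ} (hL : IsCompact L) [CompactSpace L]
    {χ : ℂ → ℂ} (hχ : ContDiff ℝ 1 χ) (hs : tsupport (fderiv ℝ χ) ⊆ L) :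
    ∃ lam : C(L, ℂ) →L[ℂ] ℂ, ∀ (g : C(L, ℂ)) (G : ℂ → ℂ), (∀ z : L, g z = G z) →
      lam g = ∫ z, dbar χ z * G z := by
  have := isFiniteMeasure_comap_coe hL
  refine ⟨integralMulCLM (Measure.comap ((↑) : L → ℂ) volume)
    ⟨fun z => dbar χ z, (continuous_dbar hχ).comp continuous_subtype_val⟩, fun g G h => ?_⟩
  rw [integralMulCLM_apply, ← setIntegral_eq_integral_of_forall_compl_eq_zero (s := L)
    fun w hw => ?_, ← integral_subtype_comap hL.measurableSet]
  · simp [h]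
  · rw [image_eq_zero_of_notMem_tsupport fun hw' => hw (hs (tsupport_dbar_subset _ hw')), zero_mul]

/-- A residue functional: a continuous functional on `C(L, ℂ)` whose components are nonzero
multiples of the residues at the points of `P` for functions holomorphic off `P`. It detects
exactness although it only sees the values on `L`. -/
structure IsPeriodFunctional (P : Finset ℂ) (L : Set ℂ) [CompactSpace L]
    (Λ : C(L, ℂ) →L[ℂ] (P → ℂ)) : Prop where
  eq_zero_of_deriv : ∀ (r : ℂ → ℂ) (V : Set ℂ), IsOpen V → L ⊆ V → DifferentiableOn ℂ r V →
    ∀ g : C(L, ℂ), (∀ z : L, g z = deriv r z) → Λ g = 0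
  apply_inv : ∀ (p : P) (g : C(L, ℂ)), (∀ z : L, g z = ((z : ℂ) - p)⁻¹) →
    Λ g = Pi.single p (-(Real.pi : ℂ))
  isExactOn : ∀ q : ℂ → ℂ, DifferentiableOn ℂ q (P : Set ℂ)ᶜ → ∀ g : C(L, ℂ),
    (∀ z : L, g z = q z) → Λ g = 0 → IsExactOn q (P : Set ℂ)ᶜ

/-- The component of `Λ` at `p` is `g ↦ ∫ g ∂̄χ`, where `χ` is a cut-off equal to `1` near `p` and
to `0` near the other points of `P`: by Green's formula it vanishes on derivatives, and by Cauchy's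
formula it maps `(z - p)⁻¹` to `-π`. -/
theorem exists_isPeriodFunctional {P : Finset ℂ} {L : Set ℂ} (hL : IsCompact L) [CompactSpace L]
    (hPL : Disjoint (P : Set ℂ) L)
    (hχ : ∀ p ∈ P, ∃ χ : ℂ → ℂ, ContDiff ℝ 2 χ ∧ HasCompactSupport χ ∧
      tsupport (fderiv ℝ χ) ⊆ L ∧ ∀ q ∈ P, ∀ᶠ z in 𝓝 q, χ z = if q = p then 1 else 0) :
    ∃ Λ : C(L, ℂ) →L[ℂ] (P → ℂ), IsPeriodFunctional P L Λ := by
  choose! χ hχ hc hs hχP using hχ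
  choose lam hlam using fun p : P =>
    exists_clm_eq_integral_dbar_mul hL ((hχ p p.2).of_le one_le_two) (hs p p.2)
  set Λ : C(L, ℂ) →L[ℂ] (P → ℂ) := ContinuousLinearMap.pi lam
  have hLP : L ⊆ (P : Set ℂ)ᶜ := hPL.subset_compl_left
  have hΛ_deriv : ∀ (r : ℂ → ℂ) (V : Set ℂ), IsOpen V → L ⊆ V → DifferentiableOn ℂ r V →
      ∀ g : C(L, ℂ), (∀ z : L, g z = deriv r z) → Λ g = 0 := fun r V hV hLV hr g hg =>
    funext fun p => (hlam p g _ hg).trans <|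
      integral_dbar_mul_deriv_eq_zero hV hr (hχ p p.2) (hc p p.2) ((hs p p.2).trans hLV)
  have hΛ_inv : ∀ (p : P) (g : C(L, ℂ)), (∀ z : L, g z = ((z : ℂ) - p)⁻¹) →
      Λ g = Pi.single p (-(Real.pi : ℂ)) := fun p g hg => funext fun q => by
    refine (hlam q g (fun z => (z - p)⁻¹) hg).trans <|
      (integral_dbar_mul_inv_sub ((hχ q q.2).of_le one_le_two) (hc q q.2)
        (hχP q q.2 p p.2)).trans ?_
    by_cases hpq : q = p
    · simp [hpq]
    · rw [Pi.single_eq_of_ne hpq, if_neg fun h => hpq (Subtype.ext h.symm), mul_zero]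
  refine ⟨Λ, hΛ_deriv, hΛ_inv, fun q hq g hg hΛg => ?_⟩
  obtain ⟨c, G, hG⟩ := exists_isExactOn_sub_sum_mul_inv hq
  set e : P → C(L, ℂ) := fun p => -resolvent (coordinate L) (p : ℂ)
  have he : ∀ (p : P) (z : L), e p z = ((z : ℂ) - p)⁻¹ := fun p z => by
    rw [ContinuousMap.neg_apply, resolvent_coordinate_apply (hPL.notMem_of_mem_left p.2), ← inv_neg,
      neg_sub]
  have hΛ_sub : Λ (g - ∑ p : P, c p • e p) = 0 := by
    refine hΛ_deriv G _ P.finite_toSet.isClosed.isOpen_compl hLP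
      (fun z hz => (hG z hz).differentiableAt.differentiableWithinAt) _ fun z => ?_
    rw [(hG z (hLP z.2)).deriv]
    simp [hg, he, P.sum_attach fun p => c p * ((z : ℂ) - p)⁻¹]
  have hc0 : ∀ p ∈ P, c p = 0 := fun p hp => by
    have hΛp := congrFun hΛ_sub ⟨p, hp⟩
    simpa [hΛg, hΛ_inv _ _ (he _), Pi.single_apply, Real.pi_ne_zero] using hΛp
  refine ⟨G, fun z hz => (hG z hz).congr_deriv ?_⟩
  simp only [Finset.sum_eq_zero fun p hp => mul_eq_zero_of_left (hc0 p hp) _, sub_zero]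

end Periods

section Increments

/-- The functional is the line integral along the segment. -/
theorem exists_clm_eq_sub_of_segment_subset {L : Set ℂ} [CompactSpace L] {a b : ℂ}
    (hab : segment ℝ a b ⊆ L) :
    ∃ l : C(L, ℂ) →L[ℂ] ℂ, ∀ (g : C(L, ℂ)) (H : ℂ → ℂ), (∀ z : L, HasDerivAt H (g z) z) →
      l g = H b - H a := by
  have hmem : ∀ t : unitInterval, a + (t : ℝ) * (b - a) ∈ L := fun t =>
    hab (segment_eq_image' ℝ a b ▸ ⟨t, t.2, by simp⟩)
  set γ : unitInterval → L := fun t => ⟨_, hmem t⟩ with hγ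
  have hγc : Continuous γ := by rw [hγ]; fun_prop
  refine ⟨integralMulCLM (Measure.map γ volume) (.const L (b - a)), fun g H hH => ?_⟩
  set F : ℝ → ℂ := fun s => (b - a) * g (γ (projIcc 0 1 zero_le_one s)) with hF
  have hFc : Continuous F := by rw [hF]; fun_prop
  have hderiv : ∀ s ∈ uIcc (0 : ℝ) 1, HasDerivAt (fun s : ℝ => H (a + s * (b - a))) (F s) s := by
    intro s hs
    rw [uIcc_of_le zero_le_one] at hs
    have h1 : HasDerivAt (fun s : ℝ => a + s * (b - a)) (b - a) s := by
      simpa using ((hasDerivAt_id s).ofReal_comp.mul_const (b - a)).const_add a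
    simp only [hF, projIcc_of_mem _ hs]
    exact (hH (γ ⟨s, hs⟩)).scomp s h1
  calc integralMulCLM (Measure.map γ volume) (.const L (b - a)) g
      = ∫ t : unitInterval, (b - a) * g (γ t) := by
        rw [integralMulCLM_apply, integral_map hγc.aemeasurable
          (by exact (continuous_const.mul g.continuous).aestronglyMeasurable)]
        rfl
    _ = ∫ s in (0 : ℝ)..1, F s := by
        rw [intervalIntegral.integral_of_le zero_le_one, ← integral_Icc_eq_integral_Ioc,
          ← integral_subtype_comap measurableSet_Icc]
        exact integral_congr_ae (Eventually.of_forall fun t => by simp [hF])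
    _ = H b - H a := by
        rw [intervalIntegral.integral_eq_sub_of_hasDerivAt hderiv (hFc.intervalIntegrable _ _)]
        simp

theorem isCompact_segment (a b : ℂ) : IsCompact (segment ℝ a b) := by
  rw [segment_eq_image']
  exact isCompact_Icc.image (by fun_prop)

/-- The compact set is a polygonal path from `a` to `b`. -/
theorem exists_isCompact_clm_eq_sub {U : Set ℂ} (hU : IsOpen U) (hUc : IsPreconnected U)
    {a b : ℂ} (ha : a ∈ U) (hb : b ∈ U) :
    ∃ Γ ⊆ U, IsCompact Γ ∧ ∀ (L : Set ℂ) [CompactSpace L], Γ ⊆ L →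
      ∃ l : C(L, ℂ) →L[ℂ] ℂ, ∀ (g : C(L, ℂ)) (H : ℂ → ℂ), (∀ z : L, HasDerivAt H (g z) z) →
        l g = H b - H a := by
  refine hUc.induction₂ (fun a b => ∃ Γ ⊆ U, IsCompact Γ ∧ ∀ (L : Set ℂ) [CompactSpace L], Γ ⊆ L →
    ∃ l : C(L, ℂ) →L[ℂ] ℂ, ∀ (g : C(L, ℂ)) (H : ℂ → ℂ), (∀ z : L, HasDerivAt H (g z) z) →
      l g = H b - H a) (fun x hx => ?_) ?_ ?_ ha hb
  · obtain ⟨r, hr, hrU⟩ := Metric.isOpen_iff.1 hU x hx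
    filter_upwards [mem_nhdsWithin_of_mem_nhds (ball_mem_nhds x hr)] with y hy
    exact ⟨segment ℝ x y, ((convex_ball x r).segment_subset (mem_ball_self hr) hy).trans hrU,
      isCompact_segment x y, fun L _ => exists_clm_eq_sub_of_segment_subset⟩
  · rintro x y z - - - ⟨Γ, hΓ, hΓc, h⟩ ⟨Γ', hΓ', hΓc', h'⟩
    refine ⟨Γ ∪ Γ', union_subset hΓ hΓ', hΓc.union hΓc', fun L _ hL => ?_⟩
    obtain ⟨l, hl⟩ := h L (subset_union_left.trans hL)
    obtain ⟨l', hl'⟩ := h' L (subset_union_right.trans hL)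
    exact ⟨l + l', fun g H hH => by rw [add_apply, hl g H hH, hl' g H hH]; ring⟩
  · rintro x y - - ⟨Γ, hΓ, hΓc, h⟩
    refine ⟨Γ, hΓ, hΓc, fun L _ hL => ?_⟩
    obtain ⟨l, hl⟩ := h L hL
    exact ⟨-l, fun g H hH => by rw [neg_apply, hl g H hH, neg_sub]⟩

/-- A quantitative form of Liouville's theorem: otherwise `(E - D)⁻¹` is bounded by `1 / ε`, and
Cauchy's estimate bounds its derivative at `0`. -/
theorem exists_norm_sub_lt_of_lt_norm_deriv {E : ℂ → ℂ} {R ε : ℝ} (hR : 0 < R) (hε : 0 < ε)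
    (hE : DifferentiableOn ℂ E (ball 0 R)) {D : ℂ}
    (hRD : ‖E 0 - D‖ ^ 2 < ε * R * ‖deriv E 0‖) : ∃ s ∈ ball (0 : ℂ) R, ‖E s - D‖ < ε := by
  by_contra! hfar
  have h0 : (0 : ℂ) ∈ ball (0 : ℂ) R := mem_ball_self hR
  have hne : ∀ s ∈ ball (0 : ℂ) R, E s - D ≠ 0 := fun s hs =>
    norm_pos_iff.1 (hε.trans_le (hfar s hs))
  have hderiv : deriv (fun s => (E s - D)⁻¹) 0 = -deriv E 0 / (E 0 - D) ^ 2 :=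
    (((hE.differentiableAt (isOpen_ball.mem_nhds h0)).hasDerivAt.sub_const D).inv (hne 0 h0)).deriv
  have hpos : 0 < ‖E 0 - D‖ ^ 2 := pow_pos (norm_pos_iff.2 (hne 0 h0)) 2
  have hbound : ∀ r ∈ Ioo 0 R, ε * r * ‖deriv E 0‖ ≤ ‖E 0 - D‖ ^ 2 := fun r hr => by
    have hsub : closedBall (0 : ℂ) r ⊆ ball 0 R := closedBall_subset_ball hr.2
    have hcauchy := norm_deriv_le_of_forall_mem_sphere_norm_le (C := ε⁻¹) hr.1
      ((((hE.sub_const D).inv hne).mono hsub).diffContOnCl_ball subset_rfl) fun z hz => by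
        rw [Pi.inv_apply, norm_inv]
        exact inv_anti₀ hε (hfar z (hsub (sphere_subset_closedBall hz)))
    rw [Pi.inv_def, hderiv, norm_div, norm_neg, norm_pow, div_le_div_iff₀ hpos hr.1] at hcauchy
    rw [mul_assoc, ← le_inv_mul_iff₀ hε]
    linarith
  have hlim : Tendsto (fun r => ε * r * ‖deriv E 0‖) (𝓝[<] R) (𝓝 (ε * R * ‖deriv E 0‖)) :=
    (Continuous.tendsto (by fun_prop) R).mono_left nhdsWithin_le_nhds
  exact hRD.not_ge (le_of_tendsto hlim (eventually_of_mem (Ioo_mem_nhdsLT hR) hbound))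

end Increments

section Correction

variable {X : Type*} [NormedCommRing X] [NormedAlgebra ℂ X]

/-- The linear combinations `t ↦ ∑ i, t i • w i` of a finite family, as a continuous linear map. -/
noncomputable def combine {ι : Type*} [Fintype ι] (w : ι → X) : (ι → ℂ) →L[ℂ] X :=
  ∑ i, (ContinuousLinearMap.proj (R := ℂ) (φ := fun _ : ι => ℂ) i).smulRight (w i)

theorem combine_apply {ι : Type*} [Fintype ι] (w : ι → X) (t : ι → ℂ) :
    combine w t = ∑ i, t i • w i := by
  simp [combine]

theorem continuous_combine {ι : Type*} [Fintype ι] :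
    Continuous (combine : (ι → X) → (ι → ℂ) →L[ℂ] X) :=
  continuous_finsetSum _ fun i _ =>
    (ContinuousLinearMap.smulRightL ℂ (ι → ℂ) X (.proj i)).continuous.comp (continuous_apply i)

theorem isInvertible_comp_combine {ι : Type*} [Fintype ι] [DecidableEq ι] {b : X}
    {Λ : X →L[ℂ] (ι → ℂ)} {w : ι → X} {c : ℂ} (hc : c ≠ 0)
    (h : ∀ i, Λ (b * w i) = Pi.single i c) :
    (Λ ∘L (ContinuousLinearMap.mul ℂ X b) ∘L combine w).IsInvertible := by
  refine ⟨ContinuousLinearEquiv.smulLeft (Units.mk0 c hc), ?_⟩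
  ext t i
  simp only [ContinuousLinearMap.comp_apply, combine_apply, map_sum, map_smul,
    ContinuousLinearMap.mul_apply', h]
  simp [Finset.sum_apply, Pi.single_apply, mul_comm]

theorem eventually_isInvertible_comp_combine {ι : Type*} [Fintype ι] {b : X}
    {Λ : X →L[ℂ] (ι → ℂ)} {w : ι → X}
    (h : (Λ ∘L (ContinuousLinearMap.mul ℂ X b) ∘L combine w).IsInvertible) :
    ∀ᶠ v in 𝓝 w, (Λ ∘L (ContinuousLinearMap.mul ℂ X b) ∘L combine v).IsInvertible :=
  (continuous_const.clm_comp (continuous_const.clm_comp continuous_combine)).continuousAt.eventually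
    (ContinuousLinearEquiv.isOpen.mem_nhds h)

variable [CompleteSpace X] {T : Type*} [NormedAddCommGroup T] [NormedSpace ℂ T]

theorem contDiff_normedSpace_exp {n : ℕ∞} :
    ContDiff ℂ n (NormedSpace.exp : X → X) :=
  contDiff_iff_contDiffAt.2 fun x => (NormedSpace.exp_analytic (𝕂 := ℂ) x).contDiffAt

theorem hasFDerivAt_mul_exp (b : X) (w : T →L[ℂ] X) :
    HasFDerivAt (fun p : X × T => p.1 * NormedSpace.exp (w p.2))
      (.fst ℂ X T + ContinuousLinearMap.mul ℂ X b ∘L w ∘L .snd ℂ X T) (b, 0) := by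
  have hexp : HasFDerivAt (fun p : X × T => NormedSpace.exp (w p.2)) (w ∘L .snd ℂ X T) (b, 0) :=
    HasFDerivAt.comp (g := NormedSpace.exp) (g' := 1) (b, 0)
      (by simpa using hasFDerivAt_exp_zero (𝕂 := ℂ) (𝔸 := X))
      (w ∘L ContinuousLinearMap.snd ℂ X T).hasFDerivAt
  convert! hasFDerivAt_fst.mul hexp using 1
  ext p <;> simp

theorem hasDerivAt_mul_exp_smul_mul_exp (b v : X) (w : T →L[ℂ] X) {σ : ℂ → T} (hσ0 : σ 0 = 0)
    (hσ : HasDerivAt σ 0 0) :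
    HasDerivAt (fun s : ℂ => b * NormedSpace.exp (s • v) * NormedSpace.exp (w (σ s)))
      (b * v) 0 := by
  have hw : HasDerivAt (fun s => NormedSpace.exp (w (σ s))) 0 0 := by
    have hexp : HasFDerivAt (NormedSpace.exp : X → X) (1 : X →L[ℂ] X) (w (σ 0)) := by
      simpa [hσ0] using hasFDerivAt_exp_zero (𝕂 := ℂ) (𝔸 := X)
    exact (hexp.comp_hasDerivAt 0 (w.hasFDerivAt.comp_hasDerivAt 0 hσ)).congr_deriv (by simp)
  exact (((hasDerivAt_exp_smul_const v (0 : ℂ)).const_mul b).mul hw).congr_deriv (by simp [hσ0])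

theorem differentiableOn_mul_exp_smul_mul_exp (b v : X) (w : T →L[ℂ] X) {σ : ℂ → T} {S : Set ℂ}
    (hσ : DifferentiableOn ℂ σ S) :
    DifferentiableOn ℂ
      (fun s : ℂ => b * NormedSpace.exp (s • v) * NormedSpace.exp (w (σ s))) S :=
  ((differentiable_const b).mul (differentiable_exp_smul_const ℂ v)).differentiableOn.mul
    ((contDiff_normedSpace_exp.differentiable one_ne_zero).comp_differentiableOn
      (w.differentiable.comp_differentiableOn hσ))

variable [CompleteSpace T]

/-- The implicit function theorem for the equation `Λ (q * exp (w t)) = 0` near `(q, t) = (b, 0)`: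
the correction of a small perturbation `q` of `b`, so as to lie in the kernel of `Λ`. -/
theorem exists_correction {b : X} {Λ : X →L[ℂ] T} {w : T →L[ℂ] X} (hb : Λ b = 0)
    (hinv : (Λ ∘L (ContinuousLinearMap.mul ℂ X b) ∘L w).IsInvertible) :
    ∃ τ : X → T, τ b = 0 ∧ ContDiffAt ℂ 1 τ b ∧
      (∀ᶠ q in 𝓝 b, Λ (q * NormedSpace.exp (w (τ q))) = 0) ∧
      ∀ v, Λ v = 0 → fderiv ℂ τ b v = 0 := by
  set F : X × T → T := fun p => Λ (p.1 * NormedSpace.exp (w p.2)) with hF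
  have hFc : ContDiffAt ℂ 1 F (b, 0) := (Λ.contDiff.comp (contDiff_fst.mul
    (contDiff_normedSpace_exp.comp (w.contDiff.comp contDiff_snd)))).contDiffAt
  have hFd : fderiv ℂ F (b, 0) =
      Λ ∘L (.fst ℂ X T + ContinuousLinearMap.mul ℂ X b ∘L w ∘L .snd ℂ X T) :=
    (Λ.hasFDerivAt.comp _ (hasFDerivAt_mul_exp b w)).fderiv
  have hinv' : (fderiv ℂ F (b, 0) ∘L .inr ℂ X T).IsInvertible := by
    rw [hFd]
    convert! hinv using 1
    ext t
    simp
  refine ⟨hFc.implicitFunction one_ne_zero hinv', hFc.implicitFunction_apply_self _ hinv',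
    hFc.contDiffAt_implicitFunction one_ne_zero hinv', ?_, fun v hv => ?_⟩
  · have hF0 : F (b, 0) = 0 := by simp [hF, hb]
    filter_upwards [hFc.eventually_apply_implicitFunction one_ne_zero hinv'] with q hq
    exact hq.trans hF0
  · rw [(hFc.hasStrictFDerivAt_implicitFunction one_ne_zero hinv').hasFDerivAt.fderiv, hFd]
    simp [hv]

theorem exists_correction_near {b : X} {Λ : X →L[ℂ] T} {w : T →L[ℂ] X} (hb : Λ b = 0)
    (hinv : (Λ ∘L (ContinuousLinearMap.mul ℂ X b) ∘L w).IsInvertible) {ε : ℝ} (hε : 0 < ε) :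
    ∃ τ : X → T, τ b = 0 ∧ (∀ v, Λ v = 0 → fderiv ℂ τ b v = 0) ∧
      ∀ᶠ q in 𝓝 b, DifferentiableAt ℂ τ q ∧ Λ (q * NormedSpace.exp (w (τ q))) = 0 ∧
        dist (q * NormedSpace.exp (w (τ q))) b < ε := by
  obtain ⟨τ, hτb, hτ, hΛ, hτ'⟩ := exists_correction hb hinv
  refine ⟨τ, hτb, hτ', (hτ.eventually (by simp)).mono (fun q hq => hq.differentiableAt one_ne_zero)
    |>.and (hΛ.and ?_)⟩
  have hcont : ContinuousAt (fun q => q * NormedSpace.exp (w (τ q))) b :=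
    continuousAt_id.mul ((contDiff_normedSpace_exp (n := 0)).continuous.continuousAt.comp
      (w.continuous.continuousAt.comp hτ.continuousAt))
  have hb : b * NormedSpace.exp (w (τ b)) = b := by
    rw [hτb, map_zero, NormedSpace.exp_zero, mul_one]
  rw [ContinuousAt, hb] at hcont
  exact hcont.eventually (ball_mem_nhds b hε)

/-- A tangent vector `b * v` in the kernel of `Λ` is followed by the curve
`s ↦ b * exp (s • v) * exp (w (σ s))` in the kernel, on a disc whose radius grows as `v` shrinks. -/
theorem exists_kernel_curve {b : X} {Λ : X →L[ℂ] T} {w : T →L[ℂ] X} (hb : Λ b = 0)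
    (hinv : (Λ ∘L (ContinuousLinearMap.mul ℂ X b) ∘L w).IsInvertible) {ε : ℝ} (hε : 0 < ε) :
    ∃ ρ > 0, ∀ v, Λ (b * v) = 0 → ∀ R > 0, R * ‖v‖ < ρ → ∃ σ : ℂ → T, σ 0 = 0 ∧
      DifferentiableOn ℂ σ (ball 0 R) ∧ HasDerivAt σ 0 0 ∧
      ∀ s ∈ ball (0 : ℂ) R, Λ (b * NormedSpace.exp (s • v) * NormedSpace.exp (w (σ s))) = 0 ∧
        dist (b * NormedSpace.exp (s • v) * NormedSpace.exp (w (σ s))) b < ε := by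
  obtain ⟨τ, hτb, hτ', hτ⟩ := exists_correction_near hb hinv hε
  have hcont : Tendsto (fun u => b * NormedSpace.exp u) (𝓝 0) (𝓝 b) :=
    (continuous_const.mul (contDiff_normedSpace_exp (n := 0)).continuous).tendsto' _ _ (by simp)
  obtain ⟨ρ, hρ, hgood⟩ := Metric.eventually_nhds_iff_ball.1 (hcont.eventually hτ)
  refine ⟨ρ, hρ, fun v hv R hR hRv => ?_⟩
  have hball : ∀ s ∈ ball (0 : ℂ) R, s • v ∈ ball (0 : X) ρ := fun s hs => by
    rw [mem_ball_zero_iff] at hs ⊢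
    rw [norm_smul]
    exact (mul_le_mul_of_nonneg_right hs.le (norm_nonneg _)).trans_lt hRv
  have hcurve : ∀ s : ℂ, HasDerivAt (fun s : ℂ => b * NormedSpace.exp (s • v))
      (b * (NormedSpace.exp (s • v) * v)) s := fun s =>
    (hasDerivAt_exp_smul_const v s).const_mul b
  have hderiv : ∀ s ∈ ball (0 : ℂ) R, HasDerivAt (fun s => τ (b * NormedSpace.exp (s • v)))
      (fderiv ℂ τ (b * NormedSpace.exp (s • v)) (b * (NormedSpace.exp (s • v) * v))) s :=
    fun s hs => (hgood _ (hball s hs)).1.hasFDerivAt.comp_hasDerivAt s (hcurve s)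
  refine ⟨fun s => τ (b * NormedSpace.exp (s • v)), by simp [hτb],
    fun s hs => (hderiv s hs).differentiableAt.differentiableWithinAt, ?_,
    fun s hs => (hgood _ (hball s hs)).2⟩
  simpa [hτ' _ hv] using hderiv 0 (mem_ball_self hR)

end Correction

section ExactDeformations

theorem mul_exp_combine_apply {Y ι : Type*} [TopologicalSpace Y] [CompactSpace Y] [Fintype ι]
    (g : C(Y, ℂ)) (w : ι → C(Y, ℂ)) (t : ι → ℂ) (y : Y) :
    (g * NormedSpace.exp (combine w t)) y = g y * exp (∑ i, t i * w i y) := by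
  rw [ContinuousMap.mul_apply, continuousMap_exp_apply, combine_apply, ContinuousMap.sum_apply]
  rfl

variable {P : Finset ℂ} {L : Set ℂ} [CompactSpace L] {Λ : C(L, ℂ) →L[ℂ] (P → ℂ)}

theorem IsPeriodFunctional.isInvertible_comp_combine (hΛ : IsPeriodFunctional P L Λ)
    {b : C(L, ℂ)} {w : P → C(L, ℂ)} (hw : ∀ p (z : L), b z * w p z = ((z : ℂ) - p)⁻¹) :
    (Λ ∘L (ContinuousLinearMap.mul ℂ C(L, ℂ) b) ∘L combine w).IsInvertible :=
  _root_.isInvertible_comp_combine (c := -(Real.pi : ℂ)) (by simp [Real.pi_ne_zero])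
    fun p => hΛ.apply_inv p _ (hw p)

theorem IsPeriodFunctional.isExactOn_mul_exp (hΛ : IsPeriodFunctional P L Λ) {q : ℂ → ℂ}
    (hq : DifferentiableOn ℂ q (P : Set ℂ)ᶜ) {W : P → ℂ → ℂ}
    (hW : ∀ p, DifferentiableOn ℂ (W p) (P : Set ℂ)ᶜ) {g : C(L, ℂ)} (hg : ∀ z : L, g z = q z)
    {w : P → C(L, ℂ)} (hw : ∀ p (z : L), w p z = W p z) {t : P → ℂ}
    (hΛ0 : Λ (g * NormedSpace.exp (combine w t)) = 0) :
    IsExactOn (fun z => q z * exp (∑ p, t p * W p z)) (P : Set ℂ)ᶜ :=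
  hΛ.isExactOn _ (hq.mul (DifferentiableOn.fun_sum fun p _ => (hW p).const_mul (t p)).cexp) _
    (fun z => by simp only [mul_exp_combine_apply, hg, hw]) hΛ0

theorem differentiableOn_inv_mul_sub {U : Set ℂ} {q : ℂ → ℂ} (hq : DifferentiableOn ℂ q U)
    (hq0 : ∀ z ∈ U, q z ≠ 0) {p : ℂ} (hp : p ∉ U) :
    DifferentiableOn ℂ (fun z => (q z * (z - p))⁻¹) U :=
  (hq.mul (by fun_prop)).inv fun z hz =>
    mul_ne_zero (hq0 z hz) (sub_ne_zero.2 fun h => hp (h ▸ hz))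

section Runge

variable {N U : Set ℂ} (hΛ : IsPeriodFunctional P L Λ) (hsep : Separates P L N)
  (hPL : (P : Set ℂ) ⊆ Lᶜ) (hN : IsCompact N) (hLN : L ⊆ N) (hU : IsOpen U) (hNU : N ⊆ U)
include hΛ hsep hPL hN hLN hU hNU

theorem IsPeriodFunctional.exists_isInvertible_comp_combine (hPU : ∀ p ∈ P, p ∉ U) {d : ℂ → ℂ}
    (hd : DifferentiableOn ℂ d U) (hd0 : ∀ z ∈ U, d z ≠ 0) {b : C(L, ℂ)} (hb : ∀ z : L, b z = d z) :
    ∃ (W : P → ℂ → ℂ) (w : P → C(L, ℂ)), (∀ p, DifferentiableOn ℂ (W p) (P : Set ℂ)ᶜ) ∧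
      (∀ p (z : L), w p z = W p z) ∧
      (Λ ∘L (ContinuousLinearMap.mul ℂ C(L, ℂ) b) ∘L combine w).IsInvertible := by
  have hLU := hLN.trans hNU
  have hLP : L ⊆ (P : Set ℂ)ᶜ := subset_compl_comm.1 hPL
  have hd' : ∀ p : P, DifferentiableOn ℂ (fun z => (d z * (z - p))⁻¹) U := fun p =>
    differentiableOn_inv_mul_sub hd hd0 (hPU p p.2)
  let w₀ : P → C(L, ℂ) := fun p => ⟨_, ((hd' p).continuousOn.mono hLU).domRestrict⟩
  have hw₀ : ∀ p (z : L), b z * w₀ p z = ((z : ℂ) - p)⁻¹ := fun p z => by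
    change b z * (d z * ((z : ℂ) - p))⁻¹ = _
    rw [hb, mul_inv, mul_inv_cancel_left₀ (hd0 z (hLU z.2))]
  obtain ⟨δ, hδ, hδinv⟩ := Metric.eventually_nhds_iff.1
    (eventually_isInvertible_comp_combine (hΛ.isInvertible_comp_combine hw₀))
  choose W hW hWw₀ using fun p : P =>
    hsep.exists_holomorphic_approx hPL hN hLN hU hNU (hd' p) (half_pos hδ)
  let w : P → C(L, ℂ) := fun p => ⟨_, ((hW p).continuousOn.mono hLP).domRestrict⟩
  refine ⟨W, w, hW, fun p z => rfl, hδinv ?_⟩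
  refine ((dist_pi_le_iff (half_pos hδ).le).2 fun p => ?_).trans_lt (half_lt_self hδ)
  refine (ContinuousMap.dist_le (half_pos hδ).le).2 fun z => ?_
  rw [dist_eq_norm]
  exact (hWw₀ p z z.2).le

/-- Approximate `deriv f` by nowhere vanishing functions and correct these so that they become
exact. -/
theorem IsPeriodFunctional.exists_exact_approx (hPU : ∀ p ∈ P, p ∉ U) {f : ℂ → ℂ}
    (hf : DifferentiableOn ℂ f U) (hf0 : ∀ z ∈ U, deriv f z ≠ 0) {ε : ℝ} (hε : 0 < ε) :
    ∃ q : ℂ → ℂ, DifferentiableOn ℂ q (P : Set ℂ)ᶜ ∧ (∀ z ∉ P, q z ≠ 0) ∧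
      IsExactOn q (P : Set ℂ)ᶜ ∧ ∀ z ∈ L, ‖q z - deriv f z‖ < ε := by
  have hLU := hLN.trans hNU
  have hLP : L ⊆ (P : Set ℂ)ᶜ := subset_compl_comm.1 hPL
  have hf' : DifferentiableOn ℂ (deriv f) U := hf.deriv hU
  let b : C(L, ℂ) := ⟨_, (hf'.continuousOn.mono hLU).domRestrict⟩
  obtain ⟨W, w, hW, hwW, hinv⟩ := hΛ.exists_isInvertible_comp_combine hsep hPL hN hLN hU hNU hPU
    hf' hf0 (b := b) fun z => rfl
  obtain ⟨τ, -, -, hτ⟩ := exists_correction_near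
    (hΛ.eq_zero_of_deriv f U hU hLU hf b fun z => rfl) hinv hε
  obtain ⟨η, hη, hball⟩ := Metric.eventually_nhds_iff.1 hτ
  obtain ⟨Q, hQ, hQ0, hQf⟩ := hsep.exists_nonvanishing_approx hPL hN hLN hU hNU hf' (half_pos hη)
    fun z hz => hf0 z (hNU hz)
  let g : C(L, ℂ) := ⟨_, (hQ.continuousOn.mono hLP).domRestrict⟩
  have hgb : dist g b < η := by
    refine ((ContinuousMap.dist_le (half_pos hη).le).2 fun z => ?_).trans_lt (half_lt_self hη)
    rw [dist_eq_norm]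
    exact (hQf z z.2).le
  obtain ⟨-, hker, hdist⟩ := hball hgb
  refine ⟨fun z => Q z * exp (∑ p, τ g p * W p z),
    hQ.mul (DifferentiableOn.fun_sum fun p _ => (hW p).const_mul _).cexp,
    fun z hz => mul_ne_zero (hQ0 z hz) (exp_ne_zero _),
    hΛ.isExactOn_mul_exp hQ hW (fun z => rfl) hwW hker, fun z hz => ?_⟩
  have happly := (ContinuousMap.dist_apply_le_dist (⟨z, hz⟩ : L)).trans_lt hdist
  simp only [mul_exp_combine_apply, hwW, dist_eq_norm] at happly
  exact happly

end Runge

end ExactDeformations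

section PrescribedIncrements

theorem Separates.mono {P L M L' M' : Set ℂ} (h : Separates P L M) (hL : L' ⊆ L) (hM : M ⊆ M') :
    Separates P L' M' := fun ζ hζ =>
  let ⟨C, hC, hCL, hζC⟩ := h ζ fun hζM => hζ (hM hζM)
  ⟨C, hC, hCL.trans (compl_subset_compl.2 hL), hζC⟩

theorem norm_deriv_le_of_forall_norm_sub_le {φ g : ℂ → ℂ} {M : Set ℂ} {z : ℂ} {r δ : ℝ}
    (hr : 0 < r) (hM : closedBall z r ⊆ M) (hφ : ∀ w ∈ M, DifferentiableAt ℂ φ w)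
    (hg : ∀ w ∈ M, HasDerivAt g 0 w) (hφg : ∀ w ∈ M, ‖φ w - g w‖ ≤ δ) :
    ‖deriv φ z‖ ≤ δ / r := by
  have hd : ∀ w ∈ M, HasDerivAt (fun w => φ w - g w) (deriv φ w - 0) w := fun w hw =>
    (hφ w hw).hasDerivAt.sub (hg w hw)
  have hdiff : DiffContOnCl ℂ (fun w => φ w - g w) (ball z r) :=
    DifferentiableOn.diffContOnCl fun w hw => (hd w (hM (closure_ball_subset_closedBall hw)))
      |>.differentiableAt.differentiableWithinAt
  have hle := norm_deriv_le_of_forall_mem_sphere_norm_le hr hdiff fun w hw =>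
    hφg w (hM (sphere_subset_closedBall hw))
  rwa [(hd z (hM (mem_closedBall_self hr.le))).deriv, sub_zero] at hle

theorem half_le_norm_sub {a b : ℂ} (ha : ‖a‖ ≤ 1 / 4) (hb : ‖b - 1‖ ≤ 1 / 4) :
    1 / 2 ≤ ‖b - a‖ := by
  have htri : ‖(1 : ℂ)‖ ≤ ‖b - a‖ + ‖a‖ + ‖b - 1‖ := by
    calc ‖(1 : ℂ)‖ = ‖b - a + a - (b - 1)‖ := by congr 1; ring
      _ ≤ ‖b - a‖ + ‖a‖ + ‖b - 1‖ := (norm_sub_le _ _).trans (by gcongr; exact norm_add_le _ _)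
  rw [norm_one] at htri
  linarith

/-- `φ` approximates the function equal to `0` on `U₁` and to `1` on `U₂`. -/
theorem Separates.exists_norm_deriv_le {P L M N U₁ U₂ : Set ℂ} (hsep : Separates P M N)
    (hL : IsCompact L) (hM : IsCompact M) (hN : IsCompact N) (hLM : L ⊆ interior M) (hMN : M ⊆ N)
    (hPM : P ⊆ Mᶜ) (h₁ : IsOpen U₁) (h₂ : IsOpen U₂) (hd : Disjoint U₁ U₂) (hNU : N ⊆ U₁ ∪ U₂)
    {z₁ z₂ : ℂ} (hz₁ : z₁ ∈ U₁ ∩ M) (hz₂ : z₂ ∈ U₂ ∩ M) {ε : ℝ} (hε : 0 < ε) :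
    ∃ φ : ℂ → ℂ, DifferentiableOn ℂ φ Pᶜ ∧ (∀ z ∈ L, ‖deriv φ z‖ ≤ ε) ∧
      1 / 2 ≤ ‖φ z₂ - φ z₁‖ := by
  classical
  have := isCompact_iff_compactSpace.1 hM
  obtain ⟨r, hr, hrM⟩ := hL.exists_cthickening_subset_open isOpen_interior hLM
  set g : ℂ → ℂ := U₂.indicator 1
  have hg1 : ∀ z ∈ U₁, g z = 0 := fun z hz => indicator_of_notMem (hd.notMem_of_mem_left hz) _
  have hg2 : ∀ z ∈ U₂, g z = 1 := fun z hz => indicator_of_mem hz _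
  have hgd : ∀ z ∈ U₁ ∪ U₂, HasDerivAt g 0 z := by
    rintro z (hz | hz)
    · exact (hasDerivAt_const z 0).congr_of_eventuallyEq (eventually_of_mem (h₁.mem_nhds hz) hg1)
    · exact (hasDerivAt_const z 1).congr_of_eventuallyEq (eventually_of_mem (h₂.mem_nhds hz) hg2)
  have hδ : 0 < min (ε * r) (1 / 4) := by positivity
  obtain ⟨φ, hφ, hφg⟩ := hsep.exists_holomorphic_approx hPM hN hMN (h₁.union h₂) hNU
    (fun z hz => (hgd z hz).differentiableAt.differentiableWithinAt) hδ
  have hφM : ∀ z ∈ interior M, DifferentiableAt ℂ φ z := fun z hz =>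
    hφ.differentiableAt (mem_of_superset (mem_interior_iff_mem_nhds.1 hz)
      (subset_compl_comm.1 hPM))
  refine ⟨φ, hφ, fun z hz => ?_, ?_⟩
  · rw [← mul_div_cancel_right₀ ε hr.ne']
    exact norm_deriv_le_of_forall_norm_sub_le hr ((closedBall_subset_cthickening hz r).trans hrM)
      hφM (fun w hw => hgd w (hNU (hMN (interior_subset hw))))
      fun w hw => (hφg w (interior_subset hw)).le.trans (min_le_left _ _)
  · have hφ₁ := (hφg z₁ hz₁.2).le.trans (min_le_right _ _)
    have hφ₂ := (hφg z₂ hz₂.2).le.trans (min_le_right _ _)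
    rw [hg1 z₁ hz₁.1, sub_zero] at hφ₁
    rw [hg2 z₂ hz₂.1] at hφ₂
    exact half_le_norm_sub hφ₁ hφ₂

variable {P : Finset ℂ} {q₀ : ℂ → ℂ}

/-- The deformation of `q₀` whose derivative in `s` at `s = 0`, `t = 0` is `deriv φ`, with one
correction parameter `t p` for the residue at each point `p` of `P`. -/
noncomputable def deform (P : Finset ℂ) (q₀ φ : ℂ → ℂ) (s : ℂ) (t : P → ℂ) (z : ℂ) : ℂ :=
  q₀ z * exp (s * (deriv φ z * (q₀ z)⁻¹)) * exp (∑ p : P, t p * (q₀ z * (z - p))⁻¹)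

theorem deform_zero_zero (φ : ℂ → ℂ) : deform P q₀ φ 0 0 = q₀ := by
  ext z
  simp [deform]

theorem deform_ne_zero {φ : ℂ → ℂ} {s : ℂ} {t : P → ℂ} {z : ℂ} (hz : q₀ z ≠ 0) :
    deform P q₀ φ s t z ≠ 0 :=
  mul_ne_zero (mul_ne_zero hz (exp_ne_zero _)) (exp_ne_zero _)

theorem mul_exp_smul_mul_exp_combine_apply {Y : Set ℂ} [CompactSpace Y] {b v : C(Y, ℂ)}
    {w : P → C(Y, ℂ)} {φ : ℂ → ℂ} (hb : ∀ z : Y, b z = q₀ z)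
    (hv : ∀ z : Y, v z = deriv φ z * (q₀ z)⁻¹) (hw : ∀ p (z : Y), w p z = (q₀ z * (z - p))⁻¹)
    (s : ℂ) (t : P → ℂ) (z : Y) :
    (b * NormedSpace.exp (s • v) * NormedSpace.exp (combine w t)) z = deform P q₀ φ s t z := by
  rw [mul_exp_combine_apply]
  simp only [ContinuousMap.mul_apply, continuousMap_exp_apply, ContinuousMap.smul_apply,
    smul_eq_mul, hb, hv, hw, deform]

theorem mul_norm_mul_lt {X : Type*} [NormedRing X] {a c : X} {R ρ : ℝ} (hR : 0 ≤ R) (hρ : 0 < ρ)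
    (ha : R * ‖a‖ ≤ ρ / (‖c‖ + 1)) : R * ‖a * c‖ < ρ :=
  calc R * ‖a * c‖ ≤ R * (‖a‖ * ‖c‖) := by gcongr; exact norm_mul_le a c
    _ = R * ‖a‖ * ‖c‖ := (mul_assoc _ _ _).symm
    _ ≤ ρ / (‖c‖ + 1) * ‖c‖ := by gcongr
    _ = ρ * (‖c‖ / (‖c‖ + 1)) := by ring
    _ < ρ := mul_lt_of_lt_one_right hρ ((div_lt_one (by positivity)).2 (lt_add_one _))

variable (hq : DifferentiableOn ℂ q₀ (P : Set ℂ)ᶜ) (hq0 : ∀ z ∉ P, q₀ z ≠ 0)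
include hq hq0

theorem differentiableOn_inv_mul_sub_mem (p : P) :
    DifferentiableOn ℂ (fun z => (q₀ z * (z - p))⁻¹) (P : Set ℂ)ᶜ :=
  differentiableOn_inv_mul_sub hq hq0 fun hp => hp p.2

theorem differentiableOn_deriv_mul_inv {φ : ℂ → ℂ} (hφ : DifferentiableOn ℂ φ (P : Set ℂ)ᶜ) :
    DifferentiableOn ℂ (fun z => deriv φ z * (q₀ z)⁻¹) (P : Set ℂ)ᶜ :=
  (hφ.deriv P.finite_toSet.isClosed.isOpen_compl).mul (hq.inv hq0)

theorem differentiableOn_deform {φ : ℂ → ℂ} (hφ : DifferentiableOn ℂ φ (P : Set ℂ)ᶜ) (s : ℂ)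
    (t : P → ℂ) : DifferentiableOn ℂ (deform P q₀ φ s t) (P : Set ℂ)ᶜ :=
  (hq.mul ((differentiableOn_deriv_mul_inv hq hq0 hφ).const_mul s).cexp).mul
    (DifferentiableOn.fun_sum fun p _ =>
      (differentiableOn_inv_mul_sub_mem hq hq0 p).const_mul (t p)).cexp

theorem IsPeriodFunctional.exists_exact_deform {L : Set ℂ} [CompactSpace L]
    {Λ : C(L, ℂ) →L[ℂ] (P → ℂ)} (hΛ : IsPeriodFunctional P L Λ) (hLP : L ⊆ (P : Set ℂ)ᶜ)
    (hH : IsExactOn q₀ (P : Set ℂ)ᶜ) {ε : ℝ} (hε : 0 < ε) :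
    ∃ ρ > 0, ∀ φ : ℂ → ℂ, DifferentiableOn ℂ φ (P : Set ℂ)ᶜ → ∀ R > 0,
      (∀ z ∈ L, R * ‖deriv φ z‖ ≤ ρ) → ∃ σ : ℂ → P → ℂ, σ 0 = 0 ∧
        DifferentiableOn ℂ σ (ball 0 R) ∧ HasDerivAt σ 0 0 ∧ ∀ s ∈ ball (0 : ℂ) R,
          IsExactOn (deform P q₀ φ s (σ s)) (P : Set ℂ)ᶜ ∧
          ∀ z ∈ L, ‖deform P q₀ φ s (σ s) z - q₀ z‖ < ε := by
  have hPo : IsOpen (P : Set ℂ)ᶜ := P.finite_toSet.isClosed.isOpen_compl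
  let b : C(L, ℂ) := ⟨_, (hq.continuousOn.mono hLP).domRestrict⟩
  let c : C(L, ℂ) := ⟨_, ((hq.inv hq0).continuousOn.mono hLP).domRestrict⟩
  let w : P → C(L, ℂ) := fun p =>
    ⟨_, ((differentiableOn_inv_mul_sub_mem hq hq0 p).continuousOn.mono hLP).domRestrict⟩
  have hbc : b * c = 1 := ContinuousMap.ext fun z => mul_inv_cancel₀ (hq0 z (hLP z.2))
  obtain ⟨H₀, hH₀⟩ := hH
  have hb : Λ b = 0 := hΛ.eq_zero_of_deriv H₀ _ hPo hLP
    (fun z hz => (hH₀ z hz).differentiableAt.differentiableWithinAt) b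
    fun z => (hH₀ z (hLP z.2)).deriv.symm
  have hinv := hΛ.isInvertible_comp_combine (b := b) (w := w) fun p z => by
    change q₀ z * (q₀ z * ((z : ℂ) - p))⁻¹ = _
    rw [mul_inv, mul_inv_cancel_left₀ (hq0 z (hLP z.2))]
  obtain ⟨ρ, hρ, hcurve⟩ := exists_kernel_curve hb hinv hε
  refine ⟨ρ / (‖c‖ + 1), by positivity, fun φ hφ R hR hφR => ?_⟩
  let a : C(L, ℂ) := ⟨_, ((hφ.deriv hPo).continuousOn.mono hLP).domRestrict⟩
  have ha : Λ (b * (a * c)) = 0 := by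
    rw [mul_left_comm, hbc, mul_one]
    exact hΛ.eq_zero_of_deriv φ _ hPo hLP hφ a fun z => rfl
  have haR : R * ‖a‖ ≤ ρ / (‖c‖ + 1) := (le_div_iff₀' hR).1 <|
    (ContinuousMap.norm_le _ (by positivity)).2 fun z => (le_div_iff₀' hR).2 (hφR z z.2)
  obtain ⟨σ, hσ0, hσd, hσ', hσ⟩ := hcurve _ ha R hR (mul_norm_mul_lt hR.le hρ haR)
  have hdeform := fun s => mul_exp_smul_mul_exp_combine_apply (b := b) (v := a * c) (w := w)
    (φ := φ) (fun _ => rfl) (fun _ => rfl) (fun _ _ => rfl) s (σ s)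
  refine ⟨σ, hσ0, hσd, hσ', fun s hs => ⟨hΛ.isExactOn _ (differentiableOn_deform hq hq0 hφ s _) _
    (hdeform s) (hσ s hs).1, fun z hz => ?_⟩⟩
  have hdist := (ContinuousMap.dist_apply_le_dist (⟨z, hz⟩ : L)).trans_lt (hσ s hs).2
  rw [hdeform, dist_eq_norm] at hdist
  exact hdist

theorem exists_differentiableOn_eq_sub {φ : ℂ → ℂ} (hφ : DifferentiableOn ℂ φ (P : Set ℂ)ᶜ)
    {σ : ℂ → P → ℂ} {S : Set ℂ} (hσ0 : σ 0 = 0) (hσ : DifferentiableOn ℂ σ S)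
    (hσ' : HasDerivAt σ 0 0) {z₁ z₂ : ℂ} (hz₁ : z₁ ∉ P) (hz₂ : z₂ ∉ P) :
    ∃ E : ℂ → ℂ, DifferentiableOn ℂ E S ∧ HasDerivAt E (φ z₂ - φ z₁) 0 ∧
      ∀ s H, (∀ z ∉ P, HasDerivAt H (deform P q₀ φ s (σ s) z) z) → E s = H z₂ - H z₁ := by
  have hPo : IsOpen (P : Set ℂ)ᶜ := P.finite_toSet.isClosed.isOpen_compl
  have hPc : IsPreconnected (P : Set ℂ)ᶜ :=
    (P.countable_toSet.isConnected_compl_of_one_lt_rank (by simp)).isPreconnected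
  obtain ⟨Γ, hΓP, hΓ, hl⟩ := exists_isCompact_clm_eq_sub hPo hPc hz₁ hz₂
  have := isCompact_iff_compactSpace.1 hΓ
  obtain ⟨l, hl⟩ := hl Γ subset_rfl
  let b : C(Γ, ℂ) := ⟨_, (hq.continuousOn.mono hΓP).domRestrict⟩
  let v : C(Γ, ℂ) :=
    ⟨_, ((differentiableOn_deriv_mul_inv hq hq0 hφ).continuousOn.mono hΓP).domRestrict⟩
  let w : P → C(Γ, ℂ) := fun p =>
    ⟨_, ((differentiableOn_inv_mul_sub_mem hq hq0 p).continuousOn.mono hΓP).domRestrict⟩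
  refine ⟨fun s => l (b * NormedSpace.exp (s • v) * NormedSpace.exp (combine w (σ s))),
    l.differentiable.comp_differentiableOn (differentiableOn_mul_exp_smul_mul_exp b v _ hσ), ?_,
    fun s H hH => hl _ H fun z => ?_⟩
  · have hbv : l (b * v) = φ z₂ - φ z₁ := hl _ φ fun z => by
      have hz : (b * v) z = deriv φ z := by
        change q₀ z * (deriv φ z * (q₀ z)⁻¹) = _
        rw [mul_left_comm, mul_inv_cancel₀ (hq0 z (hΓP z.2)), mul_one]
      rw [hz]
      exact (hφ.differentiableAt (hPo.mem_nhds (hΓP z.2))).hasDerivAt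
    exact hbv ▸ l.hasFDerivAt.comp_hasDerivAt 0
      (hasDerivAt_mul_exp_smul_mul_exp b v (combine w) hσ0 hσ')
  · rw [mul_exp_smul_mul_exp_combine_apply (b := b) (v := v) (w := w) (φ := φ) (fun _ => rfl)
      (fun _ => rfl) fun _ _ => rfl]
    exact hH z (hΓP z.2)

/-- By Liouville's theorem, the increment along a deformation over a large disc comes close to every
value. -/
theorem IsPeriodFunctional.exists_prescribed_increment {L : Set ℂ} [CompactSpace L]
    {Λ : C(L, ℂ) →L[ℂ] (P → ℂ)} (hΛ : IsPeriodFunctional P L Λ) (hLP : L ⊆ (P : Set ℂ)ᶜ)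
    (hexact : IsExactOn q₀ (P : Set ℂ)ᶜ) {z₁ z₂ : ℂ} (hz₁ : z₁ ∉ P) (hz₂ : z₂ ∉ P)
    (hφ : ∀ ε > 0, ∃ φ : ℂ → ℂ, DifferentiableOn ℂ φ (P : Set ℂ)ᶜ ∧
      (∀ z ∈ L, ‖deriv φ z‖ ≤ ε) ∧ 1 / 2 ≤ ‖φ z₂ - φ z₁‖)
    (D : ℂ) {ε : ℝ} (hε : 0 < ε) :
    ∃ H q : ℂ → ℂ, (∀ z ∉ P, HasDerivAt H (q z) z ∧ q z ≠ 0) ∧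
      (∀ z ∈ L, ‖q z - q₀ z‖ < ε) ∧ ‖H z₂ - H z₁ - D‖ < ε := by
  obtain ⟨ρ, hρ, hdeform⟩ := hΛ.exists_exact_deform hq hq0 hLP hexact hε
  obtain ⟨H₀, hH₀⟩ := hexact
  obtain ⟨R, hR⟩ := exists_gt (max 0 (2 * ‖H₀ z₂ - H₀ z₁ - D‖ ^ 2 / ε))
  rw [max_lt_iff, div_lt_iff₀ hε] at hR
  obtain ⟨hR0, hRD⟩ := hR
  obtain ⟨φ, hφ, hφL, hφz⟩ := hφ (ρ / R) (by positivity)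
  obtain ⟨σ, hσ0, hσd, hσ', hσ⟩ :=
    hdeform φ hφ R hR0 fun z hz => (le_div_iff₀' hR0).1 (hφL z hz)
  obtain ⟨E, hE, hE', hEH⟩ := exists_differentiableOn_eq_sub hq hq0 hφ hσ0 hσd hσ' hz₁ hz₂
  have hE0 : E 0 = H₀ z₂ - H₀ z₁ := hEH 0 H₀ (by rw [hσ0, deform_zero_zero]; exact hH₀)
  obtain ⟨s, hs, hsD⟩ : ∃ s ∈ ball (0 : ℂ) R, ‖E s - D‖ < ε := by
    refine exists_norm_sub_lt_of_lt_norm_deriv hR0 hε hE ?_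
    rw [hE0, hE'.deriv]
    calc ‖H₀ z₂ - H₀ z₁ - D‖ ^ 2 < ε * R * (1 / 2) := by linarith
      _ ≤ ε * R * ‖φ z₂ - φ z₁‖ := by gcongr
  obtain ⟨⟨H, hH⟩, hnear⟩ := hσ s hs
  exact ⟨H, _, fun z hz => ⟨hH z hz, deform_ne_zero (hq0 z hz)⟩, hnear, hEH s H hH ▸ hsD⟩

end PrescribedIncrements

theorem IsPeriodFunctional.exists_hasDerivAt_ne_zero_approx {P : Finset ℂ} {L : Set ℂ}
    [CompactSpace L] {Λ : C(L, ℂ) →L[ℂ] (P → ℂ)} (hΛ : IsPeriodFunctional P L Λ)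
    {M N U₁ U₂ : Set ℂ} (hM : IsCompact M) (hN : IsCompact N) (hLM : L ⊆ interior M) (hMN : M ⊆ N)
    (h₁ : IsOpen U₁) (h₂ : IsOpen U₂) (hd : Disjoint U₁ U₂) (hNU : N ⊆ U₁ ∪ U₂)
    (hPU : ∀ p ∈ P, p ∉ U₁ ∪ U₂) (hsep : Separates P M N)
    {z₁ z₂ : ℂ} (hz₁ : z₁ ∈ U₁ ∩ L) (hz₂ : z₂ ∈ U₂ ∩ L) {f : ℂ → ℂ}
    (hf : DifferentiableOn ℂ f (U₁ ∪ U₂)) (hf0 : ∀ z ∈ U₁ ∪ U₂, deriv f z ≠ 0)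
    {ε : ℝ} (hε : 0 < ε) :
    ∃ h q : ℂ → ℂ, (∀ z ∉ P, HasDerivAt h (q z) z ∧ q z ≠ 0) ∧
      (∀ z ∈ L, ‖q z - deriv f z‖ < ε) ∧ h z₁ = f z₁ ∧ ‖h z₂ - f z₂‖ < ε := by
  have hLM' : L ⊆ M := hLM.trans interior_subset
  have hPM : (P : Set ℂ) ⊆ Mᶜ := fun p hp hpM => hPU p hp (hNU (hMN hpM))
  have hPL : (P : Set ℂ) ⊆ Lᶜ := hPM.trans (compl_subset_compl.2 hLM')
  have hLP : L ⊆ (P : Set ℂ)ᶜ := subset_compl_comm.1 hPL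
  obtain ⟨q₀, hq₀, hq₀0, hexact, hq₀f⟩ := hΛ.exists_exact_approx (hsep.mono hLM' subset_rfl) hPL hN
    (hLM'.trans hMN) (h₁.union h₂) hNU hPU hf hf0 (half_pos hε)
  obtain ⟨H, q, hHq, hqq₀, hD⟩ := hΛ.exists_prescribed_increment hq₀ hq₀0 hLP hexact
    (hLP hz₁.2) (hLP hz₂.2) (fun η hη => hsep.exists_norm_deriv_le
      (isCompact_iff_compactSpace.2 ‹_›) hM hN hLM hMN hPM h₁ h₂ hd hNU ⟨hz₁.1, hLM' hz₁.2⟩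
      ⟨hz₂.1, hLM' hz₂.2⟩ hη) (f z₂ - f z₁) (half_pos hε)
  refine ⟨fun z => H z + (f z₁ - H z₁), q, fun z hz => ⟨(hHq z hz).1.add_const _, (hHq z hz).2⟩,
    fun z hz => ?_, by ring, ?_⟩
  · rw [← add_halves ε]
    exact (norm_sub_le_norm_sub_add_norm_sub ..).trans_lt (add_lt_add (hqq₀ z hz) (hq₀f z hz))
  · have hincr : H z₂ + (f z₁ - H z₁) - f z₂ = H z₂ - H z₁ - (f z₂ - f z₁) := by ring
    rw [hincr]
    exact hD.trans (half_lt_self hε)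

section ComplementComponents

theorem closure_connectedComponentIn_compl_subset {X : Type*} [TopologicalSpace X]
    [LocallyConnectedSpace X] {C : Set X} (hC : IsClosed C) (z : X) :
    closure (connectedComponentIn Cᶜ z) ⊆ connectedComponentIn Cᶜ z ∪ C := fun w hw => by
  by_contra! hwn
  rw [mem_union, not_or] at hwn
  obtain ⟨v, hvw, hvz⟩ := mem_closure_iff.1 hw _ hC.isOpen_compl.connectedComponentIn
    (mem_connectedComponentIn hwn.2)
  exact hwn.1 (connectedComponentIn_eq hvz ▸ connectedComponentIn_eq hvw ▸
    mem_connectedComponentIn hwn.2)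

theorem frontier_connectedComponentIn_compl_subset {X : Type*} [TopologicalSpace X]
    [LocallyConnectedSpace X] {C : Set X} (hC : IsClosed C) (z : X) :
    frontier (connectedComponentIn Cᶜ z) ⊆ C := by
  rw [hC.isOpen_compl.connectedComponentIn.frontier_eq, sdiff_subset_iff]
  exact closure_connectedComponentIn_compl_subset hC z

theorem isPreconnected_compl_ball (R : ℝ) : IsPreconnected (ball (0 : ℂ) R)ᶜ := by
  have himage : (ball (0 : ℂ) R)ᶜ = (fun x : ℝ × ℝ => x.1 * exp (x.2 * I)) '' Ici R ×ˢ univ := by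
    ext z
    rw [mem_compl_iff, mem_ball_zero_iff, not_lt]
    refine ⟨fun hz => ⟨(‖z‖, arg z), ⟨hz, mem_univ _⟩, norm_mul_exp_arg_mul_I z⟩, ?_⟩
    rintro ⟨⟨r, θ⟩, ⟨hr, -⟩, rfl⟩
    rw [norm_mul, norm_exp_ofReal_mul_I, mul_one, norm_real]
    exact (mem_Ici.1 hr).trans (le_abs_self r)
  rw [himage]
  exact (isPreconnected_Ici.prod isPreconnected_univ).image _ (by fun_prop)

theorem not_isBounded_compl_ball (R : ℝ) : ¬ Bornology.IsBounded (ball (0 : ℂ) R)ᶜ := fun h =>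
  NormedSpace.unbounded_univ ℝ ℂ (union_compl_self (ball (0 : ℂ) R) ▸ isBounded_ball.union h)

/-- Choose a point of `S` in each of the finitely many bounded components of the complement of `K`
that are not contained in `V`. -/
theorem exists_finset_separates {K V S : Set ℂ} (hK : IsCompact K) (hV : IsOpen V) (hKV : K ⊆ V)
    (hS : ∀ ζ ∉ K, Bornology.IsBounded (connectedComponentIn Kᶜ ζ) →
      (S ∩ connectedComponentIn Kᶜ ζ).Nonempty) :
    ∃ P : Finset ℂ, (P : Set ℂ) ⊆ S ∧ InjOn (connectedComponentIn Kᶜ) P ∧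
      (∀ p ∈ P, Bornology.IsBounded (connectedComponentIn Kᶜ p)) ∧ Separates P K V := by
  classical
  obtain ⟨R, hKR⟩ := hK.isBounded.subset_ball 0
  choose! rep hrep using fun (C : Set ℂ) (hC : (S ∩ C).Nonempty) => hC
  obtain ⟨T, hTV, hT⟩ := ((isCompact_closedBall (0 : ℂ) R).diff hV).elim_nhds_subcover
    (connectedComponentIn Kᶜ) fun ζ hζ => hK.isClosed.isOpen_compl.connectedComponentIn.mem_nhds
      (mem_connectedComponentIn fun hζK => hζ.2 (hKV hζK))
  have hrepT : ∀ ζ ∈ T, Bornology.IsBounded (connectedComponentIn Kᶜ ζ) →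
      rep (connectedComponentIn Kᶜ ζ) ∈ S ∩ connectedComponentIn Kᶜ ζ := fun ζ hζ hb =>
    hrep _ (hS ζ (fun hζK => (hTV ζ hζ).2 (hKV hζK)) hb)
  refine ⟨(T.filter fun ζ => Bornology.IsBounded (connectedComponentIn Kᶜ ζ)).image
    fun ζ => rep (connectedComponentIn Kᶜ ζ), ?_, ?_, ?_, fun ζ hζ => ?_⟩
  · simp only [Finset.coe_image, Finset.coe_filter, image_subset_iff]
    exact fun ζ hζ => (hrepT ζ hζ.1 hζ.2).1
  · simp only [Finset.coe_image, Finset.coe_filter]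
    rintro _ ⟨ζ, hζ, rfl⟩ _ ⟨ξ, hξ, rfl⟩ h
    simp only [← connectedComponentIn_eq (hrepT ζ hζ.1 hζ.2).2,
      ← connectedComponentIn_eq (hrepT ξ hξ.1 hξ.2).2] at h
    exact congrArg rep h
  · simp only [Finset.mem_image, Finset.mem_filter]
    rintro _ ⟨ζ, hζ, rfl⟩
    exact connectedComponentIn_eq (hrepT ζ hζ.1 hζ.2).2 ▸ hζ.2
  · refine ⟨_, isPreconnected_connectedComponentIn, connectedComponentIn_subset _ _,
      mem_connectedComponentIn fun hζK => hζ (hKV hζK), or_iff_not_imp_right.2 fun hb => ?_⟩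
    rw [not_not] at hb
    have hζR : ζ ∈ ball 0 R := by
      by_contra hζR
      refine not_isBounded_compl_ball R (hb.subset ?_)
      exact (isPreconnected_compl_ball R).subset_connectedComponentIn hζR
        (compl_subset_compl.2 hKR)
    obtain ⟨ξ, hξT, hξ⟩ := mem_iUnion₂.1 (hT ⟨ball_subset_closedBall hζR, hζ⟩)
    rw [← connectedComponentIn_eq hξ] at hb ⊢
    exact ⟨_, Finset.mem_image_of_mem _ (Finset.mem_filter.2 ⟨hξT, hb⟩), (hrepT ξ hξT hb).2⟩

theorem exists_ball_subset_isPreconnected_subset_compl_cthickening {K C : Set ℂ} (hK : IsCompact K)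
    (hC : IsPreconnected C) (hCK : C ⊆ Kᶜ) {ζ p : ℂ} (hζ : ζ ∈ C) (hp : p ∈ C) :
    ∃ δ > 0, ∃ r > 0, ∃ A, IsPreconnected A ∧ ball ζ r ⊆ A ∧ p ∈ A ∧ A ⊆ (cthickening δ K)ᶜ := by
  have hKo : IsOpen Kᶜ := hK.isClosed.isOpen_compl
  have hpath : IsPathConnected (connectedComponentIn Kᶜ ζ) :=
    hKo.connectedComponentIn.isConnected_iff_isPathConnected.1
      (isConnected_connectedComponentIn_iff.2 (hCK hζ))
  obtain ⟨γ, hγ⟩ := hpath.joinedIn ζ (mem_connectedComponentIn (hCK hζ)) p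
    (hC.subset_connectedComponentIn hζ hCK hp)
  obtain ⟨r, hr, hrK⟩ := nhds_basis_closedBall.mem_iff.1 (hKo.mem_nhds (hCK hζ))
  have hA : IsPreconnected (closedBall ζ r ∪ range γ) :=
    (convex_closedBall ζ r).isPreconnected.union ζ (mem_closedBall_self hr.le) ⟨0, γ.source⟩
      (isPreconnected_range γ.continuous)
  have hAK : closedBall ζ r ∪ range γ ⊆ Kᶜ :=
    union_subset hrK (range_subset_iff.2 fun t => connectedComponentIn_subset _ _ (hγ t))
  obtain ⟨δ, hδ, hKδ⟩ := hK.exists_cthickening_subset_open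
    (isClosed_closedBall.union (isCompact_range γ.continuous).isClosed).isOpen_compl
    (subset_compl_comm.1 hAK)
  exact ⟨δ, hδ, r, hr, _, hA, ball_subset_closedBall.trans subset_union_left,
    Or.inr ⟨1, γ.target⟩, subset_compl_comm.1 hKδ⟩

theorem exists_forall_isPreconnected_subset_compl_cthickening {K T Q : Set ℂ} (hK : IsCompact K)
    (hT : IsCompact T)
    (hQ : ∀ ζ ∈ T, ∃ C, IsPreconnected C ∧ C ⊆ Kᶜ ∧ ζ ∈ C ∧ (C ∩ Q).Nonempty) :
    ∃ δ > 0, ∀ ζ ∈ T, ∃ C, IsPreconnected C ∧ C ⊆ (cthickening δ K)ᶜ ∧ ζ ∈ C ∧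
      (C ∩ Q).Nonempty := by
  refine hT.induction_on (p := fun s => ∃ δ > 0, ∀ ζ ∈ s, ∃ C, IsPreconnected C ∧
    C ⊆ (cthickening δ K)ᶜ ∧ ζ ∈ C ∧ (C ∩ Q).Nonempty) ⟨1, one_pos, by simp⟩
    (fun s t hst ⟨δ, hδ, ht⟩ => ⟨δ, hδ, fun ζ hζ => ht ζ (hst hζ)⟩) ?_ fun ζ hζ => ?_
  · rintro s t ⟨δ, hδ, hs⟩ ⟨δ', hδ', ht⟩
    refine ⟨min δ δ', lt_min hδ hδ', ?_⟩
    rintro ζ (hζ | hζ)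
    · obtain ⟨C, hC, hCK, hζC, hCQ⟩ := hs ζ hζ
      exact ⟨C, hC, hCK.trans (compl_subset_compl.2 (cthickening_mono (min_le_left _ _) _)),
        hζC, hCQ⟩
    · obtain ⟨C, hC, hCK, hζC, hCQ⟩ := ht ζ hζ
      exact ⟨C, hC, hCK.trans (compl_subset_compl.2 (cthickening_mono (min_le_right _ _) _)),
        hζC, hCQ⟩
  · obtain ⟨C, hC, hCK, hζC, p, hpC, hpQ⟩ := hQ ζ hζ
    obtain ⟨δ, hδ, r, hr, A, hA, hrA, hpA, hAK⟩ :=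
      exists_ball_subset_isPreconnected_subset_compl_cthickening hK hC hCK hζC hpC
    exact ⟨ball ζ r, mem_nhdsWithin_of_mem_nhds (ball_mem_nhds ζ hr), δ, hδ,
      fun w hw => ⟨A, hA, hAK, hrA hw, p, hpA, hpQ⟩⟩

theorem Separates.exists_cthickening {P K V : Set ℂ} (h : Separates P K V) (hK : IsCompact K)
    (hV : IsOpen V) : ∃ δ > 0, Separates P (cthickening δ K) V := by
  obtain ⟨R, hKR⟩ := (hK.cthickening (r := 1)).isBounded.subset_ball 0
  have hQ : ∀ ζ ∈ closedBall 0 R \ V, ∃ C, IsPreconnected C ∧ C ⊆ Kᶜ ∧ ζ ∈ C ∧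
      (C ∩ (P ∪ (ball 0 R)ᶜ)).Nonempty := fun ζ hζ => by
    obtain ⟨C, hC, hCK, hζC, ⟨p, hpP, hpC⟩ | hCb⟩ := h ζ hζ.2
    · exact ⟨C, hC, hCK, hζC, p, hpC, Or.inl hpP⟩
    · obtain ⟨p, hpC, hpR⟩ := not_subset.1 fun hCR => hCb (isBounded_ball.subset hCR)
      exact ⟨C, hC, hCK, hζC, p, hpC, Or.inr hpR⟩
  obtain ⟨δ, hδ, hsep⟩ := exists_forall_isPreconnected_subset_compl_cthickening hK
    ((isCompact_closedBall 0 R).diff hV) hQ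
  have hδR : (ball 0 R)ᶜ ⊆ (cthickening (min δ 1) K)ᶜ :=
    compl_subset_compl.2 ((cthickening_mono (min_le_right _ _) _).trans hKR)
  refine ⟨min δ 1, lt_min hδ one_pos, fun ζ hζ => ?_⟩
  by_cases hζR : ζ ∈ ball 0 R
  · obtain ⟨C, hC, hCK, hζC, p, hpC, hp⟩ := hsep ζ ⟨ball_subset_closedBall hζR, hζ⟩
    have hCK' := hCK.trans (compl_subset_compl.2 (cthickening_mono (min_le_left δ 1) K))
    rcases hp with hpP | hpR
    · exact ⟨C, hC, hCK', hζC, Or.inl ⟨p, hpP, hpC⟩⟩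
    · exact ⟨C ∪ (ball 0 R)ᶜ, hC.union p hpC hpR (isPreconnected_compl_ball R),
        union_subset hCK' hδR, Or.inl hζC,
        Or.inr fun hb => not_isBounded_compl_ball R (hb.subset subset_union_right)⟩
  · exact ⟨_, isPreconnected_compl_ball R, hδR, hζR, Or.inr (not_isBounded_compl_ball R)⟩

theorem exists_contDiff_tsupport_fderiv_subset {H L : Set ℂ} (hH : Bornology.IsBounded H)
    (hL : IsCompact L) (hHL : frontier H ⊆ interior L) :
    ∃ χ : ℂ → ℂ, ContDiff ℝ ∞ χ ∧ HasCompactSupport χ ∧ tsupport (fderiv ℝ χ) ⊆ L ∧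
      (∀ z ∉ L, z ∈ H → ∀ᶠ w in 𝓝 z, χ w = 1) ∧ ∀ z ∉ L, z ∉ H → ∀ᶠ w in 𝓝 z, χ w = 0 := by
  obtain ⟨χ, hχ, hχ1, hχ0⟩ := exists_contDiff_eventually_eq_one_eventually_eq_zero
    (s := closure H \ interior L) (t := (interior H ∪ interior L)ᶜ)
    (isClosed_closure.sdiff isOpen_interior) (isOpen_interior.union isOpen_interior).isClosed_compl
    (disjoint_left.2 fun z hz hzt => hzt (Or.inl (by
      by_contra hzH
      exact hz.2 (hHL ⟨hz.1, hzH⟩))))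
  rw [eventually_nhdsSet_iff_forall] at hχ1 hχ0
  have hL' : ∀ z ∉ L, z ∉ interior L := fun z hz hzL => hz (interior_subset hzL)
  have hχH : ∀ z ∉ L, z ∈ H → ∀ᶠ w in 𝓝 z, χ w = 1 := fun z hz hzH =>
    hχ1 z ⟨subset_closure hzH, hL' z hz⟩
  have hχH' : ∀ z ∉ L, z ∉ H → ∀ᶠ w in 𝓝 z, χ w = 0 := fun z hz hzH =>
    hχ0 z fun h => h.elim (fun hzH' => hzH (interior_subset hzH')) (hL' z hz)
  refine ⟨χ, hχ, .of_support_subset_isCompact (hH.isCompact_closure.union hL) fun z hz => ?_,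
    fun z hz => ?_, hχH, hχH'⟩
  · by_contra! hzHL
    rw [mem_union, not_or] at hzHL
    exact hz (hχH' z hzHL.2 fun hzH => hzHL.1 (subset_closure hzH)).self_of_nhds
  · by_contra hzL
    by_cases hzH : z ∈ H
    · exact notMem_tsupport_fderiv_of_eventually_eq_const (hχH z hzL hzH) hz
    · exact notMem_tsupport_fderiv_of_eventually_eq_const (hχH' z hzL hzH) hz

end ComplementComponents

section ApproximationOnTwoContinua

theorem exists_forall_dist_le_of_isPreconnected {X E ι : Type*} [TopologicalSpace X]
    [PseudoMetricSpace E] {F : ι → X → E} {K : Set X} (hK : IsCompact K) (hKc : IsPreconnected K)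
    (hF : ∀ x ∈ K, ∃ C, ∀ᶠ y in 𝓝[K] x, ∀ i, dist (F i y) (F i x) ≤ C) {a : X} (ha : a ∈ K) :
    ∃ C, ∀ y ∈ K, ∀ i, dist (F i y) (F i a) ≤ C := by
  have hpt : ∀ y ∈ K, ∃ C, ∀ i, dist (F i y) (F i a) ≤ C := fun y hy => by
    refine hKc.induction₂ (fun x y => ∃ C, ∀ i, dist (F i y) (F i x) ≤ C) (fun x hx => ?_)
      ?_ ?_ ha hy
    · obtain ⟨C, hC⟩ := hF x hx
      exact hC.mono fun y hy => ⟨C, hy⟩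
    · rintro x y z - - - ⟨C, hC⟩ ⟨C', hC'⟩
      exact ⟨C' + C, fun i => (dist_triangle _ _ _).trans (add_le_add (hC' i) (hC i))⟩
    · rintro x y - - ⟨C, hC⟩
      exact ⟨C, fun i => dist_comm (F i y) (F i x) ▸ hC i⟩
  refine hK.induction_on (p := fun s => ∃ C, ∀ y ∈ s, ∀ i, dist (F i y) (F i a) ≤ C)
    ⟨0, by simp⟩ (fun s t hst ⟨C, hC⟩ => ⟨C, fun y hy => hC y (hst hy)⟩) ?_ fun x hx => ?_
  · rintro s t ⟨C, hC⟩ ⟨C', hC'⟩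
    exact ⟨max C C', fun y hy i => hy.elim (fun hy => (hC y hy i).trans (le_max_left _ _))
      fun hy => (hC' y hy i).trans (le_max_right _ _)⟩
  · obtain ⟨C, hC⟩ := hpt x hx
    obtain ⟨C', hC'⟩ := hF x hx
    exact ⟨_, hC', C' + C, fun y hy i =>
      (dist_triangle _ _ _).trans (add_le_add (hy i) (hC i))⟩

theorem exists_norm_sub_le_of_norm_deriv_le {K U : Set ℂ} (hK : IsCompact K)
    (hKc : IsPreconnected K) (hU : IsOpen U) (hKU : K ⊆ U) {a : ℂ} (ha : a ∈ K) :
    ∃ C, 0 ≤ C ∧ ∀ g : ℂ → ℂ, ∀ η > 0, (∀ z ∈ U, DifferentiableAt ℂ g z ∧ ‖deriv g z‖ ≤ η) →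
      ∀ z ∈ K, ‖g z - g a‖ ≤ C * η := by
  let F : {g : ℂ → ℂ // ∀ z ∈ U, DifferentiableAt ℂ g z ∧ ‖deriv g z‖ ≤ 1} → ℂ → ℂ := (↑)
  have hF : ∀ x ∈ K, ∃ C, ∀ᶠ y in 𝓝[K] x, ∀ i, dist (F i y) (F i x) ≤ C := fun x hx => by
    obtain ⟨r, hr, hrU⟩ := isOpen_iff.1 hU x (hKU hx)
    refine ⟨1 * r, mem_nhdsWithin_of_mem_nhds (mem_of_superset (ball_mem_nhds x hr) ?_)⟩
    intro y hy g
    rw [dist_eq_norm]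
    refine ((convex_ball x r).norm_image_sub_le_of_norm_deriv_le (fun w hw => (g.2 w (hrU hw)).1)
      (fun w hw => (g.2 w (hrU hw)).2) (mem_ball_self hr) hy).trans ?_
    gcongr
    exact (mem_ball_iff_norm.1 hy).le
  obtain ⟨C, hC⟩ := exists_forall_dist_le_of_isPreconnected hK hKc hF ha
  refine ⟨max C 0, le_max_right _ _, fun g η hη hg z hz => ?_⟩
  have hg' : ∀ z ∈ U, DifferentiableAt ℂ (fun w => (η : ℂ)⁻¹ * g w) z ∧
      ‖deriv (fun w => (η : ℂ)⁻¹ * g w) z‖ ≤ 1 := fun z hz => by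
    refine ⟨(hg z hz).1.const_mul _, ?_⟩
    rw [deriv_const_mul _ (hg z hz).1, norm_mul, norm_inv, norm_real, Real.norm_of_nonneg hη.le]
    exact (inv_mul_le_one₀ hη).2 (hg z hz).2
  have hCz : dist ((η : ℂ)⁻¹ * g z) ((η : ℂ)⁻¹ * g a) ≤ C := hC z hz ⟨_, hg'⟩
  rw [dist_eq_norm, ← mul_sub, norm_mul, norm_inv, norm_real, Real.norm_of_nonneg hη.le,
    inv_mul_le_iff₀' hη] at hCz
  exact hCz.trans (by gcongr; exact le_max_left _ _)

theorem exists_norm_lt_of_norm_deriv_le {K U : Set ℂ} (hK : IsCompact K)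
    (hKc : IsPreconnected K) (hU : IsOpen U) (hKU : K ⊆ U) {a : ℂ} (ha : a ∈ K) {ε : ℝ}
    (hε : 0 < ε) :
    ∃ η > 0, ∀ g : ℂ → ℂ, (∀ z ∈ U, DifferentiableAt ℂ g z ∧ ‖deriv g z‖ ≤ η) → ‖g a‖ ≤ η →
      ∀ z ∈ K, ‖g z‖ < ε := by
  obtain ⟨C, hC, hbound⟩ := exists_norm_sub_le_of_norm_deriv_le hK hKc hU hKU ha
  refine ⟨ε / (C + 2), by positivity, fun g hg hga z hz => ?_⟩
  calc ‖g z‖ ≤ ‖g a‖ + ‖g z - g a‖ := norm_le_norm_add_norm_sub' _ _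
    _ ≤ ε / (C + 2) + C * (ε / (C + 2)) := add_le_add hga (hbound g _ (by positivity) hg z hz)
    _ = ε * ((C + 1) / (C + 2)) := by ring
    _ < ε := mul_lt_of_lt_one_right hε ((div_lt_one (by positivity)).2 (by linarith))

theorem exists_finset_separates_nhds {K U S : Set ℂ} (hK : IsCompact K) (hU : IsOpen U)
    (hKU : K ⊆ U)
    (hS : ∀ ζ ∉ K, Bornology.IsBounded (connectedComponentIn Kᶜ ζ) →
      (S ∩ connectedComponentIn Kᶜ ζ).Nonempty) :
    ∃ (P : Finset ℂ) (M N : Set ℂ), (P : Set ℂ) ⊆ S ∧ InjOn (connectedComponentIn Kᶜ) P ∧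
      (∀ p ∈ P, Bornology.IsBounded (connectedComponentIn Kᶜ p)) ∧ IsCompact M ∧ IsCompact N ∧
      K ⊆ interior M ∧ M ⊆ N ∧ N ⊆ U ∧ Separates P M N := by
  obtain ⟨N, hN, hKN, hNU⟩ := exists_compact_between hK hU hKU
  obtain ⟨P, hPS, hPK, hPb, hsep⟩ := exists_finset_separates hK isOpen_interior hKN hS
  obtain ⟨δ, hδ, hsepδ⟩ := hsep.exists_cthickening hK isOpen_interior
  obtain ⟨M, hM, hKM, hMδ⟩ := exists_compact_between hK (isOpen_interior.inter isOpen_thickening)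
    (subset_inter hKN (self_subset_thickening hδ K))
  exact ⟨P, M, N, hPS, hPK, hPb, hM, hN, hKM,
    (hMδ.trans inter_subset_left).trans interior_subset, hNU, hsepδ.mono
      ((hMδ.trans inter_subset_right).trans (thickening_subset_cthickening δ K)) interior_subset⟩

theorem exists_isPeriodFunctional_of_isBounded {K L : Set ℂ} {P : Finset ℂ} (hK : IsClosed K)
    (hL : IsCompact L) [CompactSpace L] (hKL : K ⊆ interior L) (hPL : Disjoint (P : Set ℂ) L)
    (hPK : InjOn (connectedComponentIn Kᶜ) P)
    (hPb : ∀ p ∈ P, Bornology.IsBounded (connectedComponentIn Kᶜ p)) :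
    ∃ Λ : C(L, ℂ) →L[ℂ] (P → ℂ), IsPeriodFunctional P L Λ := by
  have hP : ∀ p ∈ P, p ∈ Kᶜ := fun p hp hpK =>
    hPL.notMem_of_mem_left hp (interior_subset (hKL hpK))
  refine exists_isPeriodFunctional hL hPL fun p hp => ?_
  obtain ⟨χ, hχ, hχc, hχL, hχ1, hχ0⟩ := exists_contDiff_tsupport_fderiv_subset (hPb p hp) hL
    ((frontier_connectedComponentIn_compl_subset hK p).trans hKL)
  refine ⟨χ, contDiff_infty.1 hχ 2, hχc, hχL, fun q hq => ?_⟩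
  have hqL : q ∉ L := hPL.notMem_of_mem_left hq
  split_ifs with hqp
  · exact hχ1 q hqL (hqp ▸ mem_connectedComponentIn (hP q hq))
  · exact hχ0 q hqL fun hqK => hqp (hPK hp hq (connectedComponentIn_eq hqK)).symm

theorem exists_deriv_ne_zero_approx {K₁ K₂ U₁ U₂ S : Set ℂ} (hK₁ : IsCompact K₁)
    (hK₂ : IsCompact K₂) (hc₁ : IsConnected K₁) (hc₂ : IsConnected K₂) (h₁ : IsOpen U₁)
    (h₂ : IsOpen U₂) (hd : Disjoint U₁ U₂) (hKU₁ : K₁ ⊆ U₁) (hKU₂ : K₂ ⊆ U₂)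
    (hSU : Disjoint S (U₁ ∪ U₂))
    (hS : ∀ ζ ∉ K₁ ∪ K₂, Bornology.IsBounded (connectedComponentIn (K₁ ∪ K₂)ᶜ ζ) →
      (S ∩ connectedComponentIn (K₁ ∪ K₂)ᶜ ζ).Nonempty) {f : ℂ → ℂ}
    (hf : DifferentiableOn ℂ f (U₁ ∪ U₂)) (hf0 : ∀ z ∈ U₁ ∪ U₂, deriv f z ≠ 0)
    {ε : ℝ} (hε : 0 < ε) :
    ∃ h : ℂ → ℂ, (∀ z ∉ S, DifferentiableAt ℂ h z ∧ deriv h z ≠ 0) ∧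
      ∀ z ∈ K₁ ∪ K₂, ‖h z - f z‖ < ε := by
  obtain ⟨z₁, hz₁⟩ := hc₁.nonempty
  obtain ⟨z₂, hz₂⟩ := hc₂.nonempty
  have hK : IsCompact (K₁ ∪ K₂) := hK₁.union hK₂
  have hU : IsOpen (U₁ ∪ U₂) := h₁.union h₂
  obtain ⟨P, M, N, hPS, hPK, hPb, hM, hN, hKM, hMN, hNU, hsep⟩ :=
    exists_finset_separates_nhds hK hU (union_subset_union hKU₁ hKU₂) hS
  obtain ⟨L, hL, hKL, hLM⟩ := exists_compact_between hK isOpen_interior hKM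
  have : CompactSpace L := isCompact_iff_compactSpace.1 hL
  have hPU : ∀ p ∈ P, p ∉ U₁ ∪ U₂ := fun p hp => hSU.notMem_of_mem_left (hPS hp)
  have hLU : L ⊆ U₁ ∪ U₂ := ((hLM.trans interior_subset).trans hMN).trans hNU
  obtain ⟨Λ, hΛ⟩ := exists_isPeriodFunctional_of_isBounded hK.isClosed hL hKL
    (disjoint_left.2 fun p hp hpL => hPU p hp (hLU hpL)) hPK hPb
  obtain ⟨hK₁L, hK₂L⟩ := union_subset_iff.1 hKL
  obtain ⟨η₁, hη₁, hsmall₁⟩ :=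
    exists_norm_lt_of_norm_deriv_le hK₁ hc₁.isPreconnected isOpen_interior hK₁L hz₁ hε
  obtain ⟨η₂, hη₂, hsmall₂⟩ :=
    exists_norm_lt_of_norm_deriv_le hK₂ hc₂.isPreconnected isOpen_interior hK₂L hz₂ hε
  obtain ⟨h, q, hh, hq, hz₁f, hz₂f⟩ := hΛ.exists_hasDerivAt_ne_zero_approx hM hN hLM hMN h₁ h₂ hd
    hNU hPU hsep ⟨hKU₁ hz₁, interior_subset (hK₁L hz₁)⟩ ⟨hKU₂ hz₂, interior_subset (hK₂L hz₂)⟩ hf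
    hf0 (lt_min hη₁ hη₂)
  have hderiv : ∀ z ∈ interior L, DifferentiableAt ℂ (h - f) z ∧
      ‖deriv (h - f) z‖ ≤ min η₁ η₂ :=
    fun z hz => by
      have hzL := interior_subset hz
      have hz' := (hh z fun hzP => hPU z hzP (hLU hzL)).1.sub
        (hf.differentiableAt (hU.mem_nhds (hLU hzL))).hasDerivAt
      exact ⟨hz'.differentiableAt, hz'.deriv ▸ (hq z hzL).le⟩
  refine ⟨h, fun z hz => ?_, ?_⟩
  · obtain ⟨hhz, hqz⟩ := hh z fun hzP => hz (hPS hzP)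
    exact ⟨hhz.differentiableAt, hhz.deriv ▸ hqz⟩
  · rintro z (hz | hz)
    · exact hsmall₁ (h - f) (fun w hw => (hderiv w hw).imp_right (le_min_iff.1 · |>.1))
        (by simp [hz₁f, hη₁.le]) z hz
    · exact hsmall₂ (h - f) (fun w hw => (hderiv w hw).imp_right (le_min_iff.1 · |>.2))
        (hz₂f.le.trans (min_le_right _ _)) z hz

end ApproximationOnTwoContinua

section FillHoles

variable {X : Type*} [TopologicalSpace X]

theorem exists_isCompact_isConnected_nhds [LocallyConnectedSpace X] [LocallyCompactSpace X]
    [T2Space X] (x : X) : ∃ C ∈ 𝓝 x, IsCompact C ∧ IsConnected C := by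
  obtain ⟨N, hN, hxN⟩ := exists_compact_mem_nhds x
  have hx : x ∈ interior N := mem_interior_iff_mem_nhds.2 hxN
  refine ⟨closure (connectedComponentIn (interior N) x), ?_, ?_, ?_⟩
  · exact mem_of_superset (isOpen_interior.connectedComponentIn.mem_nhds
      (mem_connectedComponentIn hx)) subset_closure
  · exact hN.of_isClosed_subset isClosed_closure
      (closure_minimal ((connectedComponentIn_subset _ _).trans interior_subset) hN.isClosed)
  · exact (isConnected_connectedComponentIn_iff.2 hx).closure

theorem exists_isCompact_isPreconnected_mem_mem [LocallyConnectedSpace X] [LocallyCompactSpace X]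
    [T2Space X] [PreconnectedSpace X] (a b : X) :
    ∃ C, IsCompact C ∧ IsPreconnected C ∧ a ∈ C ∧ b ∈ C := by
  refine isPreconnected_univ.induction₂
    (fun x y => ∃ C, IsCompact C ∧ IsPreconnected C ∧ x ∈ C ∧ y ∈ C)
    (fun x _ => ?_) ?_ ?_ (mem_univ a) (mem_univ b)
  · obtain ⟨C, hxC, hC, hCc⟩ := exists_isCompact_isConnected_nhds x
    exact mem_nhdsWithin_of_mem_nhds
      (mem_of_superset hxC fun y hy => ⟨C, hC, hCc.isPreconnected, mem_of_mem_nhds hxC, hy⟩)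
  · rintro x y z - - - ⟨C, hC, hCc, hx, hy⟩ ⟨D, hD, hDc, hy', hz⟩
    exact ⟨C ∪ D, hC.union hD, hCc.union y hy hy' hDc, Or.inl hx, Or.inr hz⟩
  · rintro x y - - ⟨C, hC, hCc, hx, hy⟩
    exact ⟨C, hC, hCc, hy, hx⟩

theorem exists_isCompact_isConnected_superset [LocallyConnectedSpace X] [LocallyCompactSpace X]
    [T2Space X] [ConnectedSpace X] {K : Set X} (hK : IsCompact K) :
    ∃ C, IsCompact C ∧ IsConnected C ∧ K ⊆ C := by
  obtain ⟨a⟩ : Nonempty X := inferInstance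
  suffices ∃ C, IsCompact C ∧ IsPreconnected C ∧ a ∈ C ∧ K ⊆ C by
    obtain ⟨C, hC, hCc, haC, hKC⟩ := this
    exact ⟨C, hC, ⟨⟨a, haC⟩, hCc⟩, hKC⟩
  refine hK.induction_on (p := fun s => ∃ C, IsCompact C ∧ IsPreconnected C ∧ a ∈ C ∧ s ⊆ C)
    ⟨{a}, isCompact_singleton, isPreconnected_singleton, rfl, empty_subset _⟩ ?_ ?_ ?_
  · rintro s t hst ⟨C, hC, hCc, haC, htC⟩
    exact ⟨C, hC, hCc, haC, hst.trans htC⟩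
  · rintro s t ⟨C, hC, hCc, haC, hsC⟩ ⟨D, hD, hDc, haD, htD⟩
    exact ⟨C ∪ D, hC.union hD, hCc.union a haC haD hDc, Or.inl haC, union_subset_union hsC htD⟩
  · intro x _
    obtain ⟨C, hC, hCc, haC, hxC⟩ := exists_isCompact_isPreconnected_mem_mem a x
    obtain ⟨D, hxD, hD, hDc⟩ := exists_isCompact_isConnected_nhds x
    exact ⟨D, mem_nhdsWithin_of_mem_nhds hxD, C ∪ D, hC.union hD,
      hCc.union x hxC (mem_of_mem_nhds hxD) hDc.isPreconnected, Or.inl haC, subset_union_right⟩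

theorem closure_connectedComponentIn_compl_inter_nonempty [LocallyConnectedSpace X]
    [PreconnectedSpace X] {C : Set X} (hC : IsClosed C) (hCn : C.Nonempty) {z : X} (hz : z ∉ C) :
    (closure (connectedComponentIn Cᶜ z) ∩ C).Nonempty := by
  by_contra! hempty
  have hclosed : closure (connectedComponentIn Cᶜ z) ⊆ connectedComponentIn Cᶜ z :=
    (disjoint_iff_inter_eq_empty.2 hempty).subset_left_of_subset_union
      (closure_connectedComponentIn_compl_subset hC z)
  have hclopen : IsClopen (connectedComponentIn Cᶜ z) :=
    ⟨closure_subset_iff_isClosed.1 hclosed, hC.isOpen_compl.connectedComponentIn⟩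
  obtain ⟨c, hc⟩ := hCn
  exact connectedComponentIn_subset Cᶜ z
    (hclopen.eq_univ ⟨z, mem_connectedComponentIn hz⟩ ▸ mem_univ c) hc

theorem connectedComponentIn_compl_inter_sdiff_interior_nonempty [LocallyConnectedSpace X]
    [PreconnectedSpace X] {C N : Set X} (hC : IsClosed C) (hCn : C.Nonempty) (hN : IsClosed N)
    (hCN : C ⊆ interior N) {z : X} (hz : z ∉ N) :
    (connectedComponentIn Cᶜ z ∩ (N \ interior N)).Nonempty := by
  have hzC : z ∉ C := fun h => hz (interior_subset (hCN h))
  by_contra! hempty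
  have hcover : connectedComponentIn Cᶜ z ⊆ interior N ∪ Nᶜ := fun w hw => by
    by_contra! hwn
    rw [mem_union, not_or, mem_compl_iff, not_not] at hwn
    exact hempty.le ⟨hw, hwn.2, hwn.1⟩
  have houtside : connectedComponentIn Cᶜ z ⊆ Nᶜ :=
    isPreconnected_connectedComponentIn.subset_right_of_subset_union isOpen_interior
      hN.isOpen_compl (disjoint_compl_right.mono_left interior_subset) hcover
      ⟨z, mem_connectedComponentIn hzC, hz⟩
  obtain ⟨c, hc, hcC⟩ := closure_connectedComponentIn_compl_inter_nonempty hC hCn hzC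
  obtain ⟨w, hwN, hw⟩ := mem_closure_iff.1 hc _ isOpen_interior (hCN hcC)
  exact houtside hw (interior_subset hwN)

/-- The union of a set with the relatively compact components of its complement; for a compact
connected set this is its `𝒪`-convex hull. -/
def fillHoles (C : Set X) : Set X :=
  {z | z ∈ C ∨ IsCompact (closure (connectedComponentIn Cᶜ z))}

theorem subset_fillHoles (C : Set X) : C ⊆ fillHoles C := fun _ => Or.inl

variable {C : Set X} {z : X}

theorem disjoint_connectedComponentIn_compl_fillHoles (hz : z ∉ fillHoles C) :
    Disjoint (connectedComponentIn Cᶜ z) (fillHoles C) := by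
  refine disjoint_left.2 fun w hw hwF => ?_
  rcases hwF with hwC | hwc
  · exact connectedComponentIn_subset _ _ hw hwC
  · exact hz (Or.inr (by rwa [connectedComponentIn_eq hw]))

theorem connectedComponentIn_compl_subset_fillHoles
    (hz : IsCompact (closure (connectedComponentIn Cᶜ z))) :
    connectedComponentIn Cᶜ z ⊆ fillHoles C := fun w hw =>
  Or.inr (by rwa [← connectedComponentIn_eq hw])

theorem isClosed_fillHoles [LocallyConnectedSpace X] (hC : IsClosed C) :
    IsClosed (fillHoles C) := by
  rw [← isOpen_compl_iff, isOpen_iff_mem_nhds]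
  intro z hz
  exact mem_of_superset (hC.isOpen_compl.connectedComponentIn.mem_nhds
    (mem_connectedComponentIn fun hzC => hz (Or.inl hzC)))
    (disjoint_connectedComponentIn_compl_fillHoles hz).subset_compl_right

theorem isConnected_fillHoles [LocallyConnectedSpace X] [PreconnectedSpace X] (hC : IsClosed C)
    (hCc : IsConnected C) : IsConnected (fillHoles C) := by
  obtain ⟨a, ha⟩ := hCc.nonempty
  refine ⟨⟨a, Or.inl ha⟩, isPreconnected_of_forall a fun y hy => ?_⟩
  by_cases hyC : y ∈ C
  · exact ⟨C, subset_fillHoles C, ha, hyC, hCc.isPreconnected⟩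
  · obtain ⟨c, hc, hcC⟩ := closure_connectedComponentIn_compl_inter_nonempty hC hCc.nonempty hyC
    refine ⟨C ∪ closure (connectedComponentIn Cᶜ y), union_subset (subset_fillHoles C) ?_,
      Or.inl ha, Or.inr (subset_closure (mem_connectedComponentIn hyC)),
      hCc.isPreconnected.union c hcC hc isPreconnected_connectedComponentIn.closure⟩
    exact (closure_connectedComponentIn_compl_subset hC y).trans (union_subset
      (connectedComponentIn_compl_subset_fillHoles (hy.resolve_left hyC)) (subset_fillHoles C))

/-- Take a compact neighbourhood `N` of `C`. A hole not contained in `N` meets the compact set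
`N \ interior N`, which is covered by finitely many components of the complement of `C`. -/
theorem isCompact_fillHoles [LocallyConnectedSpace X] [PreconnectedSpace X] [LocallyCompactSpace X]
    [T2Space X] (hC : IsCompact C) (hCn : C.Nonempty) : IsCompact (fillHoles C) := by
  classical
  obtain ⟨N, hN, hCN⟩ := exists_compact_superset hC
  obtain ⟨t, -, ht⟩ := (hN.diff isOpen_interior).elim_nhds_subcover (connectedComponentIn Cᶜ)
    fun z hz => hC.isClosed.isOpen_compl.connectedComponentIn.mem_nhds
      (mem_connectedComponentIn fun hzC => hz.2 (hCN hzC))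
  let holes := t.filter fun ζ => IsCompact (closure (connectedComponentIn Cᶜ ζ))
  have hholes : IsCompact (⋃ ζ ∈ holes, closure (connectedComponentIn Cᶜ ζ)) :=
    holes.isCompact_biUnion fun ζ hζ => (Finset.mem_filter.1 hζ).2
  refine (hN.union hholes).of_isClosed_subset (isClosed_fillHoles hC.isClosed) fun z hz => ?_
  by_cases hzN : z ∈ N
  · exact Or.inl hzN
  have hzC : z ∉ C := fun h => hzN (interior_subset (hCN h))
  obtain ⟨w, hwz, hwN⟩ := connectedComponentIn_compl_inter_sdiff_interior_nonempty hC.isClosed hCn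
    hN.isClosed hCN hzN
  obtain ⟨ζ, hζt, hwζ⟩ := mem_iUnion₂.1 (ht hwN)
  have hζz : connectedComponentIn Cᶜ ζ = connectedComponentIn Cᶜ z :=
    (connectedComponentIn_eq hwζ).trans (connectedComponentIn_eq hwz).symm
  refine Or.inr (mem_iUnion₂.2 ⟨ζ, Finset.mem_filter.2 ⟨hζt, ?_⟩, subset_closure ?_⟩)
  · exact hζz ▸ hz.resolve_left hzC
  · exact hζz ▸ mem_connectedComponentIn hzC

theorem not_isCompact_closure_connectedComponentIn_compl_fillHoles (hz : z ∉ fillHoles C) :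
    ¬ IsCompact (closure (connectedComponentIn (fillHoles C)ᶜ z)) := fun hcpt => by
  refine hz (Or.inr (hcpt.of_isClosed_subset isClosed_closure (closure_mono ?_)))
  exact isPreconnected_connectedComponentIn.subset_connectedComponentIn
    (mem_connectedComponentIn fun hzC => hz (Or.inl hzC))
    (disjoint_connectedComponentIn_compl_fillHoles hz).subset_compl_right

end FillHoles

section OConvexCompacta

variable {Ω : Set ℂ}

theorem exists_isOConvexCompact_isConnected_superset (hΩ : IsPlaneDomain Ω) {K : Set Ω}
    (hK : IsCompact K) : ∃ C, IsOConvexCompact C ∧ IsConnected C ∧ K ⊆ C := by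
  have : LocallyConnectedSpace Ω := hΩ.1.isOpenEmbedding_subtypeVal.locallyConnectedSpace
  have : LocallyCompactSpace Ω := hΩ.1.locallyCompactSpace
  have : ConnectedSpace Ω := isConnected_iff_connectedSpace.1 hΩ.2
  obtain ⟨C, hC, hCc, hKC⟩ := exists_isCompact_isConnected_superset hK
  exact ⟨fillHoles C, ⟨isCompact_fillHoles hC hCc.nonempty,
    fun z hz => not_isCompact_closure_connectedComponentIn_compl_fillHoles hz⟩,
    isConnected_fillHoles hC.isClosed hCc, hKC.trans (subset_fillHoles C)⟩

theorem IsOConvexCompact.compl_inter_connectedComponentIn_nonempty {K : Set Ω}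
    (hK : IsOConvexCompact K) {ζ : ℂ} (hζ : ζ ∉ Subtype.val '' K)
    (hb : Bornology.IsBounded (connectedComponentIn (Subtype.val '' K)ᶜ ζ)) :
    (Ωᶜ ∩ connectedComponentIn (Subtype.val '' K)ᶜ ζ).Nonempty := by
  set H := connectedComponentIn (Subtype.val '' K : Set ℂ)ᶜ ζ
  by_contra! hempty
  have hHΩ : H ⊆ Ω := disjoint_compl_left_iff_subset.1 (disjoint_iff_inter_eq_empty.2 hempty)
  have hclosure : closure H ⊆ Ω :=
    (closure_connectedComponentIn_compl_subset
      (hK.1.image continuous_subtype_val).isClosed ζ).trans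
      (union_subset hHΩ (Subtype.coe_image_subset Ω K))
  have hcpt : IsCompact (Subtype.val ⁻¹' closure H : Set Ω) :=
    (IsInducing.subtypeVal.isCompact_preimage_iff (by rwa [Subtype.range_coe])).2
      hb.isCompact_closure
  let z : Ω := ⟨ζ, hHΩ (mem_connectedComponentIn hζ)⟩
  have hz : z ∈ Kᶜ := fun hzK => hζ ⟨z, hzK, rfl⟩
  have himage : Subtype.val '' connectedComponentIn Kᶜ z ⊆ H :=
    (isPreconnected_connectedComponentIn.image _
      continuous_subtype_val.continuousOn).subset_connectedComponentIn
      ⟨z, mem_connectedComponentIn hz, rfl⟩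
      ((image_mono (connectedComponentIn_subset _ _)).trans
        (image_compl_subset Subtype.val_injective))
  exact hK.2 z hz (hcpt.of_isClosed_subset isClosed_closure (closure_minimal
    (image_subset_iff.1 (himage.trans subset_closure)) hcpt.isClosed))

end OConvexCompacta

section TransportedTargets

theorem exists_openPartialHomeomorph_of_hasStrictDerivAt {𝕜 : Type*} [NontriviallyNormedField 𝕜]
    [CompleteSpace 𝕜] {f f' : 𝕜 → 𝕜} {V : Set 𝕜} (hV : IsOpen V)
    (hf : ∀ z ∈ V, HasStrictDerivAt f (f' z) z) (hf' : ∀ z ∈ V, f' z ≠ 0) (hinj : InjOn f V) :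
    ∃ e : OpenPartialHomeomorph 𝕜 𝕜, ⇑e = f ∧ e.source = V := by
  have hopen : IsOpenMap (V.domRestrict f) := isOpenMap_iff_nhds_le.2 fun z => by
    rw [domRestrict_eq, ← map_map, map_nhds_subtype_coe_eq_nhds z.2 (hV.mem_nhds z.2),
      (hf z z.2).map_nhds_eq (hf' z z.2)]
    rfl
  exact ⟨.ofContinuousOpenRestrict hinj.toPartialEquiv
    (fun z hz => (hf z hz).hasDerivAt.continuousAt.continuousWithinAt) hopen hV, rfl, rfl⟩

theorem exists_comp_eqOn_of_injOn {G T : ℂ → ℂ} {V : Set ℂ} (hV : IsOpen V)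
    (hG : DifferentiableOn ℂ G V) (hG0 : ∀ z ∈ V, deriv G z ≠ 0)
    (hT : DifferentiableOn ℂ T V) (hT0 : ∀ z ∈ V, deriv T z ≠ 0) (hinj : InjOn T V) :
    IsOpen (T '' V) ∧ ∃ E : ℂ → ℂ, DifferentiableOn ℂ E (T '' V) ∧
      (∀ z ∈ T '' V, deriv E z ≠ 0) ∧ EqOn (E ∘ T) G V := by
  obtain ⟨e, rfl, rfl⟩ := exists_openPartialHomeomorph_of_hasStrictDerivAt hV
    (fun z hz => (hT.analyticAt (hV.mem_nhds hz)).hasStrictDerivAt) hT0 hinj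
  have hderiv : ∀ z ∈ e.source,
      HasDerivAt (G ∘ e.symm) (deriv G z * (deriv e z)⁻¹) (e z) := fun z hz => by
    have hsymm : e.symm (e z) = z := e.left_inv hz
    refine HasDerivAt.comp (e z) ?_ (e.hasDerivAt_symm (e.map_source hz) (hT0 z hz) ?_)
    · exact hsymm.symm ▸ (hG.differentiableAt (hV.mem_nhds hz)).hasDerivAt
    · exact hsymm.symm ▸ (hT.differentiableAt (hV.mem_nhds hz)).hasDerivAt
  refine ⟨e.image_source_eq_target ▸ e.open_target, G ∘ e.symm, ?_, ?_, fun z hz =>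
    congrArg G (e.left_inv hz)⟩
  · rintro _ ⟨z, hz, rfl⟩
    exact (hderiv z hz).differentiableAt.differentiableWithinAt
  · rintro _ ⟨z, hz, rfl⟩
    rw [(hderiv z hz).deriv]
    exact mul_ne_zero (hG0 z hz) (inv_ne_zero (hT0 z hz))

theorem exists_eqOn_eqOn_of_disjoint {F E : ℂ → ℂ} {U W : Set ℂ} (hU : IsOpen U) (hW : IsOpen W)
    (hd : Disjoint U W) (hF : DifferentiableOn ℂ F U) (hF0 : ∀ z ∈ U, deriv F z ≠ 0)
    (hE : DifferentiableOn ℂ E W) (hE0 : ∀ z ∈ W, deriv E z ≠ 0) :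
    ∃ H : ℂ → ℂ, DifferentiableOn ℂ H (U ∪ W) ∧ (∀ z ∈ U ∪ W, deriv H z ≠ 0) ∧
      EqOn H F U ∧ EqOn H E W := by
  classical
  have hHF : EqOn (U.piecewise F E) F U := piecewise_eqOn U F E
  have hHE : EqOn (U.piecewise F E) E W :=
    (piecewise_eqOn_compl U F E).mono hd.subset_compl_left
  refine ⟨U.piecewise F E, (hF.congr hHF).union_of_isOpen (hE.congr hHE) hU hW, ?_, hHF, hHE⟩
  rintro z (hz | hz)
  · exact hHF.deriv hU hz ▸ hF0 z hz
  · exact hHE.deriv hW hz ▸ hE0 z hz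

variable {Ω : Set ℂ}

theorem exists_eqOn_comp_eqOn_of_injOn (hΩ : IsOpen Ω) {f g : C(Ω, ℂ)} {φ : C(Ω, Ω)}
    (hf : f ∈ locallyUnivalentFunctions Ω) (hg : g ∈ locallyUnivalentFunctions Ω)
    (hφ : φ ∈ locallyUnivalentSelfMaps Ω) {A D : Set Ω} (hA : IsOpen A) (hD : IsOpen D)
    (hinj : InjOn φ D) (hd : Disjoint A (φ '' D)) :
    IsOpen (Subtype.val '' (φ '' D) : Set ℂ) ∧ ∃ H : ℂ → ℂ,
      DifferentiableOn ℂ H (Subtype.val '' A ∪ Subtype.val '' (φ '' D)) ∧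
      (∀ z ∈ Subtype.val '' A ∪ Subtype.val '' (φ '' D), deriv H z ≠ 0) ∧
      (∀ z ∈ A, H z = f z) ∧ ∀ z ∈ D, H (φ z) = g z := by
  obtain ⟨F, hF, hF0, hFf⟩ := hf
  obtain ⟨G, hG, hG0, hGg⟩ := hg
  obtain ⟨T, hT, hT0, hTφ⟩ := hφ
  have hTD : T '' (Subtype.val '' D) = Subtype.val '' (φ '' D) := by
    simp only [image_image, hTφ]
  have hTinj : InjOn T (Subtype.val '' D) := by
    rintro _ ⟨z, hz, rfl⟩ _ ⟨w, hw, rfl⟩ hzw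
    rw [hTφ, hTφ] at hzw
    exact congrArg Subtype.val (hinj hz hw (Subtype.ext hzw))
  have hAΩ : Subtype.val '' A ⊆ Ω := Subtype.coe_image_subset Ω A
  have hDΩ : Subtype.val '' D ⊆ Ω := Subtype.coe_image_subset Ω D
  obtain ⟨hTDo, E, hE, hE0, hET⟩ := exists_comp_eqOn_of_injOn (hΩ.isOpenMap_subtype_val _ hD)
    (hG.mono hDΩ) (fun z hz => hG0 z (hDΩ hz)) (hT.mono hDΩ) (fun z hz => hT0 z (hDΩ hz)) hTinj
  rw [hTD] at hTDo hE hE0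
  obtain ⟨H, hH, hH0, hHF, hHE⟩ := exists_eqOn_eqOn_of_disjoint (hΩ.isOpenMap_subtype_val _ hA)
    hTDo ((disjoint_image_iff Subtype.val_injective).2 hd) (hF.mono hAΩ)
    (fun z hz => hF0 z (hAΩ hz)) hE hE0
  refine ⟨hTDo, H, hH, hH0, fun z hz => (hHF ⟨z, hz, rfl⟩).trans (hFf z), fun z hz => ?_⟩
  rw [hHE ⟨φ z, ⟨z, hz, rfl⟩, rfl⟩, ← hGg, ← hET ⟨z, hz, rfl⟩]
  exact congrArg E (hTφ z).symm

theorem exists_locallyUnivalent_approx_of_injOn (hΩ : IsOpen Ω) {f g : C(Ω, ℂ)} {φ : C(Ω, Ω)}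
    (hf : f ∈ locallyUnivalentFunctions Ω) (hg : g ∈ locallyUnivalentFunctions Ω)
    (hφ : φ ∈ locallyUnivalentSelfMaps Ω) {C W : Set Ω} (hC : IsCompact C) (hCc : IsConnected C)
    (hW : IsOpen W) (hCW : C ⊆ W) (hinj : InjOn φ W) (hd : Disjoint C (φ '' C))
    (hconv : IsOConvexCompact (φ '' C ∪ C)) {ε : ℝ} (hε : 0 < ε) :
    ∃ h ∈ locallyUnivalentFunctions Ω,
      ∀ z ∈ C, ‖h z - f z‖ < ε ∧ ‖h (φ z) - g z‖ < ε := by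
  have hφC : IsCompact (φ '' C) := hC.image φ.continuous
  obtain ⟨A, B, hA, hB, hCA, hCB, hAB⟩ := SeparatedNhds.of_isCompact_isCompact hC hφC hd
  have hAD : Disjoint A (φ '' (W ∩ φ ⁻¹' B)) :=
    hAB.mono_right (image_subset_iff.2 inter_subset_right)
  have hCD : C ⊆ W ∩ φ ⁻¹' B := subset_inter hCW (image_subset_iff.1 hCB)
  obtain ⟨hopen, H, hH, hH0, hHf, hHg⟩ := exists_eqOn_comp_eqOn_of_injOn hΩ hf hg hφ hA
    (hW.inter (hB.preimage φ.continuous)) (hinj.mono inter_subset_left) hAD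
  obtain ⟨h, hh, hhH⟩ := exists_deriv_ne_zero_approx (S := Ωᶜ)
    (hC.image continuous_subtype_val) (hφC.image continuous_subtype_val)
    (hCc.image _ continuous_subtype_val.continuousOn)
    ((hCc.image _ φ.continuous.continuousOn).image _ continuous_subtype_val.continuousOn)
    (hΩ.isOpenMap_subtype_val _ hA) hopen ((disjoint_image_iff Subtype.val_injective).2 hAD)
    (image_mono hCA) (image_mono (image_mono hCD))
    (disjoint_compl_left_iff_subset.2
      (union_subset (Subtype.coe_image_subset Ω _) (Subtype.coe_image_subset Ω _)))
    (by
      rw [← image_union, union_comm]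
      exact fun ζ hζ hb => hconv.compl_inter_connectedComponentIn_nonempty hζ hb)
    hH hH0 hε
  have hhΩ : DifferentiableOn ℂ h Ω := fun z hz =>
    (hh z (not_not.2 hz)).1.differentiableWithinAt
  refine ⟨⟨Ω.domRestrict h, hhΩ.continuousOn.domRestrict⟩,
    ⟨h, hhΩ, fun z hz => (hh z (not_not.2 hz)).2, fun z => rfl⟩, fun z hz => ⟨?_, ?_⟩⟩
  · exact hHf z (hCA hz) ▸ hhH z (Or.inl ⟨z, hz, rfl⟩)
  · exact hHg z (hCD hz) ▸ hhH _ (Or.inr ⟨φ z, ⟨z, hz, rfl⟩, rfl⟩)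

theorem exists_locallyUnivalent_approx (hΩ : IsPlaneDomain Ω) {φ : ℕ → C(Ω, Ω)}
    (hφ : ∀ n, φ n ∈ locallyUnivalentSelfMaps Ω) (hinj : EventuallyInjective φ)
    (hconv : ∀ K : Set Ω, IsOConvexCompact K → ∀ N : ℕ, ∃ n ≥ N,
      (φ n '' K) ∩ K = ∅ ∧ IsOConvexCompact ((φ n '' K) ∪ K))
    {f g : C(Ω, ℂ)} (hf : f ∈ locallyUnivalentFunctions Ω) (hg : g ∈ locallyUnivalentFunctions Ω)
    {K : Set Ω} (hK : IsCompact K) {ε : ℝ} (hε : 0 < ε) :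
    ∃ h ∈ locallyUnivalentFunctions Ω, ∃ n,
      ∀ z ∈ K, ‖h z - f z‖ < ε ∧ ‖h (φ n z) - g z‖ < ε := by
  have : LocallyCompactSpace Ω := hΩ.1.locallyCompactSpace
  obtain ⟨C, hC, hCc, hKC⟩ := exists_isOConvexCompact_isConnected_superset hΩ hK
  obtain ⟨L, hL, hCL⟩ := exists_compact_superset hC.1
  obtain ⟨n₀, hn₀⟩ := hinj L hL
  obtain ⟨n, hn, hdisj, hunion⟩ := hconv C hC n₀
  obtain ⟨h, hh, happrox⟩ := exists_locallyUnivalent_approx_of_injOn hΩ.1 hf hg (hφ n) hC.1 hCc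
    isOpen_interior hCL ((hn₀ n hn).mono interior_subset)
    (disjoint_iff_inter_eq_empty.2 hdisj).symm hunion hε
  exact ⟨h, hh, n, fun z hz => happrox z (hKC hz)⟩

end TransportedTargets

section Hurwitz

theorem le_norm_of_forall_mem_frontier_le_norm {E : Type*} [NormedAddCommGroup E] [NormedSpace ℂ E]
    [Nontrivial E] {f : E → ℂ} {U : Set E} (hU : Bornology.IsBounded U) (hf : DiffContOnCl ℂ f U)
    (hf0 : ∀ z ∈ closure U, f z ≠ 0) {m : ℝ} (hm : 0 < m) (hfm : ∀ z ∈ frontier U, m ≤ ‖f z‖)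
    {z : E} (hz : z ∈ closure U) : m ≤ ‖f z‖ := by
  have hinv : ‖(f z)⁻¹‖ ≤ m⁻¹ := norm_le_of_forall_mem_frontier_norm_le hU (hf.inv hf0)
    (fun w hw => by
      rw [Pi.inv_apply, norm_inv]
      exact inv_anti₀ hm (hfm w hw)) hz
  rwa [norm_inv, inv_le_inv₀ (norm_pos_iff.2 (hf0 z hz)) hm] at hinv

theorem exists_forall_mem_sphere_le_norm {g : ℂ → ℂ} {Ω : Set ℂ} (hΩ : IsOpen Ω)
    (hg : DifferentiableOn ℂ g Ω) {z₀ : ℂ} (hz₀ : z₀ ∈ Ω) (hne : ∀ᶠ z in 𝓝[≠] z₀, g z ≠ 0) :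
    ∃ r > 0, closedBall z₀ r ⊆ Ω ∧ ∃ m > 0, ∀ z ∈ sphere z₀ r, m ≤ ‖g z‖ := by
  obtain ⟨r, hr, hrg⟩ := nhds_basis_closedBall.mem_iff.1
    ((eventually_nhdsWithin_iff.1 hne).and (hΩ.mem_nhds hz₀))
  have hrΩ : closedBall z₀ r ⊆ Ω := fun z hz => (hrg hz).2
  obtain ⟨w, hw, hmin⟩ := (isCompact_sphere z₀ r).exists_isMinOn
    (NormedSpace.sphere_nonempty.2 hr.le)
    (hg.continuousOn.mono (sphere_subset_closedBall.trans hrΩ)).norm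
  exact ⟨r, hr, hrΩ, ‖g w‖,
    norm_pos_iff.2 ((hrg (sphere_subset_closedBall hw)).1 (ne_of_mem_sphere hw hr.ne')),
    fun z hz => hmin hz⟩

theorem eventually_eq_zero_of_tendstoLocallyUniformlyOn {ι : Type*} {l : Filter ι} [l.NeBot]
    {Ω : Set ℂ} (hΩ : IsOpen Ω) {F : ι → ℂ → ℂ} {g : ℂ → ℂ}
    (h : TendstoLocallyUniformlyOn F g l Ω) (hF : ∀ᶠ n in l, DifferentiableOn ℂ (F n) Ω)
    (hF0 : ∃ᶠ n in l, ∀ z ∈ Ω, F n z ≠ 0) {z₀ : ℂ} (hz₀ : z₀ ∈ Ω) (hg0 : g z₀ = 0) :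
    ∀ᶠ z in 𝓝 z₀, g z = 0 := by
  have hg : DifferentiableOn ℂ g Ω := h.differentiableOn hF hΩ
  refine (hg.analyticAt (hΩ.mem_nhds hz₀)).eventually_eq_zero_or_eventually_ne_zero.resolve_right
    fun hne => ?_
  obtain ⟨r, hr, hrΩ, m, hm, hgm⟩ := exists_forall_mem_sphere_le_norm hΩ hg hz₀ hne
  have hunif := tendstoUniformlyOn_iff.1 ((tendstoLocallyUniformlyOn_iff_forall_isCompact hΩ).1 h _
    hrΩ (isCompact_closedBall z₀ r)) _ (half_pos hm)
  obtain ⟨n, hn0, hnF, hn⟩ := (hF0.and_eventually (hF.and hunif)).exists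
  have hnΩ : closure (ball z₀ r) ⊆ Ω := closure_ball_subset_closedBall.trans hrΩ
  have hsphere : ∀ z ∈ frontier (ball z₀ r), m / 2 ≤ ‖F n z‖ := fun z hz => by
    have hz' : z ∈ sphere z₀ r := frontier_ball_subset_sphere hz
    have hclose := hn z (sphere_subset_closedBall hz')
    rw [dist_eq_norm] at hclose
    linarith [hgm z hz', norm_le_norm_add_norm_sub' (g z) (F n z)]
  have hcenter := le_norm_of_forall_mem_frontier_le_norm isBounded_ball
    (hnF.mono hnΩ).diffContOnCl (fun z hz => hn0 z (hnΩ hz)) (half_pos hm) hsphere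
    (subset_closure (mem_ball_self hr))
  have hclose := hn z₀ (mem_closedBall_self hr.le)
  rw [hg0, dist_zero_left] at hclose
  exact hcenter.not_gt hclose

end Hurwitz

section UniversalFunctions

variable {Ω : Set ℂ}

theorem id_mem_locallyUnivalentFunctions :
    (⟨Subtype.val, continuous_subtype_val⟩ : C(Ω, ℂ)) ∈ locallyUnivalentFunctions Ω :=
  ⟨id, differentiableOn_id, fun z _ => (deriv_id z).symm ▸ one_ne_zero, fun _ => rfl⟩

theorem comp_mem_locallyUnivalentFunctions (hΩ : IsOpen Ω) {f : C(Ω, ℂ)}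
    (hf : f ∈ locallyUnivalentFunctions Ω) {φ : C(Ω, Ω)} (hφ : φ ∈ locallyUnivalentSelfMaps Ω) :
    f.comp φ ∈ locallyUnivalentFunctions Ω := by
  obtain ⟨F, hF, hF0, hFf⟩ := hf
  obtain ⟨T, hT, hT0, hTφ⟩ := hφ
  have hTΩ : MapsTo T Ω Ω := fun z hz => by
    rw [hTφ ⟨z, hz⟩]
    exact Subtype.prop _
  refine ⟨F ∘ T, hF.comp hT hTΩ, fun z hz => ?_, fun z => ?_⟩
  · rw [deriv_comp z (hF.differentiableAt (hΩ.mem_nhds (hTΩ hz)))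
      (hT.differentiableAt (hΩ.mem_nhds hz))]
    exact mul_ne_zero (hF0 _ (hTΩ hz)) (hT0 z hz)
  · rw [Function.comp_apply, hTφ, ContinuousMap.comp_apply, hFf]

theorem exists_ne_of_mem_locallyUnivalentFunctions (hΩ : IsOpen Ω) (hne : Ω.Nonempty)
    {f : C(Ω, ℂ)} (hf : f ∈ locallyUnivalentFunctions Ω) : ∃ x y, f x ≠ f y := by
  by_contra! hconst
  obtain ⟨F, -, hF0, hFf⟩ := hf
  obtain ⟨a, ha⟩ := hne
  have hF : EqOn F (fun _ => F a) Ω := fun z hz =>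
    ((hFf ⟨z, hz⟩).trans (hconst _ _)).trans (hFf ⟨a, ha⟩).symm
  exact hF0 a ha ((hF.deriv hΩ ha).trans (deriv_const a _))

theorem mem_locallyUnivalentFunctions_of_mem_closure (hΩ : IsPlaneDomain Ω) {f : C(Ω, ℂ)}
    (hf : f ∈ closure (locallyUnivalentFunctions Ω)) {x y : Ω} (hxy : f x ≠ f y) :
    f ∈ locallyUnivalentFunctions Ω := by
  have : LocallyCompactSpace Ω := hΩ.1.locallyCompactSpace
  obtain ⟨s, hs, hsf⟩ := mem_closure_iff_seq_limit.1 hf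
  choose F hF hF0 hFs using hs
  let G : ℂ → ℂ := Function.extend Subtype.val f 0
  have hG : ∀ z : Ω, G z = f z := Subtype.val_injective.extend_apply _ _
  have hlim : TendstoLocallyUniformlyOn F G atTop Ω := by
    rw [tendstoLocallyUniformlyOn_iff_tendstoLocallyUniformly_comp_coe,
      show G ∘ (Subtype.val : Ω → ℂ) = f from funext hG,
      show (fun n (z : Ω) => F n z) = fun n z => s n z from funext fun n => funext (hFs n)]
    exact ContinuousMap.tendsto_iff_tendstoLocallyUniformly.1 hsf
  have hGd : DifferentiableOn ℂ G Ω := hlim.differentiableOn (.of_forall hF) hΩ.1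
  refine ⟨G, hGd, fun z hz hz0 => hxy ?_, hG⟩
  have hlocal : ∀ᶠ w in 𝓝 z, deriv G w = 0 := eventually_eq_zero_of_tendstoLocallyUniformlyOn hΩ.1
    (hlim.deriv (.of_forall hF) hΩ.1) (.of_forall fun n => (hF n).deriv hΩ.1)
    (.of_forall hF0) hz hz0
  have hglobal : EqOn (deriv G) 0 Ω :=
    ((hGd.deriv hΩ.1).analyticOnNhd hΩ.1).eqOn_zero_of_preconnected_of_eventuallyEq_zero
      hΩ.2.isPreconnected hz hlocal
  rw [← hG, ← hG]
  exact hΩ.1.is_const_of_deriv_eq_zero hΩ.2.isPreconnected hGd hglobal x.2 y.2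

/-- By Hurwitz' theorem the locally univalent functions are the nonconstant elements of their
closure, hence an open subset of a complete metrizable space. -/
theorem baireSpace_locallyUnivalentFunctions (hΩ : IsPlaneDomain Ω) :
    BaireSpace (locallyUnivalentFunctions Ω) := by
  have : LocallyCompactSpace Ω := hΩ.1.locallyCompactSpace
  have : CompleteSpace (closure (locallyUnivalentFunctions Ω)) :=
    isClosed_closure.completeSpace_coe
  have hrange : range (inclusion (subset_closure (s := locallyUnivalentFunctions Ω))) =
      Subtype.val ⁻¹' ⋃ x, ⋃ y, {f : C(Ω, ℂ) | f x ≠ f y} := by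
    rw [range_inclusion]
    ext f
    simp only [mem_preimage, mem_iUnion, mem_ofPred_eq]
    exact ⟨exists_ne_of_mem_locallyUnivalentFunctions hΩ.1 hΩ.2.nonempty, fun ⟨x, y, hxy⟩ =>
      mem_locallyUnivalentFunctions_of_mem_closure hΩ f.2 hxy⟩
  suffices hopen : IsOpen (range (inclusion (subset_closure (s := locallyUnivalentFunctions Ω))))
    from IsOpenEmbedding.baireSpace ⟨IsEmbedding.inclusion subset_closure, hopen⟩
  rw [hrange]
  exact (isOpen_iUnion fun x => isOpen_iUnion fun y => isOpen_ne_fun (continuous_eval_const x)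
    (continuous_eval_const y)).preimage continuous_subtype_val

theorem exists_isCompact_forall_norm_sub_lt_imp_mem {X E : Type*} [TopologicalSpace X]
    [SeminormedAddCommGroup E] {f : C(X, E)} {O : Set C(X, E)} (hO : O ∈ 𝓝 f) :
    ∃ K, IsCompact K ∧ ∃ ε > 0, ∀ h : C(X, E), (∀ z ∈ K, ‖h z - f z‖ < ε) → h ∈ O := by
  obtain ⟨⟨K, ε⟩, ⟨hK, hε⟩, hKO⟩ := (nhds_basis_uniformity'
    (uniformity_basis_dist.compactConvergenceUniformity (α := X))).mem_iff.1 hO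
  refine ⟨K, hK, ε, hε, fun h hh => hKO fun z hz => ?_⟩
  exact (dist_comm _ _).trans_lt ((dist_eq_norm _ _).trans_lt (hh z hz))

theorem isOpen_setOf_exists_comp_mem {X Y Z : Type*} [TopologicalSpace X] [TopologicalSpace Y]
    [TopologicalSpace Z] (Φ : Set C(X, Y)) {b : Set C(X, Z)} (hb : IsOpen b) :
    IsOpen {G : C(Y, Z) | ∃ φ ∈ Φ, G.comp φ ∈ b} := by
  simp only [← exists_prop, ofPred_exists]
  exact isOpen_biUnion fun φ _ => hb.preimage (ContinuousMap.continuous_precomp φ)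

theorem setOf_isUniversalIn_eq_biInter (hΩ : IsOpen Ω) {Φ : Set C(Ω, Ω)}
    (hΦ : Φ ⊆ locallyUnivalentSelfMaps Ω) {B : Set (Set C(Ω, ℂ))}
    (hB : TopologicalSpace.IsTopologicalBasis B) :
    {G : locallyUnivalentFunctions Ω |
      IsUniversalIn Φ (locallyUnivalentFunctions Ω) (G : C(Ω, ℂ))} =
    ⋂ b ∈ {b ∈ B | (b ∩ locallyUnivalentFunctions Ω).Nonempty},
      {G : locallyUnivalentFunctions Ω | ∃ φ ∈ Φ, (G : C(Ω, ℂ)).comp φ ∈ b} := by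
  ext G
  simp only [mem_iInter, mem_ofPred_eq]
  constructor
  · rintro ⟨-, -, hdense⟩ b ⟨hb, f, hfb, hf⟩
    obtain ⟨_, hφb, φ, hφ, rfl⟩ := hB.mem_closure_iff.1 (hdense hf) b hb hfb
    exact ⟨φ, hφ, hφb⟩
  · intro hG
    refine ⟨G.2, ?_, fun f hf => hB.mem_closure_iff.2 fun b hb hfb => ?_⟩
    · rintro _ ⟨φ, hφ, rfl⟩
      exact comp_mem_locallyUnivalentFunctions hΩ G.2 (hΦ hφ)
    · obtain ⟨φ, hφ, hφb⟩ := hG b ⟨hb, f, hfb, hf⟩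
      exact ⟨_, hφb, φ, hφ, rfl⟩

theorem dense_setOf_exists_comp_mem (hΩ : IsPlaneDomain Ω) {φ : ℕ → C(Ω, Ω)}
    (hφ : ∀ n, φ n ∈ locallyUnivalentSelfMaps Ω) (hinj : EventuallyInjective φ)
    (hconv : ∀ K : Set Ω, IsOConvexCompact K → ∀ N : ℕ, ∃ n ≥ N,
      (φ n '' K) ∩ K = ∅ ∧ IsOConvexCompact ((φ n '' K) ∪ K))
    {b : Set C(Ω, ℂ)} (hb : IsOpen b) (hbne : (b ∩ locallyUnivalentFunctions Ω).Nonempty) :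
    Dense {G : locallyUnivalentFunctions Ω | ∃ ψ ∈ range φ, (G : C(Ω, ℂ)).comp ψ ∈ b} := by
  refine dense_iff_inter_open.2 fun O hO ⟨f, hf⟩ => ?_
  obtain ⟨O', hO', rfl⟩ := isOpen_induced_iff.1 hO
  obtain ⟨g, hgb, hg⟩ := hbne
  obtain ⟨K, hK, ε, hε, hKO⟩ := exists_isCompact_forall_norm_sub_lt_imp_mem (hO'.mem_nhds hf)
  obtain ⟨L, hL, δ, hδ, hLb⟩ := exists_isCompact_forall_norm_sub_lt_imp_mem (hb.mem_nhds hgb)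
  obtain ⟨h, hh, n, happrox⟩ := exists_locallyUnivalent_approx hΩ hφ hinj hconv f.2 hg
    (hK.union hL) (lt_min hε hδ)
  exact ⟨⟨h, hh⟩, hKO h fun z hz => (happrox z (Or.inl hz)).1.trans_le (min_le_left _ _),
    φ n, ⟨n, rfl⟩, hLb _ fun z hz => (happrox z (Or.inr hz)).2.trans_le (min_le_right _ _)⟩

end UniversalFunctions

theorem mainTheorem7_general (Ω : Set ℂ) (hΩ : IsPlaneDomain Ω)
    (Φ : Set C(Ω, Ω)) (hΦ : Φ ⊆ locallyUnivalentSelfMaps Ω)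
    (hseq : ∃ φ : ℕ → C(Ω, Ω), (∀ n, φ n ∈ Φ) ∧ EventuallyInjective φ ∧
      ∀ K : Set Ω, IsOConvexCompact K → ∀ N : ℕ, ∃ n ≥ N,
        (φ n '' K) ∩ K = ∅ ∧ IsOConvexCompact ((φ n '' K) ∪ K)) :
    (∃ G : C(Ω, ℂ), IsUniversalIn Φ (locallyUnivalentFunctions Ω) G) ∧
    Dense {G : locallyUnivalentFunctions Ω |
      IsUniversalIn Φ (locallyUnivalentFunctions Ω) (G : C(Ω, ℂ))} ∧
    IsGδ {G : locallyUnivalentFunctions Ω |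
      IsUniversalIn Φ (locallyUnivalentFunctions Ω) (G : C(Ω, ℂ))} := by
  have : LocallyCompactSpace Ω := hΩ.1.locallyCompactSpace
  have : BaireSpace (locallyUnivalentFunctions Ω) := baireSpace_locallyUnivalentFunctions hΩ
  have : Nonempty (locallyUnivalentFunctions Ω) := ⟨⟨_, id_mem_locallyUnivalentFunctions⟩⟩
  obtain ⟨φ, hφ, hinj, hconv⟩ := hseq
  have hB := TopologicalSpace.isBasis_countableBasis C(Ω, ℂ)
  have hcount := (TopologicalSpace.countable_countableBasis C(Ω, ℂ)).mono
    (sep_subset _ fun b => (b ∩ locallyUnivalentFunctions Ω).Nonempty)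
  have hopen : ∀ b ∈ TopologicalSpace.countableBasis C(Ω, ℂ), IsOpen
      {G : locallyUnivalentFunctions Ω | ∃ ψ ∈ Φ, (G : C(Ω, ℂ)).comp ψ ∈ b} := fun b hb =>
    (isOpen_setOf_exists_comp_mem Φ (hB.isOpen hb)).preimage continuous_subtype_val
  have huniv := setOf_isUniversalIn_eq_biInter hΩ.1 hΦ hB
  have hdense : Dense {G : locallyUnivalentFunctions Ω |
      IsUniversalIn Φ (locallyUnivalentFunctions Ω) (G : C(Ω, ℂ))} := by
    rw [huniv]
    refine dense_biInter_of_isOpen (fun b hb => hopen b hb.1) hcount fun b hb => ?_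
    refine (dense_setOf_exists_comp_mem hΩ (fun n => hΦ (hφ n)) hinj hconv (hB.isOpen hb.1)
      hb.2).mono ?_
    rintro G ⟨_, ⟨n, rfl⟩, hmem⟩
    exact ⟨φ n, hφ n, hmem⟩
  obtain ⟨G, hG⟩ := hdense.nonempty
  exact ⟨⟨G, hG⟩, hdense, huniv ▸ IsGδ.biInter_of_isOpen hcount fun b hb => hopen b hb.1⟩

theorem mainTheorem7 (Ω : Set ℂ) (hΩ : IsPlaneDomain Ω) (hconn : HasInfiniteConnectivity Ω)
    (Φ : Set C(Ω, Ω)) (hΦ : Φ ⊆ locallyUnivalentSelfMaps Ω)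
    (hseq : ∃ φ : ℕ → C(Ω, Ω), (∀ n, φ n ∈ Φ) ∧ EventuallyInjective φ ∧
      ∀ K : Set Ω, IsOConvexCompact K → ∀ N : ℕ, ∃ n ≥ N,
        (φ n '' K) ∩ K = ∅ ∧ IsOConvexCompact ((φ n '' K) ∪ K)) :
    (∃ G : C(Ω, ℂ), IsUniversalIn Φ (locallyUnivalentFunctions Ω) G) ∧
    Dense {G : locallyUnivalentFunctions Ω |
      IsUniversalIn Φ (locallyUnivalentFunctions Ω) (G : C(Ω, ℂ))} ∧
    IsGδ {G : locallyUnivalentFunctions Ω |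
      IsUniversalIn Φ (locallyUnivalentFunctions Ω) (G : C(Ω, ℂ))} :=
  mainTheorem7_general Ω hΩ Φ hΦ hseq
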